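/- Let $K$ be a $2$-adic field, i.e. a finite extension of $\mathbb{Q}_2$, with absolute ramification index $e_K$ and residue field of cardinality $q$, and let $v_K$ be its normalised valuation. For a finite group $G$ and an integer $m \ge 0$, let $\Sigma_m^{G}$ be the set of $K$-isomorphism classes of totally ramified quartic field extensions $L/K$ whose discriminant ideal $d_{L/K}$ satisfies $v_K(d_{L/K}) = m$ and for which $\mathrm{Gal}(\widetilde{L}/K) \cong G$, where $\widetilde{L}$ is the normal closure of $L$ over $K$. Let $D_4$ be the dihedral group of order $8$, $C_4$ the cyclic group of order $4$ and $V_4$ the Klein four-group, and write $\mathbb{1}_{P}$ for $1$ if $P$ holds and $0$ otherwise. For every $m$ the sets $\Sigma_m^{D_4}$, $\Sigma_m^{C_4}$, $\Sigma_m^{V_4}$ are finite. If $\Sigma_m^{D_4}$ is nonempty, then one of the following holds: 1. $m$ is even and $6 \le m \le 8e_K + 2$; 2. $m \equiv 1 \pmod 4$ and $4e_K + 5 \le m \le 8e_K + 1$; 3. $m = 8e_K + 3$. For even $m$ with $6 \le m \le 8e_K + 2$, $$\#\Sigma_m^{D_4} = 2(q-1)q^{\frac m2 - 2}\Big(\mathbb{1}_{m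 \ge 4e_K+4}\, q^{-e_K} + \mathbb{1}_{m \le 8e_K}\big(q^{\min\{0,\, e_K + 1 - \lceil m/4\rceil\}} - q^{-\min\{\lfloor (m-2)/4\rfloor,\, e_K\}}\big)\Big) - \tfrac12 \#\Sigma_m^{C_4} - \tfrac32 \#\Sigma_m^{V_4}.$$ For $m \equiv 1 \pmod 4$ with $4e_K + 5 \le m \le 8e_K + 1$, $$\#\Sigma_m^{D_4} = 2(q-1)q^{e_K + \frac{m-1}{4} - 1} - \tfrac12 \#\Sigma_m^{C_4} - \tfrac32 \#\Sigma_m^{V_4}.$$ For $m = 8e_K + 3$, $$\#\Sigma_m^{D_4} = 2q^{3e_K} - \tfrac12 \#\Sigma_m^{C_4}.$$ -/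

import Mathlib

namespace TwoAdic

noncomputable section

/-- The ring of integers `𝒪_F` of an extension `F` of `ℚ₂`: the integral closure of `ℤ₂` in `F`. -/
def ringOfIntegers (F : Type*) [Field F] [Algebra ℚ_[2] F] : Subring F :=
  letI : Algebra ℤ_[2] F := ((algebraMap ℚ_[2] F).comp (algebraMap ℤ_[2] ℚ_[2])).toAlgebra
  (integralClosure ℤ_[2] F).toSubring

/-- `𝒪_F` is the closed unit ball of the unique extension to `F` of the absolute value of `ℚ₂`. -/
theorem mem_ringOfIntegers_iff {F : Type*} [Field F] [Algebra ℚ_[2] F]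
    [Algebra.IsAlgebraic ℚ_[2] F] (x : F) :
    x ∈ ringOfIntegers F ↔ spectralNorm ℚ_[2] F x ≤ 1 := by
  let : Algebra ℤ_[2] F := ((algebraMap ℚ_[2] F).comp (algebraMap ℤ_[2] ℚ_[2])).toAlgebra
  have : IsScalarTower ℤ_[2] ℚ_[2] F := IsScalarTower.of_algebraMap_eq fun _ => rfl
  have hx : IsIntegral ℚ_[2] x := Algebra.IsIntegral.isIntegral x
  change IsIntegral ℤ_[2] x ↔ spectralValue (minpoly ℚ_[2] x) ≤ 1
  rw [spectralValue_le_one_iff (minpoly.monic hx)]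
  constructor
  · intro h n
    rw [minpoly.isIntegrallyClosed_eq_field_fractions' ℚ_[2] h, Polynomial.coeff_map]
    exact PadicInt.norm_le_one _
  · intro h
    have hl : minpoly ℚ_[2] x ∈ Polynomial.lifts (algebraMap ℤ_[2] ℚ_[2]) := by
      rw [Polynomial.lifts_iff_coeff_lifts]
      intro n
      exact ⟨⟨_, h n⟩, rfl⟩
    obtain ⟨p, hp, -, hm⟩ := Polynomial.lifts_and_degree_eq_and_monic hl (minpoly.monic hx)
    refine ⟨p, hm, ?_⟩
    rw [← Polynomial.aeval_def, ← Polynomial.aeval_map_algebraMap ℚ_[2] x p, hp, minpoly.aeval]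

instance (F : Type*) [Field F] [Algebra ℚ_[2] F] [Algebra.IsAlgebraic ℚ_[2] F] :
    IsLocalRing (ringOfIntegers F) := by
  refine IsLocalRing.of_isUnit_or_isUnit_one_sub_self fun a => ?_
  have key : ∀ b : ringOfIntegers F, spectralNorm ℚ_[2] F (b : F) = 1 → IsUnit b := by
    intro b hb
    have hb0 : (b : F) ≠ 0 := by
      intro h
      rw [h, spectralNorm_zero] at hb
      exact zero_ne_one hb
    have hmul := spectralAlgNorm_mul (K := ℚ_[2]) (b : F) (b : F)⁻¹
    simp only [spectralAlgNorm_def] at hmul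
    rw [mul_inv_cancel₀ hb0, spectralNorm_one, hb, one_mul] at hmul
    exact IsUnit.of_mul_eq_one ⟨(b : F)⁻¹, (mem_ringOfIntegers_iff _).2 hmul.symm.le⟩
      (Subtype.ext (mul_inv_cancel₀ hb0))
  by_contra hcon
  rw [not_or] at hcon
  have h1 := lt_of_le_of_ne ((mem_ringOfIntegers_iff _).1 a.2) fun h => hcon.1 (key _ h)
  have h2 := lt_of_le_of_ne ((mem_ringOfIntegers_iff _).1 (1 - a).2) fun h => hcon.2 (key _ h)
  have h3 := isNonarchimedean_spectralNorm (K := ℚ_[2]) (L := F) (a : F) ((1 - a : _) : F)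
  have h4 : (a : F) + ((1 - a : ringOfIntegers F) : F) = 1 := by push_cast; ring
  rw [h4, spectralNorm_one] at h3
  exact absurd h3 (not_le.2 (max_lt h1 h2))

section BaseField

variable (K : Type*) [Field K] [Algebra ℚ_[2] K] [FiniteDimensional ℚ_[2] K]

/-- The maximal ideal `𝔭_K` of `𝒪_K`. -/
abbrev maxIdeal : Ideal (ringOfIntegers K) :=
  IsLocalRing.maximalIdeal (ringOfIntegers K)

/-- `q`, the cardinality of the residue field of `K`. -/
def residueCard : ℕ := Nat.card (IsLocalRing.ResidueField (ringOfIntegers K))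

/-- The normalised valuation `v_K` on ideals of `𝒪_K`:
the largest `n` such that `𝔭_K ^ n` divides the ideal. -/
def idealVal (I : Ideal (ringOfIntegers K)) : ℕ∞ := emultiplicity (maxIdeal K) I

/-- `e_K`, the absolute ramification index: the exponent of `𝔭_K` in the ideal `2 𝒪_K`. -/
def absRamificationIdx : ℕ := (idealVal K (Ideal.span {2})).toNat

variable (L : Type*) [Field L] [Algebra K L]

/-- The discriminant ideal `d_{L/K}`: the ideal of `𝒪_K` generated by the discriminants of all
`K`-bases of `L` that consist of integral elements. -/
def discIdeal : Ideal (ringOfIntegers K) :=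
  Ideal.span {a | ∃ b : Module.Basis (Fin (Module.finrank K L)) K L,
    (∀ i, IsIntegral (ringOfIntegers K) (b i)) ∧ (a : K) = Algebra.discr K b}

/-- `L/K` is totally ramified: `𝔭_K 𝒪_L = 𝔭_L ^ [L : K]`, where `𝒪_L` is the integral closure
of `𝒪_K` in `L`. -/
def IsTotallyRamified : Prop :=
  ∃ P : Ideal (integralClosure (ringOfIntegers K) L), P.IsMaximal ∧
    (maxIdeal K).map (algebraMap (ringOfIntegers K) (integralClosure (ringOfIntegers K) L)) =
      P ^ Module.finrank K L

/-- The Galois closure group `Gal(L̃/K)`, where `L̃` is the normal closure of `L` over `K`. -/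
abbrev GaloisClosureGroup : Type _ :=
  IntermediateField.normalClosure K L (AlgebraicClosure L) ≃ₐ[K]
    IntermediateField.normalClosure K L (AlgebraicClosure L)

/-- `L/K` is a totally ramified quartic extension with `v_K(d_{L/K}) = m` and Galois closure group
isomorphic to `G`. -/
def IsQuarticOfType (G : Type) [Group G] (m : ℕ) : Prop :=
  Module.finrank K L = 4 ∧ IsTotallyRamified K L ∧ idealVal K (discIdeal K L) = m ∧
    Nonempty (GaloisClosureGroup K L ≃* G)

/-- `K`-isomorphism of extensions of `K` inside an algebraic closure. -/
def isoSetoid : Setoid (IntermediateField K (AlgebraicClosure K)) where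
  r L L' := Nonempty (L ≃ₐ[K] L')
  iseqv := ⟨fun _ => ⟨AlgEquiv.refl⟩, fun ⟨f⟩ => ⟨f.symm⟩, fun ⟨f⟩ ⟨g⟩ => ⟨f.trans g⟩⟩

/-- `Σ_m^G`: the set of isomorphism classes of totally ramified quartic extensions `L/K` with
`v_K(d_{L/K}) = m` and Galois closure group isomorphic to `G`. (Every algebraic extension of `K`
is isomorphic to one inside the algebraic closure of `K`.) -/
def SigmaSet (G : Type) [Group G] (m : ℕ) : Set (Quotient (isoSetoid K)) :=
  {c | ∃ L : IntermediateField K (AlgebraicClosure K),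
    Quotient.mk (isoSetoid K) L = c ∧ IsQuarticOfType K L G m}

end BaseField

/-- The dihedral group of order `8`. -/
abbrev D4 : Type := DihedralGroup 4

/-- The cyclic group of order `4`. -/
abbrev C4 : Type := Multiplicative (ZMod 4)

/-- The Klein four-group. -/
abbrev V4 : Type := Multiplicative (ZMod 2) × Multiplicative (ZMod 2)

end

end TwoAdic

/-! The proof counts, in two ways, the towers `K ⊂ F ⊂ L` inside an algebraic closure, where `F/K`
is quadratic and `L/K` is totally ramified quartic with discriminant exponent `m`.

Grouping by `L`: a quartic extension with a quadratic subfield is Galois with group `C4` or `V4`, or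
its closure has group `D4`, and conversely these three types all have quadratic subfields. The
number of such subfields is 1 for `D4` and `C4` and 3 for `V4`. A `D4` field has two automorphisms,
so its isomorphism class has two members in the closure; a Galois class has one. Hence the number of
towers is `2 #D4 + #C4 + 3 #V4` (`ncard_towers_eq`).

Grouping by `F`: both steps are totally ramified, `F` has ramification index `2e` and the same `q`,
and transitivity of discriminants gives `m = 2a + b`, with `a` and `b` the exponents of `F/K` and
`L/F`. If `N(e, n)` is the number of totally ramified quadratic extensions of discriminant exponent
`n`, the number of towers is the sum over `a` of `N(e, a) N(2e, m - 2a)` (`quarticSet_above`,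
`towers_card`).

By Kummer theory, quadratic extensions are the nontrivial classes of `Kˣ` modulo squares. Filter
these by the images of the higher unit groups. A class of odd valuation gives exponent `2e + 1`; a
class of level exactly `2k`, meaning in step `2k` but not in step `2k + 2` with `k < e`, gives `2(e
- k)`; a nontrivial class in step `2e` gives an extension that is not totally ramified. The graded
pieces have order 2 (parity of the valuation), then `q` at each odd level below `2e` and 1 at each
even one, and finally 2 at level `2e` (cokernel of `z ↦ z² + z` on the residue field). So `N(e, 2e +
1) = 2q^e` and `N(e, 2j) = 2(q - 1)q^(j - 1)` for `1 ≤ j ≤ e` (`quadSet_card`).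

What remains is a geometric sum. For `m = 8e + 3` the `V4` term vanishes: all three quadratic
subfields would come from classes of odd valuation, but the product of two such classes has even
valuation. -/

namespace TwoAdic

set_option linter.unusedSectionVars false

/-! ### The absolute value, the valuation ring and uniformizers -/

noncomputable section

/-- The absolute value on an algebraic extension of `ℚ₂` that extends the one of `ℚ₂`. -/
def absVal (F : Type*) [Field F] [Algebra ℚ_[2] F] [Algebra.IsAlgebraic ℚ_[2] F] : F →*₀ ℝ where
  toFun := spectralNorm ℚ_[2] F
  map_zero' := spectralNorm_zero
  map_one' := spectralNorm_one
  map_mul' x y := spectralAlgNorm_mul (K := ℚ_[2]) x y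

section Basic

variable {F : Type*} [Field F] [Algebra ℚ_[2] F] [Algebra.IsAlgebraic ℚ_[2] F]

theorem absVal_apply (x : F) : absVal F x = spectralNorm ℚ_[2] F x := rfl

theorem absVal_nonneg (x : F) : 0 ≤ absVal F x := spectralNorm_nonneg x

theorem absVal_pos {x : F} (hx : x ≠ 0) : 0 < absVal F x :=
  (absVal_nonneg x).lt_of_ne' ((map_ne_zero _).2 hx)

theorem absVal_add_le (x y : F) : absVal F (x + y) ≤ max (absVal F x) (absVal F y) :=
  isNonarchimedean_spectralNorm x y

@[simp]
theorem absVal_neg (x : F) : absVal F (-x) = absVal F x :=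
  spectralNorm_neg (Algebra.IsAlgebraic.isAlgebraic x)

theorem absVal_sub_le (x y : F) : absVal F (x - y) ≤ max (absVal F x) (absVal F y) := by
  simpa [sub_eq_add_neg] using absVal_add_le x (-y)

theorem absVal_sub_comm (x y : F) : absVal F (x - y) = absVal F (y - x) := by
  rw [← absVal_neg, neg_sub]

theorem absVal_add_eq_of_lt {x y : F} (h : absVal F x < absVal F y) :
    absVal F (x + y) = absVal F y := by
  refine le_antisymm ((absVal_add_le x y).trans_eq (max_eq_right h.le)) ?_
  have := absVal_sub_le (x + y) x
  rw [add_sub_cancel_left] at this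
  exact (le_max_iff.1 this).resolve_right (not_le.2 h)

theorem absVal_add_eq_of_gt {x y : F} (h : absVal F y < absVal F x) :
    absVal F (x + y) = absVal F x := by
  rw [add_comm, absVal_add_eq_of_lt h]

theorem absVal_add_eq_max {x y : F} (h : absVal F x ≠ absVal F y) :
    absVal F (x + y) = max (absVal F x) (absVal F y) := by
  rcases h.lt_or_gt with h | h
  · rw [absVal_add_eq_of_lt h, max_eq_right h.le]
  · rw [absVal_add_eq_of_gt h, max_eq_left h.le]

theorem absVal_algebraMap_padic (x : ℚ_[2]) : absVal F (algebraMap ℚ_[2] F x) = ‖x‖ :=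
  spectralNorm_extends x

theorem absVal_two : absVal F 2 = 1 / 2 := by
  have h := absVal_algebraMap_padic (F := F) ((2 : ℕ) : ℚ_[2])
  rw [Padic.norm_p, map_natCast] at h
  simpa using h

theorem charZero_of_algebra_padic (F : Type*) [Field F] [Algebra ℚ_[2] F] : CharZero F :=
  charZero_of_injective_algebraMap (algebraMap ℚ_[2] F).injective

theorem mem_ringOfIntegers_iff_absVal (x : F) : x ∈ ringOfIntegers F ↔ absVal F x ≤ 1 :=
  mem_ringOfIntegers_iff x

theorem absVal_coe_le_one (x : ringOfIntegers F) : absVal F x ≤ 1 :=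
  (mem_ringOfIntegers_iff_absVal _).1 x.2

theorem isUnit_iff_absVal (x : ringOfIntegers F) : IsUnit x ↔ absVal F x = 1 := by
  constructor
  · rintro ⟨u, rfl⟩
    have h : absVal F ((u : ringOfIntegers F) : F) *
        absVal F (((u⁻¹ : (ringOfIntegers F)ˣ) : ringOfIntegers F) : F) = 1 := by
      rw [← map_mul, ← Subring.coe_mul, Units.mul_inv, Subring.coe_one, map_one]
    nlinarith [absVal_coe_le_one (u : ringOfIntegers F), absVal_nonneg ((u : ringOfIntegers F) : F),
      absVal_coe_le_one ((u⁻¹ : (ringOfIntegers F)ˣ) : ringOfIntegers F)]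
  · intro h
    have h0 : (x : F) ≠ 0 := by
      intro h0
      simp [h0] at h
    exact IsUnit.of_mul_eq_one ⟨(x : F)⁻¹, (mem_ringOfIntegers_iff_absVal _).2 (by simp [h])⟩
      (Subtype.ext (mul_inv_cancel₀ h0))

theorem mem_maximalIdeal_iff_absVal (x : ringOfIntegers F) :
    x ∈ IsLocalRing.maximalIdeal (ringOfIntegers F) ↔ absVal F x < 1 := by
  rw [IsLocalRing.mem_maximalIdeal, mem_nonunits_iff, isUnit_iff_absVal,
    lt_iff_le_and_ne, and_iff_right (absVal_coe_le_one x)]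

theorem residue_eq_residue_iff_absVal (x y : ringOfIntegers F) :
    IsLocalRing.residue (ringOfIntegers F) x = IsLocalRing.residue _ y ↔
      absVal F (x - y : F) < 1 := by
  rw [← sub_eq_zero, ← map_sub, IsLocalRing.residue_eq_zero_iff, mem_maximalIdeal_iff_absVal]
  rfl

/-- A uniformizer of a discretely valued algebraic extension of `ℚ₂`. -/
structure IsUniformizer (p : F) : Prop where
  ne_zero : p ≠ 0
  lt_one : absVal F p < 1
  le : ∀ x : F, absVal F x < 1 → absVal F x ≤ absVal F p

namespace IsUniformizer

variable {p : F} (hp : IsUniformizer p)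

include hp

theorem pos : 0 < absVal F p := absVal_pos hp.ne_zero

theorem exists_zpow {x : F} (hx : x ≠ 0) : ∃ n : ℤ, absVal F x = absVal F p ^ n := by
  obtain ⟨n, hn, hn'⟩ := exists_mem_Ico_zpow (absVal_pos hx) (one_lt_inv₀ hp.pos |>.2 hp.lt_one)
  refine ⟨-n, le_antisymm ?_ ?_⟩
  swap
  · simpa using hn
  -- The bracket gives `|x p^(n+1)| < 1`, hence `≤ |p|` by maximality of `|p|`; cancelling one
  -- factor turns the lower bound on `|x|` into an equality.
  have hlt : absVal F (x * p ^ (n + 1)) < 1 := by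
    rw [map_mul, map_zpow₀]
    rw [inv_zpow] at hn'
    rwa [← one_div, lt_div_iff₀ (zpow_pos hp.pos _)] at hn'
  have h := hp.le _ hlt
  rw [map_mul, map_zpow₀, zpow_add_one₀ hp.pos.ne', ← mul_assoc] at h
  have h1 : absVal F x * absVal F p ^ n ≤ 1 := by
    have := hp.pos
    nlinarith
  rw [zpow_neg]
  exact (le_inv_mul_iff₀ (zpow_pos hp.pos _)).2 (by rwa [mul_comm]) |>.trans_eq (mul_one _)

theorem exists_pow {x : F} (hx : x ≠ 0) (hx1 : absVal F x ≤ 1) :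
    ∃ n : ℕ, absVal F x = absVal F p ^ n := by
  obtain ⟨n, hn⟩ := hp.exists_zpow hx
  have : 0 ≤ n := by
    rw [hn, ← zpow_zero (absVal F p)] at hx1
    exact (zpow_le_zpow_iff_right_of_lt_one₀ hp.pos hp.lt_one).1 hx1
  lift n to ℕ using this
  exact ⟨n, by simpa using hn⟩

theorem zpow_inj {m n : ℤ} : absVal F p ^ m = absVal F p ^ n ↔ m = n :=
  zpow_right_inj₀ hp.pos hp.lt_one.ne

theorem pow_inj {m n : ℕ} : absVal F p ^ m = absVal F p ^ n ↔ m = n := by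
  exact_mod_cast hp.zpow_inj (m := m) (n := n)

theorem pow_lt {m n : ℕ} : absVal F p ^ m < absVal F p ^ n ↔ n < m :=
  pow_lt_pow_iff_right_of_lt_one₀ hp.pos hp.lt_one

theorem pow_le {m n : ℕ} : absVal F p ^ m ≤ absVal F p ^ n ↔ n ≤ m :=
  pow_le_pow_iff_right_of_lt_one₀ hp.pos hp.lt_one

theorem le_pow_succ {x : F} {n : ℕ} (h : absVal F x < absVal F p ^ n) :
    absVal F x ≤ absVal F p ^ (n + 1) := by
  have := hp.le (x / p ^ n) (by
    rw [map_div₀, map_pow]; exact (div_lt_one (pow_pos hp.pos _)).2 h)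
  rw [map_div₀, map_pow, div_le_iff₀ (pow_pos hp.pos _)] at this
  rwa [pow_succ']

theorem absVal_eq {p' : F} (hp' : IsUniformizer p') : absVal F p = absVal F p' :=
  le_antisymm (hp'.le _ hp.lt_one) (hp.le _ hp'.lt_one)

theorem mem : p ∈ ringOfIntegers F := (mem_ringOfIntegers_iff_absVal _).2 hp.lt_one.le

theorem maximalIdeal_eq_span :
    IsLocalRing.maximalIdeal (ringOfIntegers F) = Ideal.span {⟨p, hp.mem⟩} := by
  ext y
  rw [mem_maximalIdeal_iff_absVal, Ideal.mem_span_singleton]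
  constructor
  · intro h
    refine ⟨⟨y / p, ?_⟩, Subtype.ext ?_⟩
    · rw [mem_ringOfIntegers_iff_absVal, map_div₀]
      exact div_le_one_of_le₀ (hp.le _ h) hp.pos.le
    · exact (mul_div_cancel₀ _ hp.ne_zero).symm
  · rintro ⟨z, rfl⟩
    rw [Subring.coe_mul, map_mul]
    nlinarith [hp.lt_one, absVal_coe_le_one z, absVal_nonneg (z : F), hp.pos]

theorem mem_pow_iff (x : ringOfIntegers F) (n : ℕ) :
    x ∈ IsLocalRing.maximalIdeal (ringOfIntegers F) ^ n ↔ absVal F x ≤ absVal F p ^ n := by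
  rw [hp.maximalIdeal_eq_span, Ideal.span_singleton_pow, Ideal.mem_span_singleton]
  constructor
  · rintro ⟨z, rfl⟩
    rw [Subring.coe_mul, map_mul, Subring.coe_pow, map_pow]
    exact mul_le_of_le_one_right (pow_nonneg hp.pos.le _) (absVal_coe_le_one z)
  · intro h
    refine ⟨⟨x / p ^ n, ?_⟩, Subtype.ext ?_⟩
    · rw [mem_ringOfIntegers_iff_absVal, map_div₀, map_pow]
      exact div_le_one_of_le₀ h (pow_nonneg hp.pos.le _)
    · exact (mul_div_cancel₀ _ (pow_ne_zero n hp.ne_zero)).symm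

end IsUniformizer

end Basic

theorem absVal_map_padic {L L' : Type*} [Field L] [Algebra ℚ_[2] L] [Algebra.IsAlgebraic ℚ_[2] L]
    [Field L'] [Algebra ℚ_[2] L'] [Algebra.IsAlgebraic ℚ_[2] L'] (f : L →ₐ[ℚ_[2]] L') (x : L) :
    absVal L' (f x) = absVal L x := by
  rw [absVal_apply, absVal_apply, spectralNorm, spectralNorm, minpoly.algHom_eq f f.injective]

theorem absVal_map {K L L' : Type*} [Field K] [Algebra ℚ_[2] K] [Field L] [Algebra ℚ_[2] L]
    [Algebra.IsAlgebraic ℚ_[2] L] [Field L'] [Algebra ℚ_[2] L'] [Algebra.IsAlgebraic ℚ_[2] L']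
    [Algebra K L] [IsScalarTower ℚ_[2] K L] [Algebra K L'] [IsScalarTower ℚ_[2] K L']
    (f : L →ₐ[K] L') (x : L) : absVal L' (f x) = absVal L x :=
  absVal_map_padic (f.restrictScalars ℚ_[2]) x

section Extension

variable {K L : Type*} [Field K] [Algebra ℚ_[2] K] [Field L] [Algebra ℚ_[2] L]
  [Algebra.IsAlgebraic ℚ_[2] K] [Algebra.IsAlgebraic ℚ_[2] L]
  [Algebra K L] [IsScalarTower ℚ_[2] K L]

@[simp]
theorem absVal_algebraMap (x : K) : absVal L (algebraMap K L x) = absVal K x :=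
  (spectralNorm.eq_of_tower x).symm

variable (K) in
-- The norm is the product over the embeddings into an algebraic closure, and each embedding
-- preserves the absolute value because it preserves minimal polynomials.
theorem absVal_norm [FiniteDimensional K L] (x : L) :
    absVal K (Algebra.norm K x) = absVal L x ^ Module.finrank K L := by
  have : CharZero K := charZero_of_algebra_padic K
  have : Algebra.IsAlgebraic ℚ_[2] (AlgebraicClosure K) := Algebra.IsAlgebraic.trans ℚ_[2] K _
  rw [← absVal_algebraMap (L := AlgebraicClosure K), Algebra.norm_eq_prod_embeddings, map_prod,
    Finset.prod_congr rfl fun σ _ => absVal_map σ x, Finset.prod_const, Finset.card_univ,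
    AlgHom.card]

end Extension

/-! ### Discreteness of the valuation and finiteness of the residue field -/

section Discrete

variable (K : Type*) [Field K] [Algebra ℚ_[2] K] [FiniteDimensional ℚ_[2] K]

/-- Through the norm to `ℚ₂`, the power `|x| ^ [K : ℚ₂]` is an integral power of `1/2`. Among the
nonzero `x` with `|x| < 1`, of which 2 is one, an element of least exponent is a uniformizer. -/
theorem exists_isUniformizer : ∃ p : K, IsUniformizer p := by
  have hn : Module.finrank ℚ_[2] K ≠ 0 := Module.finrank_pos.ne'
  have key : ∀ x : K, x ≠ 0 → absVal K x < 1 →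
      ∃ n : ℕ, absVal K x ^ Module.finrank ℚ_[2] K = ((2 : ℝ)⁻¹) ^ n := by
    intro x hx h1
    have h := absVal_norm ℚ_[2] x
    have hN : absVal ℚ_[2] (Algebra.norm ℚ_[2] x) = ‖Algebra.norm ℚ_[2] x‖ :=
      absVal_algebraMap_padic (F := ℚ_[2]) _
    have h0 : Algebra.norm ℚ_[2] x ≠ 0 := (Algebra.norm_ne_zero_iff).2 hx
    rw [hN, Padic.norm_eq_zpow_neg_valuation h0] at h
    have hlt : absVal K x ^ Module.finrank ℚ_[2] K < 1 := pow_lt_one₀ (absVal_nonneg x) h1 hn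
    rw [← h] at hlt
    have h2 : 0 ≤ (Algebra.norm ℚ_[2] x).valuation := by
      by_contra hc
      push Not at hc
      exact absurd hlt (not_lt.2 (one_le_zpow₀ (by norm_num) (by omega)))
    lift (Algebra.norm ℚ_[2] x).valuation to ℕ using h2 with k
    exact ⟨k, by rw [← h]; simp⟩
  classical
  have hex : ∃ n : ℕ, ∃ x : K, x ≠ 0 ∧ absVal K x < 1 ∧
      absVal K x ^ Module.finrank ℚ_[2] K = ((2 : ℝ)⁻¹) ^ n := by
    have h2 : (2 : K) ≠ 0 := by
      have := charZero_of_algebra_padic K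
      exact two_ne_zero
    have h3 : absVal K 2 < 1 := by rw [absVal_two]; norm_num
    obtain ⟨n, hn⟩ := key 2 h2 h3
    exact ⟨n, 2, h2, h3, hn⟩
  obtain ⟨p, h0, h1, hp⟩ := Nat.find_spec hex
  refine ⟨p, h0, h1, fun x hx => ?_⟩
  by_cases hx0 : x = 0
  · simp [hx0, absVal_nonneg]
  obtain ⟨n, hxn⟩ := key x hx0 hx
  have hle : Nat.find hex ≤ n := Nat.find_min' hex ⟨x, hx0, hx, hxn⟩
  refine le_of_pow_le_pow_left₀ hn (absVal_nonneg p) ?_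
  rw [hxn, hp]
  exact pow_le_pow_of_le_one (by norm_num) (by norm_num) hle

variable {K}

theorem IsUniformizer.idealVal_span_eq_iff {p : K} (hp : IsUniformizer p) (x : ringOfIntegers K)
    (n : ℕ) : idealVal K (Ideal.span {x}) = n ↔ absVal K x = absVal K p ^ n := by
  have hdvd : ∀ k : ℕ, maxIdeal K ^ k ∣ Ideal.span {x} ↔ absVal K x ≤ absVal K p ^ k := by
    intro k
    rw [← hp.mem_pow_iff x k]
    constructor
    · intro h
      exact (Ideal.span_singleton_le_iff_mem _).1 (Ideal.le_of_dvd h)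
    · intro h
      rw [hp.mem_pow_iff] at h
      have hx : x = ⟨p, hp.mem⟩ ^ k * ⟨x / p ^ k, (mem_ringOfIntegers_iff_absVal _).2 (by
          rw [map_div₀, map_pow]; exact div_le_one_of_le₀ h (pow_nonneg hp.pos.le _))⟩ :=
        Subtype.ext (mul_div_cancel₀ _ (pow_ne_zero k hp.ne_zero)).symm
      rw [hx, maxIdeal, hp.maximalIdeal_eq_span, Ideal.span_singleton_pow, ← Ideal.span_singleton_mul_span_singleton]
      exact dvd_mul_right _ _
  rw [idealVal, emultiplicity_eq_coe, hdvd, hdvd]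
  constructor
  · rintro ⟨h1, h2⟩
    refine le_antisymm h1 (le_of_not_gt fun h => h2 (hp.le_pow_succ h))
  · intro h
    rw [h, hp.pow_le, hp.pow_le]
    exact ⟨le_rfl, by omega⟩

/-- Since `2 ≠ 0`, its valuation is finite, so the `toNat` in `absRamificationIdx` loses nothing. -/
theorem IsUniformizer.absVal_two_eq {p : K} (hp : IsUniformizer p) :
    absVal K 2 = absVal K p ^ absRamificationIdx K := by
  have := charZero_of_algebra_padic K
  obtain ⟨n, hn⟩ := hp.exists_pow (two_ne_zero (α := K)) (by rw [absVal_two]; norm_num)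
  have h := (hp.idealVal_span_eq_iff (2 : ringOfIntegers K) n).2 hn
  rw [absRamificationIdx, h]
  exact hn

variable (K) in
theorem absRamificationIdx_pos : 0 < absRamificationIdx K := by
  obtain ⟨p, hp⟩ := exists_isUniformizer K
  refine Nat.pos_of_ne_zero fun h => ?_
  have := hp.absVal_two_eq
  rw [h, pow_zero, absVal_two] at this
  norm_num at this

variable (K) in
theorem finite_residueField : Finite (IsLocalRing.ResidueField (ringOfIntegers K)) := by
  let _ : Algebra ℤ_[2] K := ((algebraMap ℚ_[2] K).comp (algebraMap ℤ_[2] ℚ_[2])).toAlgebra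
  have : IsScalarTower ℤ_[2] ℚ_[2] K := IsScalarTower.of_algebraMap_eq fun _ => rfl
  have hfin : Module.Finite ℤ_[2] (integralClosure ℤ_[2] K) :=
    IsIntegralClosure.finite ℤ_[2] ℚ_[2] K _
  have hloc : IsLocalRing (integralClosure ℤ_[2] K) :=
    inferInstanceAs (IsLocalRing (ringOfIntegers K))
  have hhom : IsLocalHom (algebraMap ℤ_[2] (integralClosure ℤ_[2] K)) := by
    refine ⟨fun x hx => ?_⟩
    have h := (isUnit_iff_absVal (F := K) (algebraMap ℤ_[2] (integralClosure ℤ_[2] K) x)).1 hx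
    have h2 : absVal K (algebraMap ℚ_[2] K (x : ℚ_[2])) = 1 := h
    rw [absVal_algebraMap_padic] at h2
    exact PadicInt.isUnit_iff.2 h2
  have : Finite (IsLocalRing.ResidueField ℤ_[2]) :=
    Finite.of_equiv (ZMod 2) PadicInt.residueField.symm.toEquiv
  exact IsLocalRing.ResidueField.finite_of_finite
    (R := ℤ_[2]) (S := integralClosure ℤ_[2] K) this

end Discrete

end

noncomputable section

/-! ### Transitivity of discriminants -/

section DiscrTower

open Matrix Kronecker in
/-- The discriminant of a product basis in a tower of fields. -/
theorem discr_smulTower' {K F L ι κ : Type*} [Field K] [Field F] [Field L] [Algebra K F]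
    [Algebra F L] [Algebra K L] [IsScalarTower K F L] [Fintype ι] [DecidableEq ι] [Fintype κ]
    [DecidableEq κ] (b : Module.Basis ι K F) (c : Module.Basis κ F L) :
    Algebra.discr K (b.smulTower' c) =
      Algebra.discr K b ^ Fintype.card κ * Algebra.norm K (Algebra.discr F c) := by
  have : FiniteDimensional K F := b.finiteDimensional_of_finite
  have : FiniteDimensional F L := c.finiteDimensional_of_finite
  -- By transitivity of the trace, the block at `(k, l)` is the trace matrix of `b` times the matrix
  -- of multiplication by `Tr(c k * c l)`. These multiplication matrices commute, so the determinant
  -- can be taken first over `F` and then over `K`, which produces the norm.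
  have hM : Algebra.traceMatrix K (b.smulTower' c) =
      ((1 : Matrix κ κ K) ⊗ₖ Algebra.traceMatrix K b) *
        ((Algebra.traceMatrix F c).map (Algebra.leftMulMatrix b)).comp κ κ ι ι K := by
    ext ⟨k, i⟩ ⟨l, j⟩
    rw [Matrix.mul_apply, Fintype.sum_prod_type]
    simp only [Algebra.traceMatrix_apply, Algebra.traceForm_apply, Module.Basis.smulTower'_apply,
      Matrix.kroneckerMap_apply, Matrix.one_apply, Matrix.comp_apply, Matrix.map_apply, ite_mul,
      one_mul, zero_mul, Finset.sum_ite_irrel, Finset.sum_const_zero, Finset.sum_ite_eq,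
      Finset.mem_univ, if_true]
    rw [smul_mul_smul_comm, ← Algebra.trace_trace (S := F), map_smul, smul_eq_mul]
    set t := Algebra.trace F L (c k * c l)
    have h : t * b j = ∑ h, Algebra.leftMulMatrix b t h j • b h := by
      conv_lhs => rw [← b.sum_repr (t * b j)]
      simp [Algebra.leftMulMatrix_apply, LinearMap.toMatrix_apply]
    have h2 : b i * b j * t = ∑ h, Algebra.leftMulMatrix b t h j • (b i * b h) := by
      rw [mul_assoc, mul_comm (b j), h, Finset.mul_sum]
      simp only [mul_smul_comm]
    rw [h2, map_sum]
    simp only [map_smul, smul_eq_mul, mul_comm]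
  rw [Algebra.discr_def, hM, Matrix.det_mul, Matrix.det_kronecker, Matrix.det_one, one_pow, one_mul,
    ← Algebra.discr_def, Algebra.norm_eq_matrix_det b, Algebra.discr_def]
  congr 1
  exact (Matrix.det_det (Algebra.traceMatrix F c) (Algebra.leftMulMatrix b).toRingHom).symm

end DiscrTower

/-! ### Total ramification and the discriminant ideal in terms of the absolute value -/

section Extension

variable {K : Type*} [Field K] [Algebra ℚ_[2] K] [FiniteDimensional ℚ_[2] K]
  {L : Type*} [Field L] [Algebra ℚ_[2] L] [FiniteDimensional ℚ_[2] L]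
  [Algebra K L] [IsScalarTower ℚ_[2] K L]

omit [FiniteDimensional ℚ_[2] K] in
theorem isIntegral_iff_absVal (x : L) : IsIntegral (ringOfIntegers K) x ↔ absVal L x ≤ 1 := by
  let _ : Algebra ℤ_[2] K := ((algebraMap ℚ_[2] K).comp (algebraMap ℤ_[2] ℚ_[2])).toAlgebra
  let _ : Algebra ℤ_[2] L := ((algebraMap ℚ_[2] L).comp (algebraMap ℤ_[2] ℚ_[2])).toAlgebra
  have : IsScalarTower ℤ_[2] ℚ_[2] L := IsScalarTower.of_algebraMap_eq fun _ => rfl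
  have : IsScalarTower ℤ_[2] K L := IsScalarTower.of_algebraMap_eq fun x => by
    change algebraMap ℚ_[2] L _ = algebraMap K L (algebraMap ℚ_[2] K _)
    exact IsScalarTower.algebraMap_apply ℚ_[2] K L _
  change IsIntegral (integralClosure ℤ_[2] K) x ↔ _
  rw [← mem_ringOfIntegers_iff_absVal]
  change _ ↔ IsIntegral ℤ_[2] x
  exact ⟨fun h => isIntegral_trans x h, fun h => h.tower_top⟩

variable [FiniteDimensional K L]

/-- The ramification index of `L/K` divides the degree. -/
theorem exists_absVal_eq_pow {p : K} (hp : IsUniformizer p) {P : L} (hP : IsUniformizer P) :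
    ∃ i, i ∣ Module.finrank K L ∧ absVal K p = absVal L P ^ i := by
  obtain ⟨i, hi⟩ := hP.exists_pow (x := algebraMap K L p) (by simpa using hp.ne_zero)
    (by simpa using hp.lt_one.le)
  rw [absVal_algebraMap] at hi
  refine ⟨i, ?_, hi⟩
  obtain ⟨k, hk⟩ := hp.exists_pow (x := Algebra.norm K P) (Algebra.norm_ne_zero_iff.2 hP.ne_zero)
    (by rw [absVal_norm]; exact pow_le_one₀ hP.pos.le hP.lt_one.le)
  rw [absVal_norm, hi, ← pow_mul, hP.pow_inj] at hk
  exact ⟨k, hk⟩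

/-- Compare with a uniformizer `Q` of `L`: if `|p| = |Q|^i` with `i` dividing the degree `n`, and
`|P| = |Q|^j`, then `jn = i`, which forces `j = 1`. -/
theorem IsUniformizer.of_pow_finrank {p : K} (hp : IsUniformizer p) {P : L}
    (h : absVal L P ^ Module.finrank K L = absVal K p) : IsUniformizer P := by
  obtain ⟨Q, hQ⟩ := exists_isUniformizer L
  obtain ⟨i, hi, hpi⟩ := exists_absVal_eq_pow hp hQ
  have hn : Module.finrank K L ≠ 0 := Module.finrank_pos.ne'
  have hP0 : P ≠ 0 := by
    rintro rfl
    rw [map_zero, zero_pow hn] at h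
    exact hp.pos.ne h
  have hP1 : absVal L P < 1 := by
    refine lt_of_not_ge fun h1 => ?_
    exact absurd hp.lt_one (not_lt.2 (h ▸ one_le_pow₀ h1))
  obtain ⟨j, hj⟩ := hQ.exists_pow hP0 hP1.le
  have h1 : j * Module.finrank K L = i := by
    rw [hpi, hj, ← pow_mul, hQ.pow_inj] at h
    exact h
  have h2 : j = 1 := by
    obtain ⟨k, hk⟩ := hi
    rw [← h1] at hk
    have : Module.finrank K L * 1 = Module.finrank K L * (j * k) := by
      rw [mul_one]; conv_lhs => rw [hk]
      ring
    exact Nat.eq_one_of_mul_eq_one_right (Nat.eq_of_mul_eq_mul_left (by omega) this).symm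
  refine ⟨hP0, hP1, fun x hx => ?_⟩
  rw [hj, h2, pow_one]
  exact hQ.le x hx

/-- The integral closure is local with maximal ideal generated by any uniformizer, and divisibility
there is comparison of absolute values. The ideal equation therefore reduces to an equation between
absolute values of generators. -/
theorem isTotallyRamified_iff {p : K} (hp : IsUniformizer p) :
    IsTotallyRamified K L ↔ ∃ P : L, absVal L P ^ Module.finrank K L = absVal K p := by
  have hmem : ∀ x : L, x ∈ integralClosure (ringOfIntegers K) L ↔ absVal L x ≤ 1 :=
    fun x => isIntegral_iff_absVal x
  have hunit : ∀ x : integralClosure (ringOfIntegers K) L, absVal L x = 1 → IsUnit x := by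
    intro x hx
    have hx0 : (x : L) ≠ 0 := by
      intro h
      simp [h] at hx
    exact IsUnit.of_mul_eq_one ⟨(x : L)⁻¹, (hmem _).2 (by simp [hx])⟩
      (Subtype.ext (mul_inv_cancel₀ hx0))
  have hspan : ∀ (Q : L) (hQ : IsUniformizer Q) (x : integralClosure (ringOfIntegers K) L),
      x ∈ Ideal.span {(⟨Q, (hmem Q).2 hQ.lt_one.le⟩ : integralClosure (ringOfIntegers K) L)} ↔
        absVal L x < 1 := by
    intro Q hQ x
    rw [Ideal.mem_span_singleton]
    constructor
    · rintro ⟨z, rfl⟩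
      change absVal L (Q * z) < 1
      rw [map_mul]
      nlinarith [hQ.lt_one, (hmem z).1 z.2, absVal_nonneg (z : L), hQ.pos]
    · intro h
      refine ⟨⟨x / Q, ?_⟩, Subtype.ext (mul_div_cancel₀ _ hQ.ne_zero).symm⟩
      rw [hmem, map_div₀]
      exact div_le_one_of_le₀ (hQ.le _ h) hQ.pos.le
  have hmax : ∀ (Q : L) (hQ : IsUniformizer Q), Ideal.IsMaximal
      (Ideal.span {(⟨Q, (hmem Q).2 hQ.lt_one.le⟩ : integralClosure (ringOfIntegers K) L)}) := by
    intro Q hQ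
    rw [Ideal.isMaximal_iff]
    refine ⟨fun h => ?_, fun J x _ hx hxJ => ?_⟩
    · rw [hspan Q hQ] at h
      simp at h
    · rw [hspan Q hQ, not_lt] at hx
      exact (Ideal.eq_top_iff_one J).1
        (Ideal.eq_top_of_isUnit_mem J hxJ (hunit x (le_antisymm ((hmem _).1 x.2) hx)))
  have hle : ∀ (Q : L) (hQ : IsUniformizer Q) (J : Ideal (integralClosure (ringOfIntegers K) L)),
      J.IsMaximal →
      J = Ideal.span {(⟨Q, (hmem Q).2 hQ.lt_one.le⟩ : integralClosure (ringOfIntegers K) L)} := by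
    intro Q hQ J hJ
    refine hJ.eq_of_le (hmax Q hQ).ne_top fun x hx => ?_
    rw [hspan Q hQ]
    exact lt_of_le_of_ne ((hmem _).1 x.2) fun h =>
      hJ.ne_top (Ideal.eq_top_of_isUnit_mem J hx (hunit x h))
  have hmap : (maxIdeal K).map (algebraMap (ringOfIntegers K)
      (integralClosure (ringOfIntegers K) L)) =
      Ideal.span {algebraMap (ringOfIntegers K) (integralClosure (ringOfIntegers K) L)
        ⟨p, hp.mem⟩} := by
    rw [maxIdeal, hp.maximalIdeal_eq_span, Ideal.map_span, Set.image_singleton]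
  have hval : absVal L (algebraMap (ringOfIntegers K) (integralClosure (ringOfIntegers K) L)
        ⟨p, hp.mem⟩ : integralClosure (ringOfIntegers K) L) = absVal K p :=
    absVal_algebraMap p
  have hdvd : ∀ x y : integralClosure (ringOfIntegers K) L, x ∣ y → absVal L y ≤ absVal L x := by
    rintro x _ ⟨z, rfl⟩
    change absVal L (x * z) ≤ _
    rw [map_mul]
    exact mul_le_of_le_one_right (absVal_nonneg _) ((hmem _).1 z.2)
  have hdvd' : ∀ x y : integralClosure (ringOfIntegers K) L, (x : L) ≠ 0 →
      absVal L y ≤ absVal L x → x ∣ y := by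
    intro x y hx hxy
    refine ⟨⟨y / x, ?_⟩, Subtype.ext (mul_div_cancel₀ _ hx).symm⟩
    rw [hmem, map_div₀]
    exact div_le_one_of_le₀ hxy (absVal_nonneg _)
  rw [IsTotallyRamified, hmap]
  constructor
  · rintro ⟨J, hJ, hJp⟩
    obtain ⟨Q, hQ⟩ := exists_isUniformizer L
    refine ⟨Q, ?_⟩
    rw [hle Q hQ J hJ, Ideal.span_singleton_pow] at hJp
    have h1 := hdvd _ _ (Ideal.span_singleton_le_span_singleton.1 hJp.le)
    have h2 := hdvd _ _ (Ideal.span_singleton_le_span_singleton.1 hJp.ge)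
    rw [hval] at h1 h2
    rw [← map_pow]
    exact le_antisymm h2 h1
  · rintro ⟨Q, hQp⟩
    have hQ : IsUniformizer Q := hp.of_pow_finrank hQp
    refine ⟨_, hmax Q hQ, ?_⟩
    rw [Ideal.span_singleton_pow]
    have hQp' : absVal L ((⟨Q, (hmem Q).2 hQ.lt_one.le⟩ ^ Module.finrank K L :
        integralClosure (ringOfIntegers K) L) : L) = absVal K p := by
      rw [← hQp, ← map_pow]
      rfl
    refine le_antisymm (Ideal.span_singleton_le_span_singleton.2 (hdvd' _ _ ?_ ?_))
      (Ideal.span_singleton_le_span_singleton.2 (hdvd' _ _ ?_ ?_))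
    · rw [← map_ne_zero (absVal L), hQp']
      exact hp.pos.ne'
    · rw [hval, hQp']
    · rw [← map_ne_zero (absVal L), hval]
      exact hp.pos.ne'
    · rw [hval, hQp']

omit [FiniteDimensional K L] in
-- Any other basis of integral elements has integral coordinates in `b`, so its discriminant is that
-- of `b` times the square of an integral determinant.
theorem discIdeal_eq_span {ι : Type*} [Fintype ι] [DecidableEq ι] (b : Module.Basis ι K L)
    (hb : ∀ i, absVal L (b i) ≤ 1) (hb' : ∀ x, absVal L x ≤ 1 → ∀ i, absVal K (b.repr x i) ≤ 1) :
    ∃ d : ringOfIntegers K, (d : K) = Algebra.discr K b ∧ discIdeal K L = Ideal.span {d} := by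
  have : FiniteDimensional K L := b.finiteDimensional_of_finite
  have hint : ∀ x : K, IsIntegral (ringOfIntegers K) x ↔ x ∈ ringOfIntegers K := fun x => by
    rw [isIntegral_iff_absVal, mem_ringOfIntegers_iff_absVal]
  have hd : Algebra.discr K b ∈ ringOfIntegers K :=
    (hint _).1 (Algebra.discr_isIntegral K fun i => (isIntegral_iff_absVal _).2 (hb i))
  refine ⟨⟨_, hd⟩, rfl, le_antisymm (Ideal.span_le.2 ?_) ?_⟩
  · rintro a ⟨c, hc, hac⟩
    rw [SetLike.mem_coe, Ideal.mem_span_singleton]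
    let σ : ι ≃ Fin (Module.finrank K L) := Fintype.equivOfCardEq (by
      rw [Fintype.card_fin, Module.finrank_eq_card_basis b])
    let b₁ := b.reindex σ
    have h1 : Algebra.discr K b₁ = Algebra.discr K b := by
      rw [← Algebra.discr_reindex K b σ]
      congr 1
      ext i
      simp [b₁]
    have h2 : Algebra.discr K c = (b₁.toMatrix c).det ^ 2 * Algebra.discr K b₁ := by
      rw [← Algebra.discr_of_matrix_vecMul, Module.Basis.toMatrix_map_vecMul]
    have h3 : (b₁.toMatrix c).det ∈ ringOfIntegers K := by
      refine (hint _).1 (IsIntegral.det fun i j => (hint _).2 ?_)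
      rw [mem_ringOfIntegers_iff_absVal]
      simpa [b₁, Module.Basis.toMatrix_apply] using
        hb' (c j) ((isIntegral_iff_absVal _).1 (hc j)) (σ.symm i)
    refine ⟨⟨_, h3⟩ ^ 2, Subtype.ext ?_⟩
    rw [hac, h2, h1, mul_comm]
    rfl
  · rw [Ideal.span_singleton_le_iff_mem]
    let σ : ι ≃ Fin (Module.finrank K L) := Fintype.equivOfCardEq (by
      rw [Fintype.card_fin, Module.finrank_eq_card_basis b])
    refine Ideal.subset_span ⟨b.reindex σ, fun i => ?_, ?_⟩
    · rw [isIntegral_iff_absVal, Module.Basis.reindex_apply]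
      exact hb _
    · change Algebra.discr K b = _
      rw [← Algebra.discr_reindex K b σ]
      congr 1
      ext i
      simp

end Extension

end

noncomputable section

/-! ### Quadratic extensions: integral bases, ramification and discriminants -/

section Quadratic

variable {K : Type*} [Field K] [Algebra ℚ_[2] K] [FiniteDimensional ℚ_[2] K]
  {L : Type*} [Field L] [Algebra ℚ_[2] L] [FiniteDimensional ℚ_[2] L]
  [Algebra K L] [IsScalarTower ℚ_[2] K L]

section Uniformizer

variable {p : K} (hp : IsUniformizer p) {P : L} (hP : absVal L P ^ 2 = absVal K p)

include hp hP

/-- Measured in `K`, nonzero elements of `K` have integral valuation, while `P` has valuation `1/2`.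
This parity argument rules out cancellation between `x` and `yP`. -/
theorem absVal_ne_of_sq_eq {x : K} (y : K) (hx : x ≠ 0) : absVal K x ≠ absVal L P * absVal K y := by
  intro h
  have hy : y ≠ 0 := by
    rintro rfl
    rw [map_zero, mul_zero, map_eq_zero] at h
    exact hx h
  obtain ⟨i, hi⟩ := hp.exists_zpow hx
  obtain ⟨j, hj⟩ := hp.exists_zpow hy
  have h2 : absVal K p ^ (2 * i) = absVal K p ^ (1 + 2 * j) := by
    rw [zpow_add₀ hp.pos.ne', zpow_one, zpow_mul', zpow_mul', ← hi, ← hj, ← hP]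
    norm_cast
    rw [h, mul_pow]
  rw [hp.zpow_inj] at h2
  omega

theorem absVal_algebraMap_add_mul_uniformizer (x y : K) :
    absVal L (algebraMap K L x + algebraMap K L y * P) =
      max (absVal K x) (absVal L P * absVal K y) := by
  by_cases hx : x = 0
  · simp only [hx, map_zero, zero_add, map_mul, absVal_algebraMap]
    rw [max_eq_right (mul_nonneg (absVal_nonneg _) (absVal_nonneg _)), mul_comm]
  rw [absVal_add_eq_max]
  · rw [map_mul, absVal_algebraMap, absVal_algebraMap, mul_comm]
  · rw [map_mul, absVal_algebraMap, absVal_algebraMap, mul_comm]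
    exact absVal_ne_of_sq_eq hp hP y hx

/-- If the valuation of `P` is half of that of a uniformizer of `K` and `L/K` is quadratic, then
`1, P` is an integral basis. -/
theorem exists_integral_basis (h2 : Module.finrank K L = 2) :
    ∃ b : Module.Basis (Fin 2) K L, b 0 = 1 ∧ b 1 = P ∧ (∀ i, absVal L (b i) ≤ 1) ∧
      ∀ x, absVal L x ≤ 1 → ∀ i, absVal K (b.repr x i) ≤ 1 := by
  have hP1 : absVal L P < 1 := by
    refine lt_of_not_ge fun h1 => ?_
    exact absurd hp.lt_one (not_lt.2 (hP ▸ one_le_pow₀ h1))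
  have hP0 : 0 < absVal L P := by
    refine absVal_pos ?_
    rintro rfl
    rw [map_zero, zero_pow two_ne_zero] at hP
    exact hp.pos.ne hP
  have hli : LinearIndependent K ![(1 : L), P] := by
    rw [LinearIndependent.pair_iff]
    intro x y hxy
    rw [Algebra.smul_def, Algebra.smul_def, mul_one] at hxy
    have h := absVal_algebraMap_add_mul_uniformizer hp hP x y
    rw [hxy, map_zero] at h
    have hx : absVal K x ≤ 0 := h ▸ le_max_left _ _
    have hy : absVal L P * absVal K y ≤ 0 := h ▸ le_max_right _ _
    refine ⟨(map_eq_zero (absVal K)).1 (le_antisymm hx (absVal_nonneg _)),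
      (map_eq_zero (absVal K)).1 (le_antisymm ?_ (absVal_nonneg _))⟩
    exact nonpos_of_mul_nonpos_right hy hP0
  let b := basisOfLinearIndependentOfCardEqFinrank hli (by simp [h2])
  have hb0 : b 0 = 1 := by simp [b]
  have hb1 : b 1 = P := by simp [b]
  refine ⟨b, hb0, hb1, ?_, ?_⟩
  · intro i
    fin_cases i
    · simp [hb0]
    · simpa [hb1] using hP1.le
  · intro x hx i
    have hsum := b.sum_repr x
    rw [Fin.sum_univ_two, hb0, hb1, Algebra.smul_def, Algebra.smul_def, mul_one] at hsum
    rw [← hsum, absVal_algebraMap_add_mul_uniformizer hp hP, max_le_iff] at hx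
    fin_cases i
    · exact hx.1
    · change absVal K (b.repr x 1) ≤ 1
      -- If `|y| > 1` then `|y|⁻¹ ≤ |p| = |P|²`; together with `|P||y| ≤ 1` this gives `1 ≤ |P|`.
      refine le_of_not_gt fun h => ?_
      have hy0 : b.repr x 1 ≠ 0 := by
        intro h0
        rw [h0, map_zero] at h
        linarith
      have h3 : absVal K (b.repr x 1)⁻¹ < 1 := by
        rw [map_inv₀]
        exact inv_lt_one_of_one_lt₀ h
      have h4 := hp.le _ h3
      rw [map_inv₀, ← hP, inv_le_iff_one_le_mul₀ (absVal_pos hy0)] at h4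
      nlinarith [hx.2]

/-- Modulo `P`, an integer of `L` is congruent to its coordinate at 1 in the integral basis `1, P`,
so the residue field does not grow. -/
theorem residueCard_eq_of_sq_eq (h2 : Module.finrank K L = 2) : residueCard L = residueCard K := by
  have hP1 : absVal L P < 1 := by
    refine lt_of_not_ge fun h1 => ?_
    exact absurd hp.lt_one (not_lt.2 (hP ▸ one_le_pow₀ h1))
  obtain ⟨b, hb0, hb1, -, hb⟩ := exists_integral_basis hp hP h2
  let f : ringOfIntegers K →+* ringOfIntegers L :=
    ((algebraMap K L).comp (ringOfIntegers K).subtype).codRestrict _ fun x => by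
      rw [mem_ringOfIntegers_iff_absVal]
      exact (absVal_algebraMap (L := L) (x : K)).trans_le (absVal_coe_le_one x)
  have hf : ∀ x, (f x : L) = algebraMap K L x := fun x => rfl
  have : IsLocalHom f := ⟨fun x hx => by
    rw [isUnit_iff_absVal, hf, absVal_algebraMap] at hx
    rwa [isUnit_iff_absVal]⟩
  refine (Nat.card_congr (Equiv.ofBijective (IsLocalRing.ResidueField.map f)
    ⟨(IsLocalRing.ResidueField.map f).injective, fun y => ?_⟩)).symm
  obtain ⟨y, rfl⟩ := IsLocalRing.residue_surjective y
  refine ⟨IsLocalRing.residue _ ⟨b.repr y 0, ?_⟩, ?_⟩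
  · rw [mem_ringOfIntegers_iff_absVal]
    exact hb _ (absVal_coe_le_one y) 0
  · rw [IsLocalRing.ResidueField.map_residue, residue_eq_residue_iff_absVal, hf]
    have hsum := b.sum_repr (y : L)
    rw [Fin.sum_univ_two, hb0, hb1, Algebra.smul_def, Algebra.smul_def, mul_one] at hsum
    have hy : algebraMap K L (b.repr (y : L) 0) - y = -(algebraMap K L (b.repr (y : L) 1) * P) := by
      linear_combination hsum
    change absVal L (algebraMap K L (b.repr (y : L) 0) - y) < 1
    rw [hy, absVal_neg, map_mul, absVal_algebraMap]
    exact mul_lt_one_of_nonneg_of_lt_one_right (hb _ (absVal_coe_le_one y) 1) (absVal_nonneg _) hP1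

theorem absRamificationIdx_eq_of_sq_eq [FiniteDimensional K L] (h2 : Module.finrank K L = 2) :
    absRamificationIdx L = 2 * absRamificationIdx K := by
  have hPu : IsUniformizer P := hp.of_pow_finrank (by rw [h2, hP])
  have h := hPu.absVal_two_eq
  have h' := hp.absVal_two_eq
  rw [absVal_two] at h h'
  rw [h, ← hP, ← pow_mul, hPu.pow_inj] at h'
  exact h'

end Uniformizer

section SquareRoot

variable (h2 : Module.finrank K L = 2) {s : L} {a : K} (hs : s ^ 2 = algebraMap K L a)
  (hsK : ∀ x : K, algebraMap K L x ≠ s)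

include h2 hs hsK

omit [Algebra ℚ_[2] K] [FiniteDimensional ℚ_[2] K] [Algebra ℚ_[2] L] [FiniteDimensional ℚ_[2] L]
  [IsScalarTower ℚ_[2] K L] in
theorem exists_basis_one_sqrt : ∃ b : Module.Basis (Fin 2) K L, b 0 = 1 ∧ b 1 = s := by
  have hli : LinearIndependent K ![(1 : L), s] := by
    rw [LinearIndependent.pair_iff]
    intro x y hxy
    rw [Algebra.smul_def, Algebra.smul_def, mul_one] at hxy
    by_cases hy : y = 0
    · subst hy
      simpa using hxy
    · refine absurd ?_ (hsK (-x / y))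
      have hy' : algebraMap K L y ≠ 0 := by simpa using hy
      rw [map_div₀, div_eq_iff hy', map_neg]
      linear_combination -hxy
  exact ⟨basisOfLinearIndependentOfCardEqFinrank hli (by simp [h2]), by simp, by simp⟩

omit [Algebra ℚ_[2] K] [FiniteDimensional ℚ_[2] K] [Algebra ℚ_[2] L] [FiniteDimensional ℚ_[2] L]
  [IsScalarTower ℚ_[2] K L] in
theorem exists_eq_add_mul_sqrt (z : L) : ∃ x y : K, z = algebraMap K L x + algebraMap K L y * s := by
  obtain ⟨b, hb0, hb1⟩ := exists_basis_one_sqrt h2 hs hsK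
  refine ⟨b.repr z 0, b.repr z 1, ?_⟩
  have hsum := b.sum_repr z
  rw [Fin.sum_univ_two, hb0, hb1, Algebra.smul_def, Algebra.smul_def, mul_one] at hsum
  exact hsum.symm

omit [Algebra ℚ_[2] K] [FiniteDimensional ℚ_[2] K] [Algebra ℚ_[2] L] [FiniteDimensional ℚ_[2] L]
  [IsScalarTower ℚ_[2] K L] in
theorem leftMulMatrix_sqrt {b : Module.Basis (Fin 2) K L} (hb0 : b 0 = 1) (hb1 : b 1 = s)
    (x y : K) : Algebra.leftMulMatrix b (algebraMap K L x + algebraMap K L y * s) =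
      !![x, y * a; y, x] := by
  have h0 : (algebraMap K L x + algebraMap K L y * s) * b 0 = x • b 0 + y • b 1 := by
    simp [hb0, hb1, Algebra.smul_def]
  have h1 : (algebraMap K L x + algebraMap K L y * s) * b 1 = (y * a) • b 0 + x • b 1 := by
    simp only [hb0, hb1, Algebra.smul_def, map_mul, ← hs]
    ring
  ext i j
  rw [Algebra.leftMulMatrix_eq_repr_mul]
  fin_cases j
  · simp only [Fin.zero_eta, h0]
    fin_cases i <;> simp
  · simp only [Fin.mk_one, h1]
    fin_cases i <;> simp

omit [Algebra ℚ_[2] K] [FiniteDimensional ℚ_[2] K] [Algebra ℚ_[2] L] [FiniteDimensional ℚ_[2] L]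
  [IsScalarTower ℚ_[2] K L] in
theorem norm_add_mul_sqrt (x y : K) :
    Algebra.norm K (algebraMap K L x + algebraMap K L y * s) = x ^ 2 - y ^ 2 * a := by
  obtain ⟨b, hb0, hb1⟩ := exists_basis_one_sqrt h2 hs hsK
  rw [Algebra.norm_eq_matrix_det b, leftMulMatrix_sqrt h2 hs hsK hb0 hb1, Matrix.det_fin_two_of]
  ring

omit [Algebra ℚ_[2] K] [FiniteDimensional ℚ_[2] K] [Algebra ℚ_[2] L] [FiniteDimensional ℚ_[2] L]
  [IsScalarTower ℚ_[2] K L] in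
theorem trace_add_mul_sqrt (x y : K) :
    Algebra.trace K L (algebraMap K L x + algebraMap K L y * s) = 2 * x := by
  obtain ⟨b, hb0, hb1⟩ := exists_basis_one_sqrt h2 hs hsK
  rw [Algebra.trace_eq_matrix_trace b, leftMulMatrix_sqrt h2 hs hsK hb0 hb1, Matrix.trace_fin_two_of]
  ring

omit [Algebra ℚ_[2] K] [FiniteDimensional ℚ_[2] K] [Algebra ℚ_[2] L] [FiniteDimensional ℚ_[2] L]
  [IsScalarTower ℚ_[2] K L] in
theorem discr_one_add_mul_sqrt {b : Module.Basis (Fin 2) K L} {x y : K} (hb0 : b 0 = 1)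
    (hb1 : b 1 = algebraMap K L x + algebraMap K L y * s) :
    Algebra.discr K b = 4 * a * y ^ 2 := by
  have h1 : Algebra.trace K L 1 = 2 := by
    simpa using trace_add_mul_sqrt h2 hs hsK 1 0
  have h3 : b 1 * b 1 = algebraMap K L (x ^ 2 + a * y ^ 2) + algebraMap K L (2 * x * y) * s := by
    rw [hb1]
    simp only [map_add, map_mul, map_pow, map_ofNat, ← hs]
    ring
  rw [Algebra.discr_def, Matrix.det_fin_two]
  simp only [Algebra.traceMatrix_apply, Algebra.traceForm_apply]
  rw [h3, hb0, mul_one, one_mul, mul_one, h1, hb1, trace_add_mul_sqrt h2 hs hsK,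
    trace_add_mul_sqrt h2 hs hsK]
  ring

theorem absVal_add_mul_sqrt_sq (x y : K) :
    absVal L (algebraMap K L x + algebraMap K L y * s) ^ 2 = absVal K (x ^ 2 - y ^ 2 * a) := by
  have : FiniteDimensional K L := FiniteDimensional.of_finrank_pos (by omega)
  rw [← norm_add_mul_sqrt h2 hs hsK, absVal_norm, h2]

/-- Total ramification and the discriminant of `K(√a)` in terms of an element of valuation `1/2`. -/
theorem discr_of_sq_eq {p : K} (hp : IsUniformizer p) (x y : K)
    (hP : absVal L (algebraMap K L x + algebraMap K L y * s) ^ 2 = absVal K p) :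
    IsTotallyRamified K L ∧ ∀ n : ℕ, idealVal K (discIdeal K L) = n ↔
      absVal K (4 * a * y ^ 2) = absVal K p ^ n := by
  have : FiniteDimensional K L := FiniteDimensional.of_finrank_pos (by omega)
  obtain ⟨b, hb0, hb1, hb, hb'⟩ := exists_integral_basis hp hP h2
  refine ⟨(isTotallyRamified_iff hp).2 ⟨_, by rw [h2]; exact hP⟩, fun n => ?_⟩
  obtain ⟨d, hd, hd'⟩ := discIdeal_eq_span b hb hb'
  rw [hd', hp.idealVal_span_eq_iff, hd, discr_one_add_mul_sqrt h2 hs hsK hb0 hb1]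

/-- The element `p^(-k) √a` has norm of valuation 1, so it is a uniformizer; the discriminant is
then `4 a p^(-2k)`. -/
theorem sqrt_odd {p : K} (hp : IsUniformizer p) {k : ℤ}
    (ha : absVal K a = absVal K p ^ (2 * k + 1)) :
    IsTotallyRamified K L ∧ ∀ n : ℕ, idealVal K (discIdeal K L) = n ↔
      n = 2 * absRamificationIdx K + 1 := by
  have h := discr_of_sq_eq h2 hs hsK hp 0 (p ^ (-k)) (by
    rw [absVal_add_mul_sqrt_sq h2 hs hsK, zero_pow two_ne_zero, zero_sub, absVal_neg, map_mul, ha,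
      map_pow, map_zpow₀, ← zpow_natCast, ← zpow_mul, ← zpow_add₀ hp.pos.ne']
    convert zpow_one _ using 2
    push_cast
    ring)
  refine ⟨h.1, fun n => (h.2 n).trans ?_⟩
  have h4 : (4 : K) = 2 ^ 2 := by norm_num
  rw [map_mul, map_mul, ha, h4, map_pow, map_pow, map_zpow₀, hp.absVal_two_eq, ← zpow_natCast,
    ← zpow_natCast, ← zpow_natCast, ← zpow_natCast, ← zpow_mul, ← zpow_mul, ← zpow_add₀ hp.pos.ne',
    ← zpow_add₀ hp.pos.ne', hp.zpow_inj]
  push_cast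
  omega

/-- The element `(√a - 1) / p^k` has norm `(1 - a) / p^(2k)`, of valuation 1, so it is a
uniformizer; the discriminant is then `4a / p^(2k)` with `a` a unit. -/
theorem sqrt_one_add {p : K} (hp : IsUniformizer p) {k : ℕ}
    (ha : absVal K (a - 1) = absVal K p ^ (2 * k + 1)) (hk : k < absRamificationIdx K) :
    IsTotallyRamified K L ∧ ∀ n : ℕ, idealVal K (discIdeal K L) = n ↔
      n = 2 * (absRamificationIdx K - k) := by
  have ha1 : absVal K a = 1 := by
    rw [← sub_add_cancel a 1, absVal_add_eq_of_lt, map_one]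
    rw [ha, map_one]
    exact pow_lt_one₀ hp.pos.le hp.lt_one (by omega)
  have hpk := pow_ne_zero k hp.ne_zero
  have h := discr_of_sq_eq h2 hs hsK hp (-(p ^ k)⁻¹) ((p ^ k)⁻¹) (by
    rw [absVal_add_mul_sqrt_sq h2 hs hsK]
    have : (-(p ^ k)⁻¹) ^ 2 - ((p ^ k)⁻¹) ^ 2 * a = -((a - 1) / (p ^ k) ^ 2) := by
      field_simp
      ring
    rw [this, absVal_neg, map_div₀, ha, map_pow, map_pow, div_eq_iff (by
      exact pow_ne_zero _ (pow_ne_zero _ hp.pos.ne'))]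
    ring)
  refine ⟨h.1, fun n => (h.2 n).trans ?_⟩
  have h4 : (4 : K) = 2 ^ 2 := by norm_num
  rw [map_mul, map_mul, ha1, h4, map_pow, map_pow, map_inv₀, map_pow, hp.absVal_two_eq, mul_one,
    inv_pow, ← div_eq_mul_inv, div_eq_iff (pow_ne_zero _ (pow_ne_zero _ hp.pos.ne')), ← pow_mul,
    ← pow_mul, ← pow_add, hp.pow_inj]
  omega

/-- Suppose `P = x + ys` has valuation `1/2`. Its conjugate has the same absolute value, so `|2y| ≤
|P|`, strictly by parity. Since `|s - 1| ≤ |2|`, the difference `P - (x + y) = y(s - 1)` is smaller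
than `P`. Then `x + y`, an element of `K`, would have valuation `1/2`. -/
theorem sqrt_one_add_four (ha : absVal K (a - 1) ≤ absVal K 4) : ¬ IsTotallyRamified K L := by
  have : FiniteDimensional K L := FiniteDimensional.of_finrank_pos (by omega)
  obtain ⟨p, hp⟩ := exists_isUniformizer K
  have := charZero_of_algebra_padic K
  have h4 : (4 : K) = 2 ^ 2 := by norm_num
  have h2lt : absVal K 2 < 1 := by rw [absVal_two]; norm_num
  have h4lt : absVal K 4 < 1 := by rw [h4, map_pow, absVal_two]; norm_num
  have ha1 : absVal K a = 1 := by
    rw [← sub_add_cancel a 1, absVal_add_eq_of_lt, map_one]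
    rw [map_one]
    exact ha.trans_lt h4lt
  rw [isTotallyRamified_iff hp, h2]
  rintro ⟨P, hP⟩
  have hP1 : absVal L P < 1 := by
    refine lt_of_not_ge fun h1 => ?_
    exact absurd hp.lt_one (not_lt.2 (hP ▸ one_le_pow₀ h1))
  obtain ⟨x, y, rfl⟩ := exists_eq_add_mul_sqrt h2 hs hsK P
  have hconj : absVal L (algebraMap K L x + algebraMap K L (-y) * s) ^ 2 = absVal K p := by
    rw [← hP, absVal_add_mul_sqrt_sq h2 hs hsK, absVal_add_mul_sqrt_sq h2 hs hsK, neg_sq]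
  have hconj' : absVal L (algebraMap K L x + algebraMap K L (-y) * s) =
      absVal L (algebraMap K L x + algebraMap K L y * s) := by
    rw [← hP] at hconj
    exact (pow_left_inj₀ (absVal_nonneg _) (absVal_nonneg _) two_ne_zero).1 hconj
  have hs1 : absVal L s = 1 := by
    have := absVal_add_mul_sqrt_sq h2 hs hsK 0 1
    simp only [map_zero, map_one, one_mul, zero_add, zero_pow two_ne_zero, one_pow, zero_sub,
      absVal_neg, ha1] at this
    exact (pow_eq_one_iff_of_nonneg (absVal_nonneg _) two_ne_zero).1 this
  have hhalf : absVal L (algebraMap K L (-1) + algebraMap K L 1 * s) ≤ absVal K 2 := by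
    refine le_of_sq_le_sq ?_ (absVal_nonneg _)
    rw [absVal_add_mul_sqrt_sq h2 hs hsK, ← map_pow, ← h4, absVal_sub_comm]
    simpa using ha
  have hy : absVal L (algebraMap K L (2 * y)) ≤
      absVal L (algebraMap K L x + algebraMap K L y * s) := by
    have h5 : algebraMap K L (2 * y) * s = (algebraMap K L x + algebraMap K L y * s) -
        (algebraMap K L x + algebraMap K L (-y) * s) := by
      rw [map_mul, map_neg, map_ofNat]
      ring
    have h6 := absVal_sub_le (algebraMap K L x + algebraMap K L y * s)
      (algebraMap K L x + algebraMap K L (-y) * s)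
    rw [← h5, map_mul, hs1, mul_one, hconj', max_self] at h6
    exact h6
  set P := algebraMap K L x + algebraMap K L y * s with hPdef
  have hP0 : absVal L P ≠ 0 := by
    intro h
    rw [h, zero_pow two_ne_zero] at hP
    exact hp.pos.ne hP
  have hlt : absVal L (algebraMap K L y * (algebraMap K L (-1) + algebraMap K L 1 * s)) <
      absVal L P := by
    have h7 : absVal L (algebraMap K L y * (algebraMap K L (-1) + algebraMap K L 1 * s)) ≤
        absVal K (2 * y) := by
      rw [map_mul, absVal_algebraMap, map_mul, mul_comm]
      exact mul_le_mul_of_nonneg_right hhalf (absVal_nonneg _)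
    rw [absVal_algebraMap] at hy
    refine h7.trans_lt (lt_of_le_of_ne hy fun h => ?_)
    refine absVal_ne_of_sq_eq hp hP 1 (x := 2 * y) ?_ (by rw [map_one, mul_one]; exact h)
    intro h0
    rw [h0, map_zero] at h
    exact hP0 h.symm
  have hxy : algebraMap K L (x + y) =
      P + -(algebraMap K L y * (algebraMap K L (-1) + algebraMap K L 1 * s)) := by
    simp only [hPdef, map_add, map_neg, map_one]
    ring
  have hxy' : absVal K (x + y) = absVal L P := by
    rw [← absVal_algebraMap (L := L), hxy, absVal_add_eq_of_gt]
    rwa [absVal_neg]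
  refine absVal_ne_of_sq_eq hp hP 1 (x := x + y) ?_ (by rw [map_one, mul_one]; exact hxy')
  intro h0
  rw [h0, map_zero] at hxy'
  exact hP0 hxy'.symm

end SquareRoot

end Quadratic

/-! ### Towers of two quadratic extensions -/

section QuadraticTower

variable {K : Type*} [Field K] [Algebra ℚ_[2] K] [FiniteDimensional ℚ_[2] K]
  {F : Type*} [Field F] [Algebra ℚ_[2] F] [FiniteDimensional ℚ_[2] F]
  {L : Type*} [Field L] [Algebra ℚ_[2] L] [FiniteDimensional ℚ_[2] L]
  [Algebra K F] [IsScalarTower ℚ_[2] K F] [Algebra F L] [IsScalarTower ℚ_[2] F L]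
  [Algebra K L] [IsScalarTower ℚ_[2] K L] [IsScalarTower K F L]
  (hKF : Module.finrank K F = 2) (hFL : Module.finrank F L = 2)

include hKF hFL

theorem isTotallyRamified_tower_iff :
    IsTotallyRamified K L ↔ IsTotallyRamified K F ∧ IsTotallyRamified F L := by
  have : FiniteDimensional K F := FiniteDimensional.of_finrank_pos (by omega)
  have : FiniteDimensional F L := FiniteDimensional.of_finrank_pos (by omega)
  have : FiniteDimensional K L := FiniteDimensional.trans K F L
  have hKL : Module.finrank K L = 4 := by rw [← Module.finrank_mul_finrank K F L, hKF, hFL]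
  obtain ⟨p, hp⟩ := exists_isUniformizer K
  obtain ⟨P, hP⟩ := exists_isUniformizer F
  obtain ⟨Q, hQ⟩ := exists_isUniformizer L
  rw [isTotallyRamified_iff hp, isTotallyRamified_iff hp, isTotallyRamified_iff hP, hKL, hKF, hFL]
  constructor
  · rintro ⟨R, hR⟩
    obtain ⟨i, hi, hpi⟩ := exists_absVal_eq_pow hp hP
    obtain ⟨j, hj, hPj⟩ := exists_absVal_eq_pow hP hQ
    have hRu : IsUniformizer R := hp.of_pow_finrank (by rw [hKL, hR])
    rw [hKF] at hi
    rw [hFL] at hj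
    rw [hpi, hPj, hRu.absVal_eq hQ, ← pow_mul, hQ.pow_inj] at hR
    have hi' := Nat.le_of_dvd (by norm_num) hi
    have hj' := Nat.le_of_dvd (by norm_num) hj
    -- Both ramification indices divide 2 and their product is 4.
    have hij : i = 2 ∧ j = 2 := by
      interval_cases i <;> interval_cases j <;> simp_all
    exact ⟨⟨P, by rw [hpi, hij.1]⟩, ⟨Q, by rw [hPj, hij.2]⟩⟩
  · rintro ⟨⟨R, hR⟩, ⟨S, hS⟩⟩
    have hRu : IsUniformizer R := hp.of_pow_finrank (by rw [hKF, hR])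
    refine ⟨S, ?_⟩
    rw [show 4 = 2 * 2 from rfl, pow_mul, hS, ← hRu.absVal_eq hP, hR]

/-- The discriminant of a totally ramified tower of quadratic extensions. -/
theorem idealVal_discIdeal_tower (hF : IsTotallyRamified K F) (hL : IsTotallyRamified F L) :
    ∃ a b : ℕ, idealVal K (discIdeal K F) = a ∧ idealVal F (discIdeal F L) = b ∧
      idealVal K (discIdeal K L) = (2 * a + b : ℕ) := by
  have : FiniteDimensional K F := FiniteDimensional.of_finrank_pos (by omega)
  have : FiniteDimensional F L := FiniteDimensional.of_finrank_pos (by omega)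
  have := charZero_of_algebra_padic K
  have := charZero_of_algebra_padic F
  obtain ⟨p, hp⟩ := exists_isUniformizer K
  obtain ⟨P, hP⟩ := (isTotallyRamified_iff hp).1 hF
  have hPu : IsUniformizer P := hp.of_pow_finrank hP
  obtain ⟨Q, hQ⟩ := (isTotallyRamified_iff hPu).1 hL
  rw [hKF] at hP
  rw [hFL] at hQ
  obtain ⟨b, -, -, hb, hb'⟩ := exists_integral_basis hp hP hKF
  obtain ⟨c, -, -, hc, hc'⟩ := exists_integral_basis hPu hQ hFL
  obtain ⟨d, hd, hdI⟩ := discIdeal_eq_span b hb hb'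
  obtain ⟨d', hd', hdI'⟩ := discIdeal_eq_span c hc hc'
  -- Products of the two integral bases form an integral basis of the tower, so transitivity of
  -- discriminants computes the ideal.
  obtain ⟨d'', hd'', hdI''⟩ := discIdeal_eq_span (b.smulTower' c)
    (by
      rintro ⟨k, i⟩
      rw [Module.Basis.smulTower'_apply, Algebra.smul_def, map_mul, absVal_algebraMap]
      exact mul_le_one₀ (hb i) (absVal_nonneg _) (hc k))
    (by
      rintro x hx ⟨k, i⟩
      rw [Module.Basis.smulTower'_repr]
      exact hb' _ (hc' x hx k) i)
  obtain ⟨n, hn⟩ := hp.exists_pow (x := d) (by rw [hd]; exact Algebra.discr_not_zero_of_basis K b)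
    (absVal_coe_le_one d)
  obtain ⟨n', hn'⟩ := hPu.exists_pow (x := d')
    (by rw [hd']; exact Algebra.discr_not_zero_of_basis F c) (absVal_coe_le_one d')
  refine ⟨n, n', ?_, ?_, ?_⟩
  · rw [hdI, hp.idealVal_span_eq_iff, hn]
  · rw [hdI', hPu.idealVal_span_eq_iff, hn']
  · rw [hdI'', hp.idealVal_span_eq_iff, hd'', discr_smulTower', map_mul, map_pow, ← hd, hn,
      absVal_norm, ← hd', hn', hKF, Fintype.card_fin, ← hP, ← pow_mul, ← pow_mul, ← pow_mul,
      ← pow_mul, ← pow_add]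
    congr 1
    ring

end QuadraticTower

end

noncomputable section

/-! ### Kummer theory for quadratic extensions -/

section SquareRootFields

open IntermediateField Polynomial

variable {K Ω : Type*} [Field K] [Field Ω] [Algebra K Ω]

theorem finrank_adjoin_sqrt {s : Ω} {a : K} (hs : s ^ 2 = algebraMap K Ω a) (ha : ¬ IsSquare a) :
    Module.finrank K K⟮s⟯ = 2 := by
  have hirr : Irreducible (X ^ 2 - C a : K[X]) := by
    refine (Monic.irreducible_iff_roots_eq_zero_of_degree_le_three (monic_X_pow_sub_C a two_ne_zero)
      (by rw [natDegree_X_pow_sub_C]) (by rw [natDegree_X_pow_sub_C]; norm_num)).2 ?_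
    refine Multiset.eq_zero_of_forall_notMem fun y hy => ha ?_
    rw [mem_roots (monic_X_pow_sub_C a two_ne_zero).ne_zero, IsRoot, eval_sub, eval_pow, eval_X,
      eval_C, sub_eq_zero] at hy
    exact ⟨y, by rw [← hy, sq]⟩
  have hmin : X ^ 2 - C a = minpoly K s :=
    minpoly.eq_of_irreducible_of_monic hirr (by simp [hs]) (monic_X_pow_sub_C a two_ne_zero)
  have hint : IsIntegral K s := ⟨_, monic_X_pow_sub_C a two_ne_zero, by simp [hs]⟩
  rw [adjoin.finrank hint, ← hmin, natDegree_X_pow_sub_C]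

theorem adjoin_sqrt_eq_bot {s : Ω} {a : K} (hs : s ^ 2 = algebraMap K Ω a) (ha : IsSquare a) :
    K⟮s⟯ = ⊥ := by
  obtain ⟨b, rfl⟩ := ha
  rw [adjoin_simple_eq_bot_iff, mem_bot]
  rw [map_mul, ← sq, sq_eq_sq_iff_eq_or_eq_neg] at hs
  rcases hs with rfl | rfl
  · exact ⟨b, rfl⟩
  · exact ⟨-b, map_neg _ _⟩

/-- Quadratic extensions inside `Ω` are generated by square roots. -/
theorem exists_sqrt_generator [NeZero (2 : K)] (F : IntermediateField K Ω)
    (hF : Module.finrank K F = 2) :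
    ∃ (s : Ω) (a : K), s ^ 2 = algebraMap K Ω a ∧ ¬ IsSquare a ∧ F = K⟮s⟯ := by
  have h2 : (2 : K) ≠ 0 := two_ne_zero
  have : FiniteDimensional K F := FiniteDimensional.of_finrank_pos (by omega)
  have hbot : F ≠ ⊥ := by
    rintro rfl
    rw [IntermediateField.finrank_bot] at hF
    omega
  obtain ⟨x, hxF, hx⟩ := SetLike.exists_of_lt (bot_lt_iff_ne_bot.2 hbot)
  have hint : IsIntegral K x := (isIntegral_algebraMap_iff (B := Ω)
    (algebraMap F Ω).injective (x := ⟨x, hxF⟩)).2 (Algebra.IsIntegral.isIntegral _)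
  have hxF' : K⟮x⟯ ≤ F := adjoin_simple_le_iff.2 hxF
  have hd : (minpoly K x).natDegree = 2 := by
    rw [← adjoin.finrank hint]
    have h1 : Module.finrank K K⟮x⟯ ∣ 2 := hF ▸ finrank_dvd_of_le_right hxF'
    rcases (Nat.dvd_prime Nat.prime_two).1 h1 with h | h
    · exact absurd (finrank_adjoin_simple_eq_one_iff.1 h) hx
    · exact h
  have hroot := minpoly.aeval K x
  rw [aeval_eq_sum_range, hd, Finset.sum_range_succ, Finset.sum_range_succ,
    Finset.sum_range_one, ← hd, (minpoly.monic hint).coeff_natDegree, hd] at hroot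
  set u := (minpoly K x).coeff 1
  set v := (minpoly K x).coeff 0
  simp only [Algebra.smul_def, pow_zero, mul_one, pow_one, map_one, one_mul] at hroot
  -- Completing the square in `x² + ux + v = 0`.
  have hs : (2 * x + algebraMap K Ω u) ^ 2 = algebraMap K Ω (u ^ 2 - 4 * v) := by
    simp only [map_sub, map_pow, map_mul, map_ofNat]
    linear_combination 4 * hroot
  have hsF : 2 * x + algebraMap K Ω u ∈ F :=
    F.add_mem (F.mul_mem (ofNat_mem F 2) hxF) (F.algebraMap_mem _)
  have hsq : ¬ IsSquare (u ^ 2 - 4 * v) := by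
    intro h
    have h1 := adjoin_sqrt_eq_bot hs h
    rw [adjoin_simple_eq_bot_iff] at h1
    refine hx ?_
    have h3 : x = algebraMap K Ω 2⁻¹ * (2 * x + algebraMap K Ω u - algebraMap K Ω u) := by
      rw [add_sub_cancel_right, ← mul_assoc, map_inv₀, map_ofNat, inv_mul_cancel₀, one_mul]
      have := (_root_.map_ne_zero (algebraMap K Ω)).2 h2
      rwa [map_ofNat] at this
    rw [h3]
    exact mul_mem (IntermediateField.algebraMap_mem _ _) (sub_mem h1 (IntermediateField.algebraMap_mem _ _))
  refine ⟨_, _, hs, hsq, ?_⟩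
  refine (eq_of_le_of_finrank_eq (adjoin_simple_le_iff.2 hsF) ?_).symm
  rw [finrank_adjoin_sqrt hs hsq, hF]

theorem algebraMap_ne_sqrt {s : Ω} {a : K} (hs : s ^ 2 = algebraMap K Ω a) (ha : ¬ IsSquare a)
    (x : K) : algebraMap K Ω x ≠ s := by
  rintro rfl
  rw [← map_pow] at hs
  exact ha ⟨x, by rw [← (algebraMap K Ω).injective hs, sq]⟩

/-- Write `t = x + ys` and square: since `s ∉ K`, the cross term `2xy` vanishes. If `y = 0` then `b`
is a square, which is excluded in the nontrivial case; if `x = 0` then `b / a = y²`. -/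
theorem isSquare_div_of_adjoin_sqrt_eq [NeZero (2 : K)] {s t : Ω} {a b : K} (hs : s ^ 2 = algebraMap K Ω a)
    (ht : t ^ 2 = algebraMap K Ω b) (ha : a ≠ 0) :
    K⟮s⟯ = K⟮t⟯ → IsSquare (b / a) := by
  intro h
  by_cases hsa : IsSquare a
  · by_cases htb : IsSquare b
    · exact htb.div hsa
    · have h1 := finrank_adjoin_sqrt ht htb
      rw [← h, adjoin_sqrt_eq_bot hs hsa, IntermediateField.finrank_bot] at h1
      omega
  · have htb : ¬ IsSquare b := by
      intro htb
      have h1 := finrank_adjoin_sqrt hs hsa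
      rw [h, adjoin_sqrt_eq_bot ht htb, IntermediateField.finrank_bot] at h1
      omega
    have hmem : t ∈ K⟮s⟯ := h ▸ mem_adjoin_simple_self K t
    obtain ⟨x, y, hxy⟩ := exists_eq_add_mul_sqrt (s := (⟨s, mem_adjoin_simple_self K s⟩ : K⟮s⟯))
      (finrank_adjoin_sqrt hs hsa)
      (a := a) (Subtype.ext hs) (fun x hx => algebraMap_ne_sqrt hs hsa x (congrArg Subtype.val hx))
      ⟨t, hmem⟩
    replace hxy : t = algebraMap K Ω x + algebraMap K Ω y * s := congrArg Subtype.val hxy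
    have h1 : algebraMap K Ω (b - x ^ 2 - a * y ^ 2) = algebraMap K Ω (2 * x * y) * s := by
      simp only [map_sub, map_mul, map_pow, ← hs, ← ht, hxy, map_ofNat]
      ring
    have hzero : 2 * x * y = 0 := by
      by_contra h0
      refine algebraMap_ne_sqrt hs hsa ((b - x ^ 2 - a * y ^ 2) / (2 * x * y)) ?_
      rw [map_div₀, h1, mul_div_cancel_left₀]
      exact (_root_.map_ne_zero _).2 h0
    have h2 : b - x ^ 2 - a * y ^ 2 = 0 := by
      rw [hzero, map_zero, zero_mul] at h1
      exact (map_eq_zero _).1 h1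
    rcases mul_eq_zero.1 hzero with h3 | h3
    · have hx : x = 0 := (mul_eq_zero.1 h3).resolve_left two_ne_zero
      refine ⟨y, ?_⟩
      rw [div_eq_iff ha]
      rw [hx] at h2
      linear_combination h2
    · refine absurd ⟨x, ?_⟩ htb
      rw [h3] at h2
      linear_combination h2

theorem adjoin_sqrt_eq_of_isSquare_div {s t : Ω} {a b : K} (hs : s ^ 2 = algebraMap K Ω a)
    (ht : t ^ 2 = algebraMap K Ω b) (ha : a ≠ 0) (hb : b ≠ 0) :
    IsSquare (b / a) → K⟮s⟯ = K⟮t⟯ := by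
  rintro ⟨c, hc⟩
  rw [div_eq_iff ha] at hc
  have hc0 : c ≠ 0 := by
    rintro rfl
    rw [mul_zero, zero_mul] at hc
    exact hb hc
  have hts : t ^ 2 = (algebraMap K Ω c * s) ^ 2 := by
    rw [ht, hc, mul_pow, hs, ← map_pow, ← map_mul]
    ring_nf
  have hc0' : algebraMap K Ω c ≠ 0 := (_root_.map_ne_zero _).2 hc0
  have key : K⟮t⟯ = K⟮algebraMap K Ω c * s⟯ := by
    rcases sq_eq_sq_iff_eq_or_eq_neg.1 hts with rfl | rfl
    · rfl
    · refine le_antisymm (adjoin_simple_le_iff.2 (neg_mem (mem_adjoin_simple_self _ _)))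
        (adjoin_simple_le_iff.2 ?_)
      simpa using neg_mem (mem_adjoin_simple_self K (-(algebraMap K Ω c * s)))
  rw [key]
  refine le_antisymm (adjoin_simple_le_iff.2 ?_) (adjoin_simple_le_iff.2 ?_)
  · have := mul_mem (IntermediateField.algebraMap_mem K⟮algebraMap K Ω c * s⟯ c⁻¹)
      (mem_adjoin_simple_self K (algebraMap K Ω c * s))
    rwa [map_inv₀, inv_mul_cancel_left₀ hc0'] at this
  · exact mul_mem (IntermediateField.algebraMap_mem _ c) (mem_adjoin_simple_self K s)

end SquareRootFields

end

noncomputable section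

/-! ### Units close to 1 are squares -/

section Hensel

variable {K : Type*} [Field K] [Algebra ℚ_[2] K] [FiniteDimensional ℚ_[2] K]

theorem absVal_four_eq_sq : absVal K 4 = absVal K 2 ^ 2 := by
  rw [← map_pow]
  norm_num

/-- Elements congruent to `1` modulo `4𝔭` are squares. -/
theorem isSquare_of_absVal_sub_one_lt {a : K} (ha : absVal K (a - 1) < absVal K 4) :
    IsSquare a := by
  by_contra hsq
  let Ω := AlgebraicClosure K
  obtain ⟨s, hs⟩ := IsAlgClosed.exists_pow_nat_eq (algebraMap K Ω a) two_pos
  let L := IntermediateField.adjoin K {s}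
  have h2 : Module.finrank K L = 2 := finrank_adjoin_sqrt hs hsq
  have : FiniteDimensional K L := FiniteDimensional.of_finrank_pos (by omega)
  have : FiniteDimensional ℚ_[2] L := FiniteDimensional.trans ℚ_[2] K L
  let s' : L := ⟨s, IntermediateField.mem_adjoin_simple_self K s⟩
  have hs' : s' ^ 2 = algebraMap K L a := Subtype.ext hs
  have hsK : ∀ x : K, algebraMap K L x ≠ s' := fun x hx =>
    algebraMap_ne_sqrt hs hsq x (congrArg Subtype.val hx)
  -- Otherwise `s + 1` and `s - 1` both have norm `1 - a`, smaller than 4, so both are smaller than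
  -- 2; but their difference is 2.
  have key : ∀ x : K, x ^ 2 = 1 → absVal L (algebraMap K L x + algebraMap K L 1 * s') <
      absVal K 2 := by
    intro x hx
    refine lt_of_pow_lt_pow_left₀ 2 (absVal_nonneg _) ?_
    rw [absVal_add_mul_sqrt_sq h2 hs' hsK, ← absVal_four_eq_sq, hx, one_pow, one_mul,
      absVal_sub_comm]
    exact ha
  have h1 := absVal_sub_le (algebraMap K L 1 + algebraMap K L 1 * s')
    (algebraMap K L (-1) + algebraMap K L 1 * s')
  have h3 : (algebraMap K L 1 + algebraMap K L 1 * s') -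
    (algebraMap K L (-1) + algebraMap K L 1 * s') = algebraMap K L 2 := by
    simp only [map_one, map_neg, map_ofNat]
    ring
  rw [h3, absVal_algebraMap] at h1
  exact absurd h1 (not_le.2 (max_lt (key 1 (one_pow 2)) (key (-1) (by ring))))

end Hensel

/-! ### The Artin–Schreier map on a finite field -/

section ArtinSchreier

/-- The equation `y(y + 1) = 0` has two solutions, and for an endomorphism of a finite group the
index of the image is the order of the kernel. -/
theorem index_range_sq_add_self {k : Type*} [Field k] [Finite k] (f : k →+ k) (hf : ∀ y, f y = y ^ 2 + y) : f.range.index = 2 := by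
  have hker : Nat.card f.ker = 2 := by
    have hset : (f.ker : Set k) = {0, -1} := by
      ext y
      rw [SetLike.mem_coe, AddMonoidHom.mem_ker, hf, Set.mem_insert_iff, Set.mem_singleton_iff,
        eq_neg_iff_add_eq_zero, ← mul_eq_zero]
      ring_nf
    change Nat.card (f.ker : Set k) = 2
    rw [hset, Nat.card_coe_set_eq, Set.ncard_pair (neg_ne_zero.2 one_ne_zero).symm]
  have h1 := f.ker.card_mul_index
  have h3 := f.range.card_mul_index
  rw [AddSubgroup.index_ker, hker] at h1
  rw [← h1, mul_comm] at h3
  exact Nat.eq_of_mul_eq_mul_right Nat.card_pos h3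

end ArtinSchreier

/-! ### The filtration of `Kˣ` modulo squares by unit groups -/

section UnitFiltration

variable {K : Type*} [Field K] [Algebra ℚ_[2] K] [FiniteDimensional ℚ_[2] K]

/-- The subgroup of units `x` of `𝒪_K` with `|x - 1| ≤ |p| ^ d`. -/
def unitFiltration (p : K) (d : ℕ) : Subgroup Kˣ where
  carrier := {x | absVal K x = 1 ∧ absVal K (x - 1 : K) ≤ absVal K p ^ d}
  one_mem' := by simp [absVal_nonneg]
  mul_mem' := by
    rintro x y ⟨hx, hx'⟩ ⟨hy, hy'⟩
    refine ⟨by simp [hx, hy], ?_⟩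
    have h : ((x * y : Kˣ) : K) - 1 = x * (y - 1) + (x - 1) := by
      push_cast
      ring
    rw [h]
    refine (absVal_add_le _ _).trans (max_le ?_ hx')
    rwa [map_mul, hx, one_mul]
  inv_mem' := by
    rintro x ⟨hx, hx'⟩
    have h : ((x⁻¹ : Kˣ) : K) - 1 = -(x⁻¹ * (x - 1)) := by
      rw [Units.val_inv_eq_inv_val]
      field_simp
      ring
    refine ⟨by simp [hx], ?_⟩
    rw [h, absVal_neg, map_mul, Units.val_inv_eq_inv_val, map_inv₀, hx, inv_one,
      one_mul]
    exact hx'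

theorem mem_unitFiltration {p : K} {d : ℕ} {x : Kˣ} : x ∈ unitFiltration p d ↔
    absVal K x = 1 ∧ absVal K (x - 1 : K) ≤ absVal K p ^ d := Iff.rfl

variable (K) in
/-- The subgroup of squares. -/
def squares : Subgroup Kˣ := (powMonoidHom 2).range

omit [Algebra ℚ_[2] K] [FiniteDimensional ℚ_[2] K] in
theorem mem_squares {x : Kˣ} : x ∈ squares K ↔ ∃ y : Kˣ, y ^ 2 = x := Iff.rfl

omit [Algebra ℚ_[2] K] [FiniteDimensional ℚ_[2] K] in
theorem mem_squares_iff_isSquare {x : Kˣ} : x ∈ squares K ↔ IsSquare (x : K) := by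
  rw [mem_squares]
  constructor
  · rintro ⟨y, rfl⟩
    exact ⟨y, by push_cast; ring⟩
  · rintro ⟨y, hy⟩
    have hy0 : y ≠ 0 := by
      rintro rfl
      exact x.ne_zero (by rw [hy, mul_zero])
    exact ⟨Units.mk0 y hy0, Units.ext (by push_cast; rw [hy, sq, Units.val_mk0])⟩

/-- The classes of `unitFiltration p d` modulo squares. -/
def sqFiltration (p : K) (d : ℕ) : Subgroup Kˣ := unitFiltration p d ⊔ squares K

theorem mem_sqFiltration {p : K} {d : ℕ} {x : Kˣ} : x ∈ sqFiltration p d ↔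
    ∃ u ∈ unitFiltration p d, ∃ y : Kˣ, u * y ^ 2 = x := by
  rw [sqFiltration, Subgroup.mem_sup]
  constructor
  · rintro ⟨u, hu, z, ⟨y, rfl⟩, h⟩
    exact ⟨u, hu, y, h⟩
  · rintro ⟨u, hu, y, h⟩
    exact ⟨u, hu, _, ⟨y, rfl⟩, h⟩

variable {p : K} (hp : IsUniformizer p)

include hp

theorem unitFiltration_antitone : Antitone (unitFiltration p) := fun _ _ hmn _ hx =>
  ⟨hx.1, hx.2.trans (pow_le_pow_of_le_one hp.pos.le hp.lt_one.le hmn)⟩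

theorem sqFiltration_antitone : Antitone (sqFiltration p) := fun _ _ hmn =>
  sup_le_sup_right (unitFiltration_antitone hp hmn) _

/-- The map `1 + ct ↦ c mod 𝔭` for an element `t` of valuation `d`. -/
theorem exists_residueHom {d : ℕ} (hd : d ≠ 0) {t : K} (ht : absVal K t = absVal K p ^ d) :
    ∃ f : unitFiltration p d →*
        Multiplicative (IsLocalRing.ResidueField (ringOfIntegers K)),
      Function.Surjective f ∧ ∀ (x : unitFiltration p d) (c : ringOfIntegers K),
        f x = Multiplicative.ofAdd (IsLocalRing.residue _ c) ↔
          absVal K (((x : Kˣ) : K) - 1 - c * t) < absVal K p ^ d := by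
  have ht0 : t ≠ 0 := by
    rw [← map_ne_zero (absVal K), ht]
    exact pow_ne_zero _ hp.pos.ne'
  have hpd : 0 < absVal K p ^ d := pow_pos hp.pos d
  have hpd1 : absVal K p ^ d < 1 := pow_lt_one₀ hp.pos.le hp.lt_one hd
  let g : unitFiltration p d → ringOfIntegers K := fun x =>
    ⟨(((x : Kˣ) : K) - 1) / t, by
      rw [mem_ringOfIntegers_iff_absVal, map_div₀, ht]
      exact div_le_one_of_le₀ x.2.2 hpd.le⟩
  have hg : ∀ x, (g x : K) = (((x : Kˣ) : K) - 1) / t := fun x => rfl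
  let f : unitFiltration p d →* Multiplicative (IsLocalRing.ResidueField (ringOfIntegers K)) :=
    { toFun := fun x => Multiplicative.ofAdd (IsLocalRing.residue _ (g x))
      map_one' := by
        have : g 1 = 0 := Subtype.ext (by rw [hg]; simp)
        rw [this, map_zero, ofAdd_zero]
      map_mul' := by
        intro x y
        rw [← ofAdd_add, ← map_add]
        congr 1
        rw [residue_eq_residue_iff_absVal]
        have h : (g (x * y) : K) - ((g x + g y : ringOfIntegers K) : K) =
            (((x : Kˣ) : K) - 1) * ((((y : Kˣ) : K) - 1) / t) := by
          rw [Subring.coe_add, hg, hg, hg]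
          push_cast
          field_simp
          ring
        rw [h, map_mul]
        exact mul_lt_one_of_nonneg_of_lt_one_left (absVal_nonneg _) (x.2.2.trans_lt hpd1)
          (absVal_coe_le_one (g y)) }
  have hf : ∀ (x : unitFiltration p d) (c : ringOfIntegers K),
        f x = Multiplicative.ofAdd (IsLocalRing.residue _ c) ↔
          absVal K (((x : Kˣ) : K) - 1 - c * t) < absVal K p ^ d := by
    intro x c
    change Multiplicative.ofAdd (IsLocalRing.residue _ (g x)) = _ ↔ _
    rw [Multiplicative.ofAdd.injective.eq_iff, residue_eq_residue_iff_absVal, hg]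
    have h : (((x : Kˣ) : K) - 1) / t - c = (((x : Kˣ) : K) - 1 - c * t) / t := by
      field_simp
    rw [h, map_div₀, ht, div_lt_one hpd]
  refine ⟨f, fun c => ?_, hf⟩
  obtain ⟨c, rfl⟩ := Multiplicative.ofAdd.surjective c
  obtain ⟨c, rfl⟩ := IsLocalRing.residue_surjective c
  have hct : absVal K (c * t) ≤ absVal K p ^ d := by
    rw [map_mul, ht]
    exact mul_le_of_le_one_left hpd.le (absVal_coe_le_one c)
  have h1 : absVal K (1 + c * t) = 1 := by
    rw [absVal_add_eq_of_gt, map_one]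
    rw [map_one]
    exact hct.trans_lt hpd1
  have h0 : 1 + (c : K) * t ≠ 0 := by
    rw [← map_ne_zero (absVal K), h1]
    exact one_ne_zero
  refine ⟨⟨Units.mk0 _ h0, h1, ?_⟩, (hf _ c).2 ?_⟩
  · rw [Units.val_mk0, add_sub_cancel_left]
    exact hct
  · rw [Units.val_mk0, add_sub_cancel_left, sub_self, map_zero]
    exact hpd

theorem relIndex_unitFiltration {d : ℕ} (hd : d ≠ 0) :
    (unitFiltration p (d + 1)).relIndex (unitFiltration p d) = residueCard K := by
  obtain ⟨f, hf, hf'⟩ := exists_residueHom hp hd (t := p ^ d) (map_pow _ _ _)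
  have hker : (unitFiltration p (d + 1)).subgroupOf (unitFiltration p d) = f.ker := by
    ext x
    rw [Subgroup.mem_subgroupOf, MonoidHom.mem_ker, ← ofAdd_zero,
      ← map_zero (IsLocalRing.residue (ringOfIntegers K)), hf', mem_unitFiltration,
      and_iff_right x.2.1]
    simp only [ZeroMemClass.coe_zero, zero_mul, sub_zero]
    exact ⟨fun h => h.trans_lt (hp.pow_lt.2 (Nat.lt_succ_self d)), fun h => hp.le_pow_succ h⟩
  rw [Subgroup.relIndex, hker, Subgroup.index_ker, MonoidHom.range_eq_top.2 hf]
  exact Subgroup.card_top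

omit hp in
/-- If `x²` is close to `1` then so is `x`. -/
theorem absVal_sq_sub_one (x : K) :
    absVal K (x ^ 2 - 1) ≤ absVal K 2 ^ 2 ∧ absVal K (x - 1) ≤ absVal K 2 ∨
      absVal K (x ^ 2 - 1) = absVal K (x - 1) ^ 2 ∧ absVal K 2 < absVal K (x - 1) := by
  have h1 : x ^ 2 - 1 = (x - 1) * ((x - 1) + 2) := by ring
  rw [h1, map_mul]
  rcases le_or_gt (absVal K (x - 1)) (absVal K 2) with h | h
  · left
    refine ⟨?_, h⟩
    rw [sq]
    exact mul_le_mul h ((absVal_add_le _ _).trans (max_le h le_rfl)) (absVal_nonneg _)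
      (absVal_nonneg _)
  · right
    refine ⟨?_, h⟩
    rw [absVal_add_eq_of_gt h, sq]

/-- Either `x² - 1` has valuation at least `2e`, or its valuation is twice that of `x - 1`; so it
cannot be the odd number `2k + 1 < 2e`. -/
theorem sq_mem_unitFiltration_succ {k : ℕ} (hk : k < absRamificationIdx K) {x : Kˣ}
    (hx : x ^ 2 ∈ unitFiltration p (2 * k + 1)) : x ^ 2 ∈ unitFiltration p (2 * k + 2) := by
  obtain ⟨h1, h2⟩ := hx
  refine ⟨h1, ?_⟩
  push_cast at h2 ⊢
  rcases absVal_sq_sub_one (x : K) with ⟨h, -⟩ | ⟨h, -⟩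
  · refine h.trans ?_
    rw [hp.absVal_two_eq, ← pow_mul, hp.pow_le]
    omega
  · rw [h] at h2 ⊢
    have h3 : absVal K (x - 1 : K) < absVal K p ^ k := by
      refine lt_of_pow_lt_pow_left₀ 2 (pow_nonneg hp.pos.le _) (h2.trans_lt ?_)
      rw [← pow_mul, hp.pow_lt]
      omega
    have h4 := pow_le_pow_left₀ (absVal_nonneg _) (hp.le_pow_succ h3) 2
    rw [← pow_mul] at h4
    exact h4.trans_eq (by ring_nf)

/-- Squares contribute nothing new at an odd level below `2e`, so by the second isomorphism theorem
the index is that of consecutive unit groups. -/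
theorem relIndex_sqFiltration_odd {k : ℕ} (hk : k < absRamificationIdx K) :
    (sqFiltration p (2 * k + 2)).relIndex (sqFiltration p (2 * k + 1)) = residueCard K := by
  have hle := unitFiltration_antitone hp (Nat.le_succ (2 * k + 1))
  have hsup : sqFiltration p (2 * k + 1) =
      unitFiltration p (2 * k + 1) ⊔ sqFiltration p (2 * k + 2) := by
    rw [sqFiltration, sqFiltration, ← sup_assoc, sup_eq_left.2 hle]
  have hinf : sqFiltration p (2 * k + 2) ⊓ unitFiltration p (2 * k + 1) =
      unitFiltration p (2 * k + 2) := by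
    refine le_antisymm ?_ (le_inf le_sup_left hle)
    rintro x ⟨hx, hx'⟩
    obtain ⟨u, hu, y, rfl⟩ := mem_sqFiltration.1 hx
    refine mul_mem hu (sq_mem_unitFiltration_succ hp hk ?_)
    exact (Subgroup.mul_mem_cancel_left _ (hle hu)).1 hx'
  rw [hsup, Subgroup.relIndex_sup_right, ← Subgroup.inf_relIndex_right, hinf]
  exact relIndex_unitFiltration hp (by omega)

omit hp in
theorem two_eq_zero_residueField : (2 : IsLocalRing.ResidueField (ringOfIntegers K)) = 0 := by
  rw [← map_ofNat (IsLocalRing.residue (ringOfIntegers K)) 2, IsLocalRing.residue_eq_zero_iff,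
    mem_maximalIdeal_iff_absVal]
  change absVal K 2 < 1
  rw [absVal_two]
  norm_num

omit hp in
theorem exists_sq_residue (c : ringOfIntegers K) :
    ∃ w : ringOfIntegers K, absVal K (c - w ^ 2 : K) < 1 := by
  have := finite_residueField K
  have : CharP (IsLocalRing.ResidueField (ringOfIntegers K)) 2 :=
    CharTwo.of_one_ne_zero_of_two_eq_zero one_ne_zero two_eq_zero_residueField
  obtain ⟨w, hw⟩ := surjective_frobenius (IsLocalRing.ResidueField (ringOfIntegers K)) 2
    (IsLocalRing.residue _ c)
  obtain ⟨w, rfl⟩ := IsLocalRing.residue_surjective w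
  refine ⟨w, ?_⟩
  rw [frobenius_def, ← map_pow, eq_comm, residue_eq_residue_iff_absVal] at hw
  exact hw

/-- The residue field is perfect, so the leading coefficient of `x - 1` at an even level is a square
`w²`, removed by dividing by `(1 + w p^k)²`. The cross term `2 w p^k` has valuation at least `e + k
> 2k` and does no harm. -/
theorem sqFiltration_even {k : ℕ} (hk : k < absRamificationIdx K) :
    sqFiltration p (2 * k + 1) = sqFiltration p (2 * k) := by
  refine le_antisymm (sqFiltration_antitone hp (Nat.le_succ _)) (sup_le ?_ le_sup_right)
  intro x hxmem
  obtain ⟨hx, hx'⟩ := mem_unitFiltration.1 hxmem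
  rw [mem_sqFiltration]
  suffices h : ∃ y : K, absVal K y = 1 ∧ absVal K (x - y ^ 2 : K) < absVal K p ^ (2 * k) by
    obtain ⟨y, hy, hxy⟩ := h
    have hy0 : y ≠ 0 := by
      rw [← map_ne_zero (absVal K), hy]
      exact one_ne_zero
    have hval : ((x / Units.mk0 y hy0 ^ 2 : Kˣ) : K) = x / y ^ 2 := by
      rw [Units.val_div_eq_div_val, Units.val_pow_eq_pow_val, Units.val_mk0]
    refine ⟨x / Units.mk0 y hy0 ^ 2, ⟨?_, ?_⟩, Units.mk0 y hy0, div_mul_cancel _ _⟩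
    · rw [hval, map_div₀, map_pow, hx, hy, one_pow, div_one]
    have h : ((x / Units.mk0 y hy0 ^ 2 : Kˣ) : K) - 1 = (x - y ^ 2) / y ^ 2 := by
      rw [hval]
      field_simp
    rw [h, map_div₀, map_pow, hy, one_pow, div_one]
    exact hp.le_pow_succ hxy
  -- At level 0 the unit `x` itself is approximated by a square, because `1 + w` need not be a unit.
  rcases Nat.eq_zero_or_pos k with rfl | hk0
  · obtain ⟨w, hw⟩ := exists_sq_residue (K := K) ⟨(x : K), (mem_ringOfIntegers_iff_absVal _).2
      hx.le⟩
    refine ⟨w, ?_, by rw [mul_zero, pow_zero]; exact hw⟩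
    have h1 : absVal K (w ^ 2 : K) = 1 := by
      have h2 : (w ^ 2 : K) = -(x - w ^ 2) + x := by ring
      rw [h2, absVal_add_eq_of_lt, hx]
      rw [absVal_neg, hx]
      exact hw
    rw [map_pow] at h1
    exact (pow_eq_one_iff_of_nonneg (absVal_nonneg _) two_ne_zero).1 h1
  · have hpk := pow_ne_zero (2 * k) hp.ne_zero
    obtain ⟨w, hw⟩ := exists_sq_residue (⟨(x - 1) / p ^ (2 * k), by
      rw [mem_ringOfIntegers_iff_absVal, map_div₀, map_pow]
      exact div_le_one_of_le₀ hx' (pow_nonneg hp.pos.le _)⟩ : ringOfIntegers K)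
    have hwk : absVal K (w * p ^ k) ≤ absVal K p ^ k := by
      rw [map_mul, map_pow]
      exact mul_le_of_le_one_left (pow_nonneg hp.pos.le _) (absVal_coe_le_one w)
    refine ⟨1 + w * p ^ k, ?_, ?_⟩
    · rw [absVal_add_eq_of_gt, map_one]
      rw [map_one]
      exact hwk.trans_lt (pow_lt_one₀ hp.pos.le hp.lt_one (by omega))
    · have h : (x - (1 + w * p ^ k) ^ 2 : K) =
          ((x - 1) / p ^ (2 * k) - w ^ 2) * p ^ (2 * k) + -(2 * (w * p ^ k)) := by
        field_simp
        ring
      rw [h]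
      refine (absVal_add_le _ _).trans_lt (max_lt ?_ ?_)
      · rw [map_mul, map_pow]
        exact mul_lt_of_lt_one_left (pow_pos hp.pos _) hw
      · rw [absVal_neg, map_mul, hp.absVal_two_eq]
        refine (mul_le_mul_of_nonneg_left hwk (pow_nonneg hp.pos.le _)).trans_lt ?_
        rw [← pow_add, hp.pow_lt]
        omega

/-- For `y = 1 + 2z` one has `y² = 1 + 4(z² + z)`. So a unit `1 + 4c` with `c` integral is a square
exactly when `c` modulo `𝔭` has the form `z² + z`; sufficiency uses that units closer to 1 than 4
are squares. -/
theorem relIndex_sqFiltration_top :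
    (squares K).relIndex (sqFiltration p (2 * absRamificationIdx K)) = 2 := by
  have := finite_residueField K
  have he := absRamificationIdx_pos K
  have hc0 := charZero_of_algebra_padic K
  have h4 : absVal K 4 = absVal K p ^ (2 * absRamificationIdx K) := by
    rw [absVal_four_eq_sq, hp.absVal_two_eq, ← pow_mul, mul_comm]
  obtain ⟨f, hf, hf'⟩ := exists_residueHom hp (by omega) h4
  let φ : IsLocalRing.ResidueField (ringOfIntegers K) →+
      IsLocalRing.ResidueField (ringOfIntegers K) :=
    { toFun := fun y => y ^ 2 + y
      map_zero' := by ring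
      map_add' := fun x y => by
        have h0 : (2 : IsLocalRing.ResidueField (ringOfIntegers K)) = 0 := two_eq_zero_residueField
        linear_combination (x * y) * h0 }
  have hφ : φ.range.index = 2 :=
    index_range_sq_add_self φ fun y => rfl
  rw [sqFiltration, Subgroup.relIndex_sup_right, Subgroup.relIndex]
  refine Eq.trans ?_ hφ
  rw [← AddSubgroup.index_toSubgroup, ← Subgroup.index_comap_of_surjective _ hf]
  refine congrArg Subgroup.index ?_
  ext x
  rw [Subgroup.mem_subgroupOf, Subgroup.mem_comap]
  constructor
  · rintro ⟨y, hy⟩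
    have hy' : ((x : Kˣ) : K) = (y : K) ^ 2 := by rw [← hy]; rfl
    have hx := x.2.2
    rw [hy', ← h4, absVal_four_eq_sq] at hx
    have hy2 : absVal K (y - 1 : K) ≤ absVal K 2 := by
      rcases absVal_sq_sub_one (y : K) with ⟨-, h⟩ | ⟨h, h'⟩
      · exact h
      · rw [h] at hx
        exact absurd h' (not_lt.2 (le_of_sq_le_sq hx (absVal_nonneg _)))
    have hz : ((y : K) - 1) / 2 ∈ ringOfIntegers K := by
      rw [mem_ringOfIntegers_iff_absVal, map_div₀]
      exact div_le_one_of_le₀ hy2 (absVal_nonneg _)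
    refine ⟨IsLocalRing.residue _ ⟨_, hz⟩, ?_⟩
    have h := (hf' x (⟨_, hz⟩ ^ 2 + ⟨_, hz⟩)).2 (by
      rw [hy', Subring.coe_add, Subring.coe_pow]
      have : (y : K) ^ 2 - 1 - ((((y : K) - 1) / 2) ^ 2 + ((y : K) - 1) / 2) * 4 = 0 := by
        field_simp
        ring
      rw [this, map_zero]
      exact pow_pos hp.pos _)
    rw [h, map_add, map_pow]
    rfl
  · rintro ⟨z, hz⟩
    obtain ⟨z, rfl⟩ := IsLocalRing.residue_surjective z
    have hz' : f x = Multiplicative.ofAdd (IsLocalRing.residue _ (z ^ 2 + z)) := by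
      rw [map_add, map_pow]
      exact hz.symm
    rw [hf', ← h4, Subring.coe_add, Subring.coe_pow] at hz'
    have hy1 : absVal K (1 + 2 * z : K) = 1 := by
      rw [absVal_add_eq_of_gt, map_one]
      rw [map_one, map_mul, absVal_two]
      linarith [absVal_coe_le_one z]
    have hy0 : (1 + 2 * z : K) ≠ 0 := by
      rw [← map_ne_zero (absVal K), hy1]
      exact one_ne_zero
    rw [mem_squares_iff_isSquare]
    have h3 : IsSquare (((x : Kˣ) : K) / (1 + 2 * z) ^ 2) := by
      refine isSquare_of_absVal_sub_one_lt ?_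
      have h5 : ((x : Kˣ) : K) / (1 + 2 * z) ^ 2 - 1 =
          (((x : Kˣ) : K) - 1 - (z ^ 2 + z) * 4) / (1 + 2 * z) ^ 2 := by
        field_simp
        ring
      rw [h5, map_div₀, map_pow, hy1, one_pow, div_one]
      exact hz'
    have h6 := h3.mul (IsSquare.sq (1 + 2 * z : K))
    rwa [div_mul_cancel₀ _ (pow_ne_zero 2 hy0)] at h6

/-- Descending from level `2e`, where the index is 2, each odd level contributes a factor `q` and
each even level contributes nothing. -/
theorem relIndex_squares_even {k : ℕ} (hk : k ≤ absRamificationIdx K) :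
    (squares K).relIndex (sqFiltration p (2 * k)) =
      2 * residueCard K ^ (absRamificationIdx K - k) := by
  induction hk using Nat.decreasingInduction with
  | self => simpa using relIndex_sqFiltration_top hp
  | of_succ k hk ih =>
    rw [← sqFiltration_even hp hk, ← Subgroup.relIndex_mul_relIndex (squares K)
      (sqFiltration p (2 * k + 2)) _ le_sup_right (sqFiltration_antitone hp (Nat.le_succ _)),
      relIndex_sqFiltration_odd hp hk, show 2 * k + 2 = 2 * (k + 1) from rfl, ih, mul_assoc,
      ← pow_succ]
    congr 2
    omega

theorem mem_sqFiltration_zero {x : Kˣ} :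
    x ∈ sqFiltration p 0 ↔ ∃ k : ℤ, absVal K x = absVal K p ^ (2 * k) := by
  rw [mem_sqFiltration]
  constructor
  · rintro ⟨u, hu, y, rfl⟩
    obtain ⟨k, hk⟩ := hp.exists_zpow y.ne_zero
    refine ⟨k, ?_⟩
    rw [Units.val_mul, Units.val_pow_eq_pow_val, map_mul, map_pow, hu.1, hk, one_mul, mul_comm,
      zpow_mul, zpow_ofNat]
  · rintro ⟨k, hk⟩
    have hxk : absVal K ((x * (Units.mk0 p hp.ne_zero ^ (-k)) ^ 2 : Kˣ) : K) = 1 := by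
      push_cast
      rw [map_mul, map_pow, map_zpow₀, hk, Units.val_mk0, ← zpow_ofNat, ← zpow_mul,
        ← zpow_add₀ hp.pos.ne', ← zpow_zero (absVal K p)]
      congr 1
      ring
    refine ⟨x * (Units.mk0 p hp.ne_zero ^ (-k)) ^ 2, ⟨hxk, ?_⟩, Units.mk0 p hp.ne_zero ^ k, ?_⟩
    · refine (absVal_sub_le _ _).trans ?_
      rw [hxk, map_one, max_self, pow_zero]
    · rw [mul_assoc, ← mul_pow, ← zpow_add, neg_add_cancel, zpow_zero, one_pow, mul_one]

theorem index_sqFiltration_zero : (sqFiltration p 0).index = 2 := by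
  rw [Subgroup.index_eq_two_iff]
  refine ⟨Units.mk0 p hp.ne_zero, fun x => ?_⟩
  obtain ⟨k, hk⟩ := hp.exists_zpow x.ne_zero
  have hk' : absVal K ((x * Units.mk0 p hp.ne_zero : Kˣ) : K) = absVal K p ^ (k + 1) := by
    rw [Units.val_mul, map_mul, hk, Units.val_mk0, zpow_add_one₀ hp.pos.ne']
  rw [mem_sqFiltration_zero hp, mem_sqFiltration_zero hp, hk, hk']
  simp only [hp.zpow_inj]
  rcases Int.even_or_odd' k with ⟨j, rfl | rfl⟩
  · refine Or.inr ⟨⟨j, rfl⟩, ?_⟩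
    rintro ⟨i, hi⟩
    omega
  · refine Or.inl ⟨⟨j + 1, by ring⟩, ?_⟩
    rintro ⟨i, hi⟩
    omega

theorem index_squares : (squares K).index = 4 * residueCard K ^ absRamificationIdx K := by
  have h := relIndex_squares_even hp (Nat.zero_le _)
  rw [mul_zero, Nat.sub_zero] at h
  rw [← Subgroup.relIndex_mul_index (show squares K ≤ sqFiltration p 0 from le_sup_right), h,
    index_sqFiltration_zero hp]
  ring

end UnitFiltration

end

noncomputable section

/-! ### Counting classes in a difference of subgroups -/

section Counting

/-- Counting fibres of a map that is constant exactly on the cosets of `S`. -/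
theorem ncard_image_sdiff_subgroup {G X : Type*} [CommGroup G] (f : G → X) {S A B : Subgroup G}
    (hf : ∀ a b, f a = f b ↔ b / a ∈ S) (hS : S.index ≠ 0) (hSB : S ≤ B) (hBA : B ≤ A) :
    (f '' (A \ B : Set G)).Finite ∧
      (f '' (A \ B : Set G)).ncard = S.relIndex A - S.relIndex B := by
  have hfin : Finite (G ⧸ S) := Nat.finite_of_card_ne_zero hS
  have hcard : ∀ H : Subgroup G, (H.map (QuotientGroup.mk' S) : Set (G ⧸ S)).ncard =
      S.relIndex H := by
    intro H
    rw [← MonoidHom.domRestrict_range, ← Nat.card_coe_set_eq]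
    change Nat.card (((QuotientGroup.mk' S).domRestrict H).range) = _
    rw [← Subgroup.index_ker, MonoidHom.ker_domRestrict, QuotientGroup.ker_mk']
    rfl
  let g : G ⧸ S → X := Quotient.lift f fun a b h => (hf a b).2 (by
    have h' := QuotientGroup.leftRel_apply.1 h
    rwa [div_eq_inv_mul])
  have hg : ∀ a : G, g (QuotientGroup.mk' S a) = f a := fun a => rfl
  have hginj : Function.Injective g := by
    intro a b h
    obtain ⟨a, rfl⟩ := QuotientGroup.mk'_surjective S a
    obtain ⟨b, rfl⟩ := QuotientGroup.mk'_surjective S b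
    rw [hg, hg, hf] at h
    exact QuotientGroup.eq.2 (by rwa [← div_eq_inv_mul])
  have himage : f '' (A \ B : Set G) = g '' ((A.map (QuotientGroup.mk' S) : Set (G ⧸ S)) \
      (B.map (QuotientGroup.mk' S) : Set (G ⧸ S))) := by
    ext x
    constructor
    · rintro ⟨a, ⟨ha, hb⟩, rfl⟩
      refine ⟨QuotientGroup.mk' S a, ⟨⟨a, ha, rfl⟩, ?_⟩, rfl⟩
      rintro ⟨b, hbB, hab⟩
      refine hb ?_
      have h := hSB (QuotientGroup.eq.1 hab)
      exact (B.mul_mem_cancel_left (B.inv_mem hbB)).1 h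
    · rintro ⟨_, ⟨⟨a, ha, rfl⟩, hb⟩, rfl⟩
      exact ⟨a, ⟨ha, fun h => hb ⟨a, h, rfl⟩⟩, rfl⟩
  rw [himage]
  refine ⟨(Set.toFinite _).image _, ?_⟩
  rw [Set.ncard_image_of_injective _ hginj, Set.ncard_sdiff (Subgroup.map_mono hBA), hcard, hcard]

end Counting

/-! ### Counting totally ramified quadratic extensions by discriminant -/

section QuadSet

variable (K Ω : Type*) [Field K] [Algebra ℚ_[2] K] [FiniteDimensional ℚ_[2] K] [Field Ω]
  [Algebra K Ω]

/-- The totally ramified quadratic extensions of `K` in `Ω` of discriminant exponent `n`. -/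
def quadSet (n : ℕ) : Set (IntermediateField K Ω) :=
  {F | Module.finrank K F = 2 ∧ IsTotallyRamified K F ∧ idealVal K (discIdeal K F) = n}

variable [IsAlgClosed Ω]

variable {K} in
/-- A square root of `a`. -/
def sqrtIn (a : Kˣ) : Ω := (IsAlgClosed.exists_pow_nat_eq (algebraMap K Ω a) two_pos).choose

variable {K} in
omit [Algebra ℚ_[2] K] [FiniteDimensional ℚ_[2] K] in
theorem sqrtIn_sq (a : Kˣ) : sqrtIn Ω a ^ 2 = algebraMap K Ω a :=
  (IsAlgClosed.exists_pow_nat_eq (algebraMap K Ω a) two_pos).choose_spec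

variable {K} in
/-- The field `K(√a)`. -/
def sqrtField (a : Kˣ) : IntermediateField K Ω := IntermediateField.adjoin K {sqrtIn Ω a}

variable {K}

theorem sqrtField_eq_iff (a b : Kˣ) : sqrtField Ω a = sqrtField Ω b ↔ b / a ∈ squares K := by
  have := charZero_of_algebra_padic K
  rw [mem_squares_iff_isSquare, Units.val_div_eq_div_val]
  exact ⟨isSquare_div_of_adjoin_sqrt_eq (sqrtIn_sq Ω a) (sqrtIn_sq Ω b) a.ne_zero,
    adjoin_sqrt_eq_of_isSquare_div (sqrtIn_sq Ω a) (sqrtIn_sq Ω b) a.ne_zero b.ne_zero⟩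

theorem exists_eq_sqrtField {F : IntermediateField K Ω} (hF : Module.finrank K F = 2) :
    ∃ a : Kˣ, F = sqrtField Ω a := by
  have := charZero_of_algebra_padic K
  obtain ⟨s, a, hs, ha, rfl⟩ := exists_sqrt_generator F hF
  have ha0 : a ≠ 0 := by
    rintro rfl
    exact ha ⟨0, by simp⟩
  refine ⟨Units.mk0 a ha0, adjoin_sqrt_eq_of_isSquare_div hs (sqrtIn_sq Ω _) ha0
    (Units.ne_zero _) ⟨1, ?_⟩⟩
  rw [Units.val_mk0, div_self ha0, one_mul]

theorem finrank_sqrtField {a : Kˣ} (ha : a ∉ squares K) :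
    Module.finrank K (sqrtField Ω a) = 2 :=
  finrank_adjoin_sqrt (sqrtIn_sq Ω a) (by rwa [← mem_squares_iff_isSquare])

/-- This allows `a` to be replaced by a representative `u` of its square class adapted to the
filtration, without changing the field. -/
theorem exists_sqrt_mem_sqrtField {a u y : Kˣ} (hu : u * y ^ 2 = a) (ha : a ∉ squares K) :
    ∃ t : sqrtField Ω a, t ^ 2 = algebraMap K _ (u : K) ∧ ∀ x : K, algebraMap K _ x ≠ t := by
  have hu' : ¬ IsSquare (u : K) := by
    rw [← mem_squares_iff_isSquare]
    intro h
    rw [← hu] at ha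
    exact ha (mul_mem h ⟨y, rfl⟩)
  have hy : algebraMap K Ω y ≠ 0 := (map_ne_zero _).2 y.ne_zero
  have ht : (sqrtIn Ω a / algebraMap K Ω y) ^ 2 = algebraMap K Ω u := by
    rw [div_pow, sqrtIn_sq, ← hu, ← map_pow, Units.val_mul, Units.val_pow_eq_pow_val, map_mul,
      mul_div_cancel_right₀]
    rw [map_pow]
    exact pow_ne_zero 2 hy
  refine ⟨⟨sqrtIn Ω a / algebraMap K Ω y, div_mem
    (IntermediateField.mem_adjoin_simple_self K _) (algebraMap_mem _ _)⟩, Subtype.ext ht, ?_⟩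
  intro x hx
  exact algebraMap_ne_sqrt ht hu' x (congrArg Subtype.val hx)

variable [Algebra ℚ_[2] Ω] [IsScalarTower ℚ_[2] K Ω]

omit [IsAlgClosed Ω] in
theorem finiteDimensional_padic_of_finrank {F : IntermediateField K Ω}
    (hF : Module.finrank K F ≠ 0) : FiniteDimensional ℚ_[2] F := by
  have : FiniteDimensional K F := FiniteDimensional.of_finrank_pos (Nat.pos_of_ne_zero hF)
  exact FiniteDimensional.trans ℚ_[2] K F

variable {p : K} (hp : IsUniformizer p)

include hp

theorem sqrtField_mem_quadSet_of_odd {a : Kˣ} (ha : a ∉ sqFiltration p 0) (n : ℕ) :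
    sqrtField Ω a ∈ quadSet K Ω n ↔ n = 2 * absRamificationIdx K + 1 := by
  have hasq : a ∉ squares K := fun h => ha (le_sup_right (a := unitFiltration p 0) h)
  have h2 := finrank_sqrtField Ω hasq
  have : FiniteDimensional ℚ_[2] (sqrtField Ω a) := finiteDimensional_padic_of_finrank Ω (by omega)
  obtain ⟨t, ht, htK⟩ := exists_sqrt_mem_sqrtField Ω (a := a) (u := a) (y := 1) (by simp) hasq
  obtain ⟨k, hk⟩ := hp.exists_zpow a.ne_zero
  rw [mem_sqFiltration_zero hp] at ha
  rcases Int.even_or_odd' k with ⟨j, rfl | rfl⟩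
  · exact absurd ⟨j, hk⟩ ha
  have h := sqrt_odd h2 ht htK hp hk
  rw [← h.2 n]
  exact ⟨fun h' => h'.2.2, fun h' => ⟨h2, h.1, h'⟩⟩

theorem sqrtField_mem_quadSet_of_even {k : ℕ} (hk : k < absRamificationIdx K) {a : Kˣ}
    (ha : a ∈ sqFiltration p (2 * k)) (ha' : a ∉ sqFiltration p (2 * k + 2)) (n : ℕ) :
    sqrtField Ω a ∈ quadSet K Ω n ↔ n = 2 * (absRamificationIdx K - k) := by
  have hasq : a ∉ squares K := fun h => ha' (le_sup_right (a := unitFiltration p _) h)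
  have h2 := finrank_sqrtField Ω hasq
  have : FiniteDimensional ℚ_[2] (sqrtField Ω a) := finiteDimensional_padic_of_finrank Ω (by omega)
  rw [← sqFiltration_even hp hk] at ha
  obtain ⟨u, ⟨hu, hu'⟩, y, huy⟩ := mem_sqFiltration.1 ha
  obtain ⟨t, ht, htK⟩ := exists_sqrt_mem_sqrtField Ω huy hasq
  have hu2 : absVal K (u - 1 : K) = absVal K p ^ (2 * k + 1) := by
    refine le_antisymm hu' (le_of_not_gt fun h => ha' ?_)
    exact mem_sqFiltration.2 ⟨u, ⟨hu, hp.le_pow_succ h⟩, y, huy⟩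
  have h := sqrt_one_add h2 ht htK hp hu2 hk
  rw [← h.2 n]
  exact ⟨fun h' => h'.2.2, fun h' => ⟨h2, h.1, h'⟩⟩

theorem sqrtField_notMem_quadSet {a : Kˣ} (ha : a ∈ sqFiltration p (2 * absRamificationIdx K))
    (n : ℕ) : sqrtField Ω a ∉ quadSet K Ω n := by
  rintro ⟨h2, h3, -⟩
  have hasq : a ∉ squares K := by
    intro h
    rw [sqrtField, adjoin_sqrt_eq_bot (sqrtIn_sq Ω a) (mem_squares_iff_isSquare.1 h),
      IntermediateField.finrank_bot] at h2
    omega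
  have : FiniteDimensional ℚ_[2] (sqrtField Ω a) := finiteDimensional_padic_of_finrank Ω (by omega)
  obtain ⟨u, ⟨hu, hu'⟩, y, huy⟩ := mem_sqFiltration.1 ha
  obtain ⟨t, ht, htK⟩ := exists_sqrt_mem_sqrtField Ω huy hasq
  refine sqrt_one_add_four h2 ht htK ?_ h3
  rwa [absVal_four_eq_sq, hp.absVal_two_eq, ← pow_mul, mul_comm _ 2]

theorem exists_sqFiltration_jump {a : Kˣ} (ha : a ∈ sqFiltration p 0)
    (ha' : a ∉ sqFiltration p (2 * absRamificationIdx K)) :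
    ∃ k < absRamificationIdx K, a ∈ sqFiltration p (2 * k) ∧ a ∉ sqFiltration p (2 * k + 2) := by
  by_contra hcon
  push Not at hcon
  have : ∀ k ≤ absRamificationIdx K, a ∈ sqFiltration p (2 * k) := by
    intro k
    induction k with
    | zero => exact fun _ => ha
    | succ k ih => exact fun hk => hcon k (by omega) (ih (by omega))
  exact ha' (this _ le_rfl)

theorem quadSet_odd : quadSet K Ω (2 * absRamificationIdx K + 1) =
    sqrtField Ω '' (((⊤ : Subgroup Kˣ) : Set Kˣ) \ (sqFiltration p 0 : Set Kˣ)) := by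
  ext F
  constructor
  · intro hF
    obtain ⟨a, rfl⟩ := exists_eq_sqrtField Ω hF.1
    refine ⟨a, ⟨Subgroup.mem_top _, fun ha => ?_⟩, rfl⟩
    by_cases ha' : a ∈ sqFiltration p (2 * absRamificationIdx K)
    · exact sqrtField_notMem_quadSet Ω hp ha' _ hF
    · obtain ⟨k, hk, hak, hak'⟩ := exists_sqFiltration_jump hp ha ha'
      rw [sqrtField_mem_quadSet_of_even Ω hp hk hak hak'] at hF
      omega
  · rintro ⟨a, ⟨-, ha⟩, rfl⟩
    exact (sqrtField_mem_quadSet_of_odd Ω hp ha _).2 rfl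

theorem quadSet_even {k : ℕ} (hk : k < absRamificationIdx K) :
    quadSet K Ω (2 * (absRamificationIdx K - k)) =
    sqrtField Ω '' ((sqFiltration p (2 * k) : Set Kˣ) \ (sqFiltration p (2 * k + 2) : Set Kˣ)) := by
  ext F
  constructor
  · intro hF
    obtain ⟨a, rfl⟩ := exists_eq_sqrtField Ω hF.1
    by_cases ha0 : a ∈ sqFiltration p 0
    · by_cases ha' : a ∈ sqFiltration p (2 * absRamificationIdx K)
      · exact absurd hF (sqrtField_notMem_quadSet Ω hp ha' _)
      · obtain ⟨j, hj, haj, haj'⟩ := exists_sqFiltration_jump hp ha0 ha'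
        rw [sqrtField_mem_quadSet_of_even Ω hp hj haj haj'] at hF
        obtain rfl : k = j := by omega
        exact ⟨a, ⟨haj, haj'⟩, rfl⟩
    · rw [sqrtField_mem_quadSet_of_odd Ω hp ha0] at hF
      omega
  · rintro ⟨a, ⟨ha, ha'⟩, rfl⟩
    exact (sqrtField_mem_quadSet_of_even Ω hp hk ha ha' _).2 rfl

theorem quadSet_nonempty {n : ℕ} (h : (quadSet K Ω n).Nonempty) :
    n = 2 * absRamificationIdx K + 1 ∨ ∃ k < absRamificationIdx K,
      n = 2 * (absRamificationIdx K - k) := by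
  obtain ⟨F, hF⟩ := h
  obtain ⟨a, rfl⟩ := exists_eq_sqrtField Ω hF.1
  by_cases ha0 : a ∈ sqFiltration p 0
  · by_cases ha' : a ∈ sqFiltration p (2 * absRamificationIdx K)
    · exact absurd hF (sqrtField_notMem_quadSet Ω hp ha' _)
    · obtain ⟨j, hj, haj, haj'⟩ := exists_sqFiltration_jump hp ha0 ha'
      rw [sqrtField_mem_quadSet_of_even Ω hp hj haj haj'] at hF
      exact Or.inr ⟨j, hj, hF⟩
  · rw [sqrtField_mem_quadSet_of_odd Ω hp ha0] at hF
    exact Or.inl hF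

omit hp

/-- The number of totally ramified quadratic extensions with discriminant exponent `n`, for
absolute ramification index `e` and residue cardinality `q`. -/
def quadCount (e q n : ℕ) : ℕ :=
  if n = 2 * e + 1 then 2 * q ^ e
  else if Even n ∧ 2 ≤ n ∧ n ≤ 2 * e then 2 * (q - 1) * q ^ (n / 2 - 1) else 0

variable (K) in
theorem residueCard_pos : 0 < residueCard K := by
  have := finite_residueField K
  exact Nat.card_pos

variable (K) in
-- Each set is the image of a difference of two steps of the filtration, so its size is a difference
-- of indices over the squares: `4q^e - 2q^e` in the odd case and `2q^(e-k) - 2q^(e-k-1)` in the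
-- even case.
theorem quadSet_card (n : ℕ) : (quadSet K Ω n).Finite ∧
    (quadSet K Ω n).ncard = quadCount (absRamificationIdx K) (residueCard K) n := by
  obtain ⟨p, hp⟩ := exists_isUniformizer K
  have hidx : (squares K).index ≠ 0 := by
    rw [index_squares hp]
    have := pow_pos (residueCard_pos K) (absRamificationIdx K)
    omega
  by_cases hodd : n = 2 * absRamificationIdx K + 1
  · subst hodd
    rw [quadSet_odd Ω hp]
    have h := ncard_image_sdiff_subgroup (sqrtField Ω) (sqrtField_eq_iff Ω) hidx
      (B := sqFiltration p 0) (A := ⊤) le_sup_right le_top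
    refine ⟨h.1, h.2.trans ?_⟩
    have h0 := relIndex_squares_even hp (Nat.zero_le _)
    rw [mul_zero, Nat.sub_zero] at h0
    rw [Subgroup.relIndex_top_right, index_squares hp, h0, quadCount, if_pos rfl]
    omega
  by_cases heven : Even n ∧ 2 ≤ n ∧ n ≤ 2 * absRamificationIdx K
  · obtain ⟨k, hk, rfl⟩ : ∃ k < absRamificationIdx K, n = 2 * (absRamificationIdx K - k) := by
      obtain ⟨⟨j, rfl⟩, h1, h2⟩ := heven
      exact ⟨absRamificationIdx K - j, by omega, by omega⟩
    rw [quadSet_even Ω hp hk]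
    have h := ncard_image_sdiff_subgroup (sqrtField Ω) (sqrtField_eq_iff Ω) hidx
      (B := sqFiltration p (2 * k + 2)) (A := sqFiltration p (2 * k)) le_sup_right
      (sqFiltration_antitone hp (by omega))
    refine ⟨h.1, h.2.trans ?_⟩
    rw [relIndex_squares_even hp hk.le, show 2 * k + 2 = 2 * (k + 1) from rfl,
      relIndex_squares_even hp hk, quadCount, if_neg (by omega),
      if_pos ⟨even_two_mul _, by omega, by omega⟩]
    obtain ⟨j, hj⟩ : ∃ j, absRamificationIdx K - k = j + 1 :=
      ⟨absRamificationIdx K - k - 1, by omega⟩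
    rw [hj, show absRamificationIdx K - (k + 1) = j by omega,
      show 2 * (j + 1) / 2 - 1 = j by omega, pow_succ]
    obtain ⟨r, hr⟩ : ∃ r, residueCard K = r + 1 := ⟨residueCard K - 1, by
      have := residueCard_pos K; omega⟩
    rw [hr, Nat.add_sub_cancel, Nat.sub_eq_iff_eq_add]
    · ring
    · nlinarith [pow_pos (Nat.succ_pos r) j]
  · have hempty : quadSet K Ω n = ∅ := by
      refine Set.not_nonempty_iff_eq_empty.1 fun h => ?_
      rcases quadSet_nonempty Ω hp h with h | ⟨k, hk, rfl⟩
      · exact hodd h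
      · exact heven ⟨even_two_mul _, by omega, by omega⟩
    rw [hempty, Set.ncard_empty, quadCount, if_neg hodd, if_neg heven]
    exact ⟨Set.finite_empty, rfl⟩

end QuadSet

end

noncomputable section

/-! ### Groups of order 4 and the dihedral group of order 8 -/

section Groups

theorem card_eq_four_iff {G : Type*} [Group G] :
    Nat.card G = 4 ↔ Nonempty (G ≃* C4) ∨ Nonempty (G ≃* V4) := by
  have hC : Nat.card C4 = 4 := by
    rw [Nat.card_eq_fintype_card]
    rfl
  have hV : Nat.card V4 = 4 := by
    rw [Nat.card_eq_fintype_card]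
    rfl
  constructor
  · intro h
    have hfin : Finite G := Nat.finite_of_card_ne_zero (by omega)
    by_cases hc : IsCyclic G
    · exact Or.inl ⟨mulEquivOfCyclicCardEq (h.trans hC.symm)⟩
    · right
      have hsq : ∀ g : G, g ^ 2 = 1 := by
        intro g
        have h1 : orderOf g ∣ 4 := h ▸ orderOf_dvd_natCard g
        have h2 : orderOf g ≠ 4 := fun h2 => hc (isCyclic_of_orderOf_eq_card g (h2.trans h.symm))
        have h3 := Nat.le_of_dvd (by norm_num) h1
        rw [← orderOf_dvd_iff_pow_eq_one]
        interval_cases orderOf g <;> simp_all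
      have hexp : Monoid.exponent G = 2 := by
        have h1 : Monoid.exponent G ∣ 2 := Monoid.exponent_dvd_of_forall_pow_eq_one hsq
        rcases (Nat.dvd_prime Nat.prime_two).1 h1 with h2 | h2
        · have := Monoid.exp_eq_one_iff.1 h2
          rw [Nat.card_of_subsingleton (1 : G)] at h
          omega
        · exact h2
      have : IsKleinFour G := ⟨h, hexp⟩
      have hexpV : Monoid.exponent V4 = 2 := by
        rw [Monoid.exponent_prod]
        simp
      have : IsKleinFour V4 := ⟨hV, hexpV⟩
      exact IsKleinFour.nonempty_mulEquiv
  · rintro (⟨⟨f⟩⟩ | ⟨⟨f⟩⟩)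
    · rw [Nat.card_congr f.toEquiv, hC]
    · rw [Nat.card_congr f.toEquiv, hV]

/-- In `C4` the class of 2 is a nontrivial square, whereas all squares in `V4` are trivial. -/
theorem not_nonempty_mulEquiv_C4_V4 {G : Type*} [Group G] (f : G ≃* C4) (g : G ≃* V4) : False := by
  have h := (g.symm.trans f).symm.map_eq_one_iff (x := Multiplicative.ofAdd (2 : ZMod 4))
  have h2 : ∀ y : V4, y * y = 1 := by decide
  have h3 : (Multiplicative.ofAdd (2 : ZMod 4) : C4) =
    Multiplicative.ofAdd (1 : ZMod 4) * Multiplicative.ofAdd (1 : ZMod 4) := by decide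
  have h4 := h.1 (by rw [h3, map_mul, h2])
  revert h4
  decide

theorem ncard_subgroups_card_two (G : Type*) [Group G] :
    {H : Subgroup G | Nat.card H = 2}.ncard = {g : G | g ^ 2 = 1 ∧ g ≠ 1}.ncard := by
  have himage : {H : Subgroup G | Nat.card H = 2} =
      Subgroup.zpowers '' {g : G | g ^ 2 = 1 ∧ g ≠ 1} := by
    ext H
    constructor
    · intro hH
      have hH' : Nat.card H = 2 := hH
      have : Finite H := Nat.finite_of_card_ne_zero (by omega)
      have : Nontrivial H := Finite.one_lt_card_iff_nontrivial.1 (by omega)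
      obtain ⟨g, hg⟩ := exists_ne (1 : H)
      have hord : orderOf g = 2 := by
        have h1 : orderOf g ∣ 2 := hH' ▸ orderOf_dvd_natCard g
        rcases (Nat.dvd_prime Nat.prime_two).1 h1 with h2 | h2
        · exact absurd (orderOf_eq_one_iff.1 h2) hg
        · exact h2
      refine ⟨g, ⟨?_, fun h => hg (Subtype.ext h)⟩, ?_⟩
      · rw [← Subgroup.coe_pow, ← hord, pow_orderOf_eq_one, Subgroup.coe_one]
      · refine Subgroup.eq_of_le_of_card_ge (Subgroup.zpowers_le.2 g.2) ?_
        rw [Nat.card_zpowers, Subgroup.orderOf_coe, hord, hH']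
    · rintro ⟨g, ⟨hg, hg1⟩, rfl⟩
      rw [Set.mem_ofPred_eq, Nat.card_zpowers]
      exact orderOf_eq_prime hg hg1
  rw [himage, Set.InjOn.ncard_image]
  rintro g ⟨hg, hg1⟩ h ⟨hh, hh1⟩ hgh
  have hmem : g ∈ Subgroup.zpowers h := hgh ▸ Subgroup.mem_zpowers g
  obtain ⟨k, rfl⟩ := Subgroup.mem_zpowers_iff.1 hmem
  rcases Int.even_or_odd' k with ⟨j, rfl | rfl⟩
  · rw [zpow_mul, zpow_ofNat, hh, one_zpow] at hg1
    exact absurd rfl hg1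
  · rw [zpow_add_one, zpow_mul, zpow_ofNat, hh, one_zpow, one_mul]

theorem ncard_involutions_congr {G H : Type*} [Group G] [Group H] (f : G ≃* H) :
    {g : G | g ^ 2 = 1 ∧ g ≠ 1}.ncard = {g : H | g ^ 2 = 1 ∧ g ≠ 1}.ncard := by
  refine Set.ncard_congr (fun g _ => f g) ?_ (fun _ _ _ _ h => f.injective h) ?_
  · rintro g ⟨h1, h2⟩
    exact ⟨by rw [← map_pow, h1, map_one], by simpa using h2⟩
  · rintro h ⟨h1, h2⟩
    exact ⟨f.symm h, ⟨by rw [← map_pow, h1, map_one], by simpa using h2⟩, by simp⟩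

theorem ncard_subgroups_card_two_C4 {G : Type*} [Group G] (f : G ≃* C4) :
    {H : Subgroup G | Nat.card H = 2}.ncard = 1 := by
  have h : {g : C4 | g ^ 2 = 1 ∧ g ≠ 1} =
      ((Finset.univ.filter fun g : C4 => g ^ 2 = 1 ∧ g ≠ 1 : Finset C4) : Set C4) := by
    ext
    simp
  rw [ncard_subgroups_card_two, ncard_involutions_congr f, h, Set.ncard_coe_finset]
  decide

theorem ncard_subgroups_card_two_V4 {G : Type*} [Group G] (f : G ≃* V4) :
    {H : Subgroup G | Nat.card H = 2}.ncard = 3 := by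
  have h : {g : V4 | g ^ 2 = 1 ∧ g ≠ 1} =
      ((Finset.univ.filter fun g : V4 => g ^ 2 = 1 ∧ g ≠ 1 : Finset V4) : Set V4) := by
    ext
    simp
  rw [ncard_subgroups_card_two, ncard_involutions_congr f, h, Set.ncard_coe_finset]
  decide

/-- The action of the dihedral group on the vertices of the square. -/
def dihedralPermFun : D4 → Equiv.Perm (ZMod 4)
  | .r i => Equiv.addRight i
  | .sr i => (Equiv.neg _).trans (Equiv.addRight (-i))

/-- The permutation representation of the dihedral group on the vertices of the square. -/
def dihedralPerm : D4 →* Equiv.Perm (ZMod 4) :=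
  MonoidHom.mk' dihedralPermFun (by decide)

theorem dihedralPerm_injective : Function.Injective dihedralPerm := by
  rw [injective_iff_map_eq_one]
  change ∀ a, dihedralPermFun a = 1 → a = 1
  decide

/-- A group of order eight that acts faithfully on four points is dihedral. -/
theorem nonempty_mulEquiv_D4 {G X : Type*} [Group G] (hG : Nat.card G = 8) (hX : Nat.card X = 4)
    (f : G →* Equiv.Perm X) (hf : Function.Injective f) : Nonempty (G ≃* D4) := by
  have hfinX : Finite X := Nat.finite_of_card_ne_zero (by omega)
  have hcardZ : Nat.card (ZMod 4) = 4 := Nat.card_zmod 4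
  let σ : X ≃ ZMod 4 :=
    (Finite.equivFinOfCardEq hX).trans (Finite.equivFinOfCardEq hcardZ).symm
  let f' : G →* Equiv.Perm (ZMod 4) := σ.permCongrHom.toMonoidHom.comp f
  have hf' : Function.Injective f' := σ.permCongrHom.injective.comp hf
  have hP : Nat.card (Equiv.Perm (ZMod 4)) = 24 := by
    rw [Nat.card_perm, hcardZ]
    rfl
  have hfac : (24 : ℕ).factorization 2 = 3 := by
    rw [show (24 : ℕ) = 2 ^ 3 * 3 by norm_num, Nat.factorization_mul (by norm_num) (by norm_num),
      Nat.Prime.factorization_pow Nat.prime_two, Nat.Prime.factorization Nat.prime_three]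
    simp
  have hD : Nat.card D4 = 8 := by
    rw [DihedralGroup.nat_card]
  -- Since `24 = 2³ · 3`, both images of order 8 are Sylow 2-subgroups of the symmetric group on
  -- four points, hence isomorphic.
  let S₁ : Sylow 2 (Equiv.Perm (ZMod 4)) := Sylow.ofCard f'.range (by
    rw [hP, hfac, ← Nat.card_congr (MonoidHom.ofInjective hf').toEquiv, hG]
    norm_num)
  let S₂ : Sylow 2 (Equiv.Perm (ZMod 4)) := Sylow.ofCard dihedralPerm.range (by
    rw [hP, hfac, ← Nat.card_congr (MonoidHom.ofInjective dihedralPerm_injective).toEquiv, hD]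
    norm_num)
  exact ⟨((MonoidHom.ofInjective hf').trans (Sylow.equiv S₁ S₂)).trans
    (MonoidHom.ofInjective dihedralPerm_injective).symm⟩

end Groups

end

noncomputable section

open IntermediateField

/-- A field is isomorphic to its image under an embedding. -/
def equivFieldRange {K L M : Type*} [Field K] [Field L] [Field M] [Algebra K L] [Algebra K M]
    (f : L →ₐ[K] M) : L ≃ₐ[K] f.fieldRange := AlgEquiv.ofInjectiveField f

/-! ### Conjugates and automorphisms -/

section Conjugates

variable {K Ω : Type*} [Field K] [CharZero K] [Field Ω] [Algebra K Ω] [IsAlgClosed Ω]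

/-- The number of conjugates of `L` times the number of its automorphisms is its degree. -/
theorem ncard_conjugates_mul_card_aut (L : IntermediateField K Ω) [FiniteDimensional K L] :
    {L' : IntermediateField K Ω | Nonempty (L' ≃ₐ[K] L)}.ncard * Nat.card (L ≃ₐ[K] L) =
      Module.finrank K L := by
  rw [← AlgHom.card K L Ω, ← Nat.card_eq_fintype_card, ← Nat.card_coe_set_eq, ← Nat.card_prod]
  let φ : ∀ L' : {L' : IntermediateField K Ω | Nonempty (L' ≃ₐ[K] L)}, L' ≃ₐ[K] L :=
    fun L' => L'.2.some
  -- Once an isomorphism with `L` is chosen for each conjugate, an embedding of `L` amounts to its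
  -- image together with an automorphism of `L`.
  let g : {L' : IntermediateField K Ω | Nonempty (L' ≃ₐ[K] L)} × (L ≃ₐ[K] L) → (L →ₐ[K] Ω) :=
    fun x => x.1.1.val.comp ((φ x.1).symm.toAlgHom.comp x.2.toAlgHom)
  have hg : ∀ x y, g x y = ((φ x.1).symm (x.2 y) : Ω) := fun x y => rfl
  have hrange : ∀ x, (g x).fieldRange = x.1.1 := by
    intro x
    ext z
    constructor
    · rintro ⟨y, rfl⟩
      exact ((φ x.1).symm (x.2 y)).2
    · intro hz
      exact ⟨x.2.symm (φ x.1 ⟨z, hz⟩), by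
        change g x _ = z
        simp [hg]⟩
  refine Nat.card_congr (Equiv.ofBijective g ⟨?_, ?_⟩)
  · rintro ⟨L₁, σ⟩ ⟨L₂, τ⟩ h
    have h1 : L₁ = L₂ := Subtype.ext (by
      have h1 := hrange (L₁, σ)
      rw [h, hrange] at h1
      exact h1.symm)
    subst h1
    refine Prod.ext rfl (AlgEquiv.ext fun y => ?_)
    have h2 := DFunLike.congr_fun h y
    rw [hg, hg] at h2
    exact (φ L₁).symm.injective (Subtype.ext h2)
  · intro f
    let e : L ≃ₐ[K] f.fieldRange := equivFieldRange f
    let L' : {L' : IntermediateField K Ω | Nonempty (L' ≃ₐ[K] L)} := ⟨f.fieldRange, ⟨e.symm⟩⟩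
    refine ⟨(L', e.trans (φ L')), AlgHom.ext fun y => ?_⟩
    rw [hg]
    simp only [AlgEquiv.trans_apply, AlgEquiv.symm_apply_apply]
    rfl

end Conjugates

/-! ### Quadratic subfields of quartic extensions -/

section Quartic

variable {K L : Type*} [Field K] [CharZero K] [Field L] [Algebra K L]

/-- The quadratic subextensions of `L/K`. -/
def quadSubfields (K L : Type*) [Field K] [Field L] [Algebra K L] : Set (IntermediateField K L) :=
  {F | Module.finrank K F = 2}

variable (h4 : Module.finrank K L = 4)

include h4

theorem finrank_right_of_mem_quadSubfields {F : IntermediateField K L} (hF : F ∈ quadSubfields K L) :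
    Module.finrank F L = 2 := by
  have h := Module.finrank_mul_finrank K F L
  rw [h4, show Module.finrank K F = 2 from hF] at h
  omega

theorem card_fixingSubgroup_of_mem_quadSubfields {F : IntermediateField K L}
    (hF : F ∈ quadSubfields K L) : Nat.card F.fixingSubgroup = 2 := by
  have hFL := finrank_right_of_mem_quadSubfields h4 hF
  have : FiniteDimensional K L := FiniteDimensional.of_finrank_pos (by omega)
  have : Algebra.IsQuadraticExtension F L := { finrank_eq_two' := hFL }
  rw [Nat.card_congr (fixingSubgroupEquiv F).toEquiv, IsGalois.card_aut_eq_finrank, hFL]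

/-- The order divides 4, is even because `L` has a nontrivial involution over a quadratic subfield,
and is not 4 because `L/K` is not Galois. -/
theorem card_aut_of_not_isGalois (hG : ¬ IsGalois K L) (hF : (quadSubfields K L).Nonempty) :
    Nat.card (L ≃ₐ[K] L) = 2 := by
  have : FiniteDimensional K L := FiniteDimensional.of_finrank_pos (by omega)
  obtain ⟨F, hF⟩ := hF
  have h1 : Nat.card (L ≃ₐ[K] L) ≠ 4 := fun h => hG (IsGalois.of_card_aut_eq_finrank K L (by
    rw [h, h4]))
  have h2 : 2 ∣ Nat.card (L ≃ₐ[K] L) :=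
    card_fixingSubgroup_of_mem_quadSubfields h4 hF ▸ Subgroup.card_subgroup_dvd_card _
  have h3 : Nat.card (L ≃ₐ[K] L) ∣ 4 := by
    have h5 := finrank_fixedField_eq_card (⊤ : Subgroup (L ≃ₐ[K] L))
    rw [Subgroup.card_top] at h5
    rw [← h5, ← h4, ← Module.finrank_mul_finrank K (fixedField (⊤ : Subgroup (L ≃ₐ[K] L))) L]
    exact dvd_mul_left _ _
  have h5 := Nat.le_of_dvd (by norm_num) h3
  interval_cases Nat.card (L ≃ₐ[K] L) <;> simp_all

/-- Every quadratic subfield is fixed by a group of order 2, which is the whole automorphism group;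
so it is the fixed field of that group. -/
theorem ncard_quadSubfields_of_not_isGalois (hG : ¬ IsGalois K L)
    (hF : (quadSubfields K L).Nonempty) : (quadSubfields K L).ncard = 1 := by
  have : FiniteDimensional K L := FiniteDimensional.of_finrank_pos (by omega)
  have hA := card_aut_of_not_isGalois h4 hG hF
  obtain ⟨F, hF⟩ := hF
  have key : ∀ E ∈ quadSubfields K L, E = fixedField (⊤ : Subgroup (L ≃ₐ[K] L)) := by
    intro E hE
    have h1 : E.fixingSubgroup = ⊤ := by
      refine Subgroup.eq_top_of_card_eq _ ?_
      rw [card_fixingSubgroup_of_mem_quadSubfields h4 hE, hA]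
    refine eq_of_le_of_finrank_eq' (le_iff_le _ _ |>.2 h1.ge) ?_
    rw [finrank_fixedField_eq_card, Subgroup.card_top, hA,
      finrank_right_of_mem_quadSubfields h4 hE]
  rw [Set.ncard_eq_one]
  exact ⟨F, Set.eq_singleton_iff_unique_mem.2 ⟨hF, fun E hE => (key E hE).trans (key F hF).symm⟩⟩

theorem ncard_quadSubfields_of_isGalois [IsGalois K L] :
    (quadSubfields K L).ncard = {H : Subgroup (L ≃ₐ[K] L) | Nat.card H = 2}.ncard := by
  have : FiniteDimensional K L := FiniteDimensional.of_finrank_pos (by omega)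
  refine Set.ncard_congr (fun F _ => F.fixingSubgroup)
    (fun F hF => card_fixingSubgroup_of_mem_quadSubfields h4 hF) ?_ ?_
  · intro E F _ _ h
    rw [← IsGalois.fixedField_fixingSubgroup E, h, IsGalois.fixedField_fixingSubgroup]
  · intro H hH
    refine ⟨fixedField H, ?_, fixingSubgroup_fixedField H⟩
    have h := Module.finrank_mul_finrank K (fixedField H) L
    rw [finrank_fixedField_eq_card, show Nat.card H = 2 from hH, h4] at h
    change Module.finrank K (fixedField H) = 2
    omega

end Quartic

/-! ### The normal closure and its action on the embeddings -/

section Closure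

variable {K L : Type*} [Field K] [CharZero K] [Field L] [Algebra K L] [FiniteDimensional K L]

instance isGalois_closure :
    IsGalois K (normalClosure K L (AlgebraicClosure L)) where
  to_isSeparable := inferInstance
  to_normal := by
    have : Algebra.IsAlgebraic K (AlgebraicClosure L) := Algebra.IsAlgebraic.trans K L _
    have : IsAlgClosure K (AlgebraicClosure L) := ⟨inferInstance, inferInstance⟩
    have : Normal K (AlgebraicClosure L) := IsAlgClosure.normal K _
    infer_instance

variable (K L) in
theorem card_galoisClosureGroup : Nat.card (GaloisClosureGroup K L) =
    Module.finrank K (normalClosure K L (AlgebraicClosure L)) :=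
  IsGalois.card_aut_eq_finrank _ _

theorem nonempty_equiv_closure_of_isGalois [IsGalois K L] :
    Nonempty (L ≃ₐ[K] normalClosure K L (AlgebraicClosure L)) := by
  let f : L →ₐ[K] AlgebraicClosure L := IsScalarTower.toAlgHom K L _
  have h : normalClosure K L (AlgebraicClosure L) = f.fieldRange := by
    refine le_antisymm ?_ f.fieldRange_le_normalClosure
    rw [normalClosure_le_iff]
    intro g
    have : Normal K f.fieldRange := Normal.of_algEquiv (equivFieldRange f)
    have h1 := (IntermediateField.normal_iff_forall_fieldRange_le (K := f.fieldRange)).1 this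
      (g.comp (equivFieldRange f).symm.toAlgHom)
    refine le_trans ?_ h1
    rintro _ ⟨x, rfl⟩
    exact ⟨equivFieldRange f x, congrArg g ((equivFieldRange f).symm_apply_apply x)⟩
  exact ⟨(equivFieldRange f).trans (equivOfEq h.symm)⟩

theorem nonempty_galoisClosureGroup_of_isGalois [IsGalois K L] :
    Nonempty (GaloisClosureGroup K L ≃* (L ≃ₐ[K] L)) := by
  obtain ⟨f⟩ := nonempty_equiv_closure_of_isGalois (K := K) (L := L)
  exact ⟨f.symm.autCongr⟩

variable (K L) in
/-- The embedding of `L` in its normal closure. -/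
def toClosure : L →ₐ[K] normalClosure K L (AlgebraicClosure L) :=
  (normalClosure.algHomEquiv K L (AlgebraicClosure L)).symm (IsScalarTower.toAlgHom K L _)

theorem isGalois_of_card_galoisClosureGroup
    (h : Nat.card (GaloisClosureGroup K L) = Module.finrank K L) : IsGalois K L := by
  rw [card_galoisClosureGroup] at h
  have h1 : (toClosure K L).fieldRange = ⊤ := by
    refine eq_of_le_of_finrank_eq le_top ?_
    rw [finrank_top', h]
    exact (equivFieldRange (toClosure K L)).toLinearEquiv.finrank_eq.symm
  have e : L ≃ₐ[K] normalClosure K L (AlgebraicClosure L) :=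
    ((equivFieldRange (toClosure K L)).trans (equivOfEq h1)).trans topEquiv
  exact IsGalois.of_algEquiv e.symm

/-- An automorphism of the normal closure is determined by its action on the conjugates of `L`. -/
theorem galoisClosureGroup_eq_one (σ : GaloisClosureGroup K L)
    (h : ∀ (f : L →ₐ[K] normalClosure K L (AlgebraicClosure L)) (x : L), σ (f x) = f x) :
    σ = 1 := by
  have hle : normalClosure K L (AlgebraicClosure L) ≤
      lift (fixedField (Subgroup.zpowers σ)) := by
    rw [normalClosure_le_iff]
    rintro g _ ⟨x, rfl⟩
    have hx := h ((normalClosure.algHomEquiv K L (AlgebraicClosure L)).symm g) x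
    refine (mem_lift ((normalClosure.algHomEquiv K L (AlgebraicClosure L)).symm g x)).2 ?_
    rw [mem_fixedField_iff]
    intro τ hτ
    have h2 : Subgroup.zpowers σ ≤ MulAction.stabilizer (GaloisClosureGroup K L)
        ((normalClosure.algHomEquiv K L (AlgebraicClosure L)).symm g x) :=
      Subgroup.zpowers_le.2 hx
    exact h2 hτ
  refine AlgEquiv.ext fun y => ?_
  have hy := (mem_lift y).1 (hle y.2)
  exact (mem_fixedField_iff _ _).1 hy σ (Subgroup.mem_zpowers σ)

variable (K L) in
/-- The action of the Galois group of the normal closure on the embeddings of `L`. -/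
def embeddingAction : GaloisClosureGroup K L →*
    Equiv.Perm (L →ₐ[K] normalClosure K L (AlgebraicClosure L)) where
  toFun σ :=
    { toFun := fun f => σ.toAlgHom.comp f
      invFun := fun f => σ.symm.toAlgHom.comp f
      left_inv := fun _ => AlgHom.ext fun _ => σ.symm_apply_apply _
      right_inv := fun _ => AlgHom.ext fun _ => σ.apply_symm_apply _ }
  map_one' := rfl
  map_mul' _ _ := rfl

theorem embeddingAction_injective : Function.Injective (embeddingAction K L) := by
  rw [injective_iff_map_eq_one]
  intro σ hσ
  refine galoisClosureGroup_eq_one σ fun f x => ?_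
  exact DFunLike.congr_fun (DFunLike.congr_fun hσ f) x

variable (K L) in
theorem card_embeddings :
    Nat.card (L →ₐ[K] normalClosure K L (AlgebraicClosure L)) = Module.finrank K L := by
  rw [Nat.card_congr (normalClosure.algHomEquiv K L (AlgebraicClosure L)),
    Nat.card_eq_fintype_card, AlgHom.card]

end Closure

/-! ### The Galois group of the closure of a quartic extension -/

section Dihedral

variable {K L : Type*} [Field K] [CharZero K] [Field L] [Algebra K L]

omit [CharZero K] in
/-- Elements of a quadratic extension satisfy a monic quadratic equation. -/
theorem exists_quadratic_equation (h2 : Module.finrank K L = 2) (x : L) :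
    ∃ b c : K, x ^ 2 + algebraMap K L b * x + algebraMap K L c = 0 := by
  have : FiniteDimensional K L := FiniteDimensional.of_finrank_pos (by omega)
  have h := LinearMap.aeval_self_charpoly (Algebra.lmul K L x)
  have hd : (Algebra.lmul K L x).charpoly.natDegree = 2 := by
    rw [LinearMap.charpoly_natDegree, h2]
  have hm := (Algebra.lmul K L x).charpoly_monic
  rw [Polynomial.aeval_algHom_apply] at h
  have h1 : Polynomial.aeval x (Algebra.lmul K L x).charpoly = 0 := by
    simpa using DFunLike.congr_fun h 1
  rw [Polynomial.aeval_eq_sum_range, hd, Finset.sum_range_succ, Finset.sum_range_succ,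
    Finset.sum_range_one, ← hd, hm.coeff_natDegree, hd] at h1
  refine ⟨(Algebra.lmul K L x).charpoly.coeff 1, (Algebra.lmul K L x).charpoly.coeff 0, ?_⟩
  simp only [Algebra.smul_def, pow_zero, mul_one, pow_one, map_one, one_mul] at h1
  rw [← h1]
  ring

/-- The automorphism permutes the roots `y` and `-y - b` of the quadratic, so its square fixes `y`.
-/
theorem apply_apply_eq_of_quadratic {K M : Type*} [Field K] [Field M] [Algebra K M]
    (σ : M ≃ₐ[K] M) {b c y : M} (hb : σ b = b)
    (hc : σ c = c) (h : y ^ 2 + b * y + c = 0) : σ (σ y) = y := by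
  have h1 : σ y ^ 2 + b * σ y + c = 0 := by
    have := congrArg σ h
    simpa [hb, hc] using this
  have h2 : (σ y - y) * (σ y + y + b) = 0 := by linear_combination h1 - h
  rcases mul_eq_zero.1 h2 with h3 | h3
  · rw [sub_eq_zero.1 h3, sub_eq_zero.1 h3]
  · have h4 : σ y = -y - b := by linear_combination h3
    rw [h4, map_sub, map_neg, h4, hb]
    ring

variable (h4 : Module.finrank K L = 4)

include h4

/-- The faithful action on four embeddings makes the order divide 24. Each `σ²` fixes the conjugates
of `F` and hence each `σ⁴` fixes those of `L`, so the group is a 2-group. Its order is divisible by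
4 and differs from 4 because `L/K` is not Galois. -/
theorem card_galoisClosureGroup_eq_eight (hG : ¬ IsGalois K L)
    (hF : (quadSubfields K L).Nonempty) : Nat.card (GaloisClosureGroup K L) = 8 := by
  have : FiniteDimensional K L := FiniteDimensional.of_finrank_pos (by omega)
  have hfin : Finite (L →ₐ[K] normalClosure K L (AlgebraicClosure L)) :=
    Nat.finite_of_card_ne_zero (by rw [card_embeddings]; omega)
  have hfinG : Finite (GaloisClosureGroup K L) := Finite.of_injective _ embeddingAction_injective
  obtain ⟨F, hF⟩ := hF
  have h24 : Nat.card (GaloisClosureGroup K L) ∣ 24 := by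
    have h := Subgroup.card_dvd_of_injective _ (embeddingAction_injective (K := K) (L := L))
    rw [Nat.card_perm, card_embeddings, h4] at h
    exact h
  have hpow : ∀ σ : GaloisClosureGroup K L, σ ^ 4 = 1 := by
    intro σ
    refine galoisClosureGroup_eq_one _ fun f x => ?_
    have hKF : ∀ y : F, σ (σ (f y)) = f y := by
      intro y
      obtain ⟨b, c, hbc⟩ := exists_quadratic_equation hF y
      have hbc' := congrArg (fun z : F => f (z : L)) hbc
      refine apply_apply_eq_of_quadratic σ (b := algebraMap K _ b)
        (c := algebraMap K _ c) (σ.commutes b) (σ.commutes c) ?_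
      have hb : ((algebraMap K F b : F) : L) = algebraMap K L b := rfl
      have hc : ((algebraMap K F c : F) : L) = algebraMap K L c := rfl
      simpa [hb, hc] using hbc'
    obtain ⟨b, c, hbc⟩ := exists_quadratic_equation (finrank_right_of_mem_quadSubfields h4 hF) x
    have hbc' := congrArg f hbc
    have h := apply_apply_eq_of_quadratic (σ * σ)
      (b := f (b : L)) (c := f (c : L)) (y := f x) (hKF b) (hKF c) (by
        rw [map_zero, map_add, map_add, map_pow, map_mul] at hbc'
        exact hbc')
    rw [show σ ^ 4 = (σ * σ) * (σ * σ) by rw [← sq, ← sq, ← pow_mul]]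
    exact h
  have hP : IsPGroup 2 (GaloisClosureGroup K L) := fun σ => ⟨2, hpow σ⟩
  obtain ⟨n, hn⟩ := IsPGroup.iff_card.1 hP
  have h4dvd : 4 ∣ Nat.card (GaloisClosureGroup K L) := by
    have h := finrank_dvd_of_le_right (le_top (a := (toClosure K L).fieldRange))
    rw [finrank_top', ← card_galoisClosureGroup,
      ← (equivFieldRange (toClosure K L)).toLinearEquiv.finrank_eq, h4] at h
    exact h
  have hne : Nat.card (GaloisClosureGroup K L) ≠ 4 := fun h =>
    hG (isGalois_of_card_galoisClosureGroup (h.trans h4.symm))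
  rw [hn] at h24 h4dvd hne ⊢
  have hn5 : n < 5 := by
    by_contra hc
    have h1 : 2 ^ 5 ∣ 24 := (pow_dvd_pow 2 (not_lt.1 hc)).trans h24
    omega
  interval_cases n <;> simp_all

theorem nonempty_mulEquiv_D4_iff :
    Nonempty (GaloisClosureGroup K L ≃* D4) ↔ ¬ IsGalois K L ∧ (quadSubfields K L).Nonempty := by
  have : FiniteDimensional K L := FiniteDimensional.of_finrank_pos (by omega)
  constructor
  · rintro ⟨f⟩
    have h8 : Nat.card (GaloisClosureGroup K L) = 8 := by
      rw [Nat.card_congr f.toEquiv, DihedralGroup.nat_card]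
    have hfinG : Finite (GaloisClosureGroup K L) := Nat.finite_of_card_ne_zero (by omega)
    refine ⟨fun hG => ?_, ?_⟩
    · obtain ⟨g⟩ := nonempty_galoisClosureGroup_of_isGalois (K := K) (L := L)
      rw [Nat.card_congr g.toEquiv, IsGalois.card_aut_eq_finrank, h4] at h8
      omega
    · let e := equivFieldRange (toClosure K L)
      have hL' : Module.finrank K (toClosure K L).fieldRange = 4 := by
        rw [← e.toLinearEquiv.finrank_eq, h4]
      have hfd := card_galoisClosureGroup K L
      rw [h8] at hfd
      have : FiniteDimensional K (normalClosure K L (AlgebraicClosure L)) :=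
        FiniteDimensional.of_finrank_pos (by omega)
      have hH : Nat.card (toClosure K L).fieldRange.fixingSubgroup = 2 ^ 1 := by
        rw [IsGalois.card_fixingSubgroup_eq_finrank]
        have h := Module.finrank_mul_finrank K (toClosure K L).fieldRange
          (normalClosure K L (AlgebraicClosure L))
        rw [hL', ← hfd] at h
        omega
      -- The group of order 2 fixing `L` lies in a subgroup of order 4, whose fixed field is
      -- quadratic over `K` and contained in `L`.
      obtain ⟨H, hH4, hle⟩ := Sylow.exists_subgroup_card_pow_succ (p := 2) (n := 1)
        (by rw [h8]; norm_num) hH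
      have hFle : fixedField H ≤ (toClosure K L).fieldRange := by
        rw [← IsGalois.fixedField_fixingSubgroup (toClosure K L).fieldRange]
        exact fixedField_le hle
      have hF : Module.finrank K (fixedField H) = 2 := by
        have h := Module.finrank_mul_finrank K (fixedField H)
          (normalClosure K L (AlgebraicClosure L))
        rw [finrank_fixedField_eq_card, hH4, ← hfd] at h
        omega
      refine ⟨(restrict hFle).map e.symm.toAlgHom, ?_⟩
      change Module.finrank K _ = 2
      rw [← (intermediateFieldMap e.symm (restrict hFle)).toLinearEquiv.finrank_eq,
        ← (restrictAlgEquiv hFle).toLinearEquiv.finrank_eq, hF]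
  · rintro ⟨hG, hF⟩
    exact nonempty_mulEquiv_D4 (card_galoisClosureGroup_eq_eight h4 hG hF)
      ((card_embeddings K L).trans h4) _ embeddingAction_injective

theorem nonempty_mulEquiv_iff_of_card_eq_four {G : Type} [Group G] (hG : Nat.card G = 4) :
    Nonempty (GaloisClosureGroup K L ≃* G) ↔ IsGalois K L ∧ Nonempty ((L ≃ₐ[K] L) ≃* G) := by
  have : FiniteDimensional K L := FiniteDimensional.of_finrank_pos (by omega)
  constructor
  · rintro ⟨f⟩
    have hGal : IsGalois K L := isGalois_of_card_galoisClosureGroup (by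
      rw [Nat.card_congr f.toEquiv, hG, h4])
    obtain ⟨g⟩ := nonempty_galoisClosureGroup_of_isGalois (K := K) (L := L)
    exact ⟨hGal, ⟨g.symm.trans f⟩⟩
  · rintro ⟨hGal, ⟨f⟩⟩
    obtain ⟨g⟩ := nonempty_galoisClosureGroup_of_isGalois (K := K) (L := L)
    exact ⟨g.trans f⟩

end Dihedral

end

noncomputable section

open IntermediateField

/-! ### Counting with fibres of constant size -/

section FibreCount

theorem ncard_eq_mul_ncard_image {α β : Type*} {X : Set α} (hX : X.Finite) (f : α → β) {c : ℕ}
    (hc : ∀ x ∈ X, {y ∈ X | f y = f x}.ncard = c) : X.ncard = c * (f '' X).ncard := by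
  classical
  lift X to Finset α using hX
  rw [Set.ncard_coe_finset, ← Finset.coe_image, Set.ncard_coe_finset,
    Finset.card_eq_sum_card_image f X, mul_comm]
  refine Finset.sum_const_nat fun y hy => ?_
  obtain ⟨x, hx, rfl⟩ := Finset.mem_image.1 hy
  rw [← hc x hx, ← Set.ncard_coe_finset]
  congr 1
  ext z
  simp

theorem ncard_prod_fibre {α β : Type*} {X : Set α} (hX : X.Finite) {Y : α → Set β} {c : ℕ}
    (hY : ∀ x ∈ X, (Y x).Finite) (hc : ∀ x ∈ X, (Y x).ncard = c) :
    {z : α × β | z.1 ∈ X ∧ z.2 ∈ Y z.1}.Finite ∧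
      {z : α × β | z.1 ∈ X ∧ z.2 ∈ Y z.1}.ncard = X.ncard * c := by
  classical
  have h : {z : α × β | z.1 ∈ X ∧ z.2 ∈ Y z.1} = ⋃ x ∈ X, Prod.mk x '' Y x := by
    ext ⟨x, y⟩
    simp [and_comm]
  have hfin : {z : α × β | z.1 ∈ X ∧ z.2 ∈ Y z.1}.Finite := by
    rw [h]
    exact hX.biUnion fun x hx => (hY x hx).image _
  refine ⟨hfin, ?_⟩
  lift X to Finset α using hX
  obtain ⟨Z, hZ⟩ := hfin.exists_finset_coe
  rw [← hZ, Set.ncard_coe_finset, Set.ncard_coe_finset, Finset.card_eq_sum_card_fiberwise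
    (f := Prod.fst) (t := X)]
  · refine Finset.sum_const_nat fun x hx => ?_
    rw [← hc x hx, ← Set.ncard_coe_finset, ← Set.ncard_image_of_injective (Y x) (Prod.mk_right_injective x)]
    congr 1
    ext ⟨x', y⟩
    have h1 : (x', y) ∈ Z ↔ x' ∈ X ∧ y ∈ Y x' := by
      rw [← Finset.mem_coe, hZ]
      simp
    simp only [Finset.coe_filter, Set.mem_ofPred_eq, h1, Set.mem_image, Prod.mk.injEq]
    constructor
    · rintro ⟨⟨-, h2⟩, rfl⟩
      exact ⟨y, h2, rfl, rfl⟩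
    · rintro ⟨y, h2, rfl, rfl⟩
      exact ⟨⟨hx, h2⟩, rfl⟩
  · intro z hz
    have : z ∈ (Z : Set (α × β)) := hz
    rw [hZ] at this
    exact this.1

end FibreCount

/-! ### Invariance under `K`-isomorphism -/

section Invariance

variable {K L L' : Type*} [Field K] [Algebra ℚ_[2] K] [FiniteDimensional ℚ_[2] K] [Field L]
  [Algebra K L] [Field L'] [Algebra K L']

theorem discIdeal_le_of_algEquiv (f : L ≃ₐ[K] L') : discIdeal K L ≤ discIdeal K L' := by
  refine Ideal.span_mono ?_
  rintro a ⟨b, hb, hab⟩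
  have hn : Module.finrank K L = Module.finrank K L' := f.toLinearEquiv.finrank_eq
  have hfun : ⇑((b.map f.toLinearEquiv).reindex (finCongr hn)) = f ∘ b ∘ (finCongr hn).symm := by
    ext i
    simp
  refine ⟨(b.map f.toLinearEquiv).reindex (finCongr hn), fun i => ?_, ?_⟩
  · rw [hfun]
    exact (hb _).map (f.restrictScalars (ringOfIntegers K))
  · rw [hab, hfun, ← Algebra.discr_reindex K b (finCongr hn)]
    exact Algebra.discr_eq_discr_of_algEquiv _ f

theorem discIdeal_congr (f : L ≃ₐ[K] L') : discIdeal K L = discIdeal K L' :=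
  le_antisymm (discIdeal_le_of_algEquiv f) (discIdeal_le_of_algEquiv f.symm)

variable [Algebra ℚ_[2] L] [FiniteDimensional ℚ_[2] L] [IsScalarTower ℚ_[2] K L]
  [Algebra ℚ_[2] L'] [FiniteDimensional ℚ_[2] L'] [IsScalarTower ℚ_[2] K L']

theorem isTotallyRamified_congr [FiniteDimensional K L] [FiniteDimensional K L']
    (f : L ≃ₐ[K] L') : IsTotallyRamified K L ↔ IsTotallyRamified K L' := by
  obtain ⟨p, hp⟩ := exists_isUniformizer K
  rw [isTotallyRamified_iff hp, isTotallyRamified_iff hp, f.toLinearEquiv.finrank_eq]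
  constructor
  · rintro ⟨x, hx⟩
    exact ⟨f x, by rw [← hx]; exact congrArg (· ^ _) (absVal_map f.toAlgHom x)⟩
  · rintro ⟨x, hx⟩
    exact ⟨f.symm x, by rw [← hx]; exact congrArg (· ^ _) (absVal_map f.symm.toAlgHom x)⟩

end Invariance

/-! ### Quartic extensions above a given quadratic extension -/

section QuarticSet

variable (K Ω : Type*) [Field K] [Algebra ℚ_[2] K] [FiniteDimensional ℚ_[2] K] [Field Ω]
  [Algebra K Ω]

/-- The totally ramified quartic extensions of `K` in `Ω` of discriminant exponent `m`. -/
def quarticSet (m : ℕ) : Set (IntermediateField K Ω) :=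
  {L | Module.finrank K L = 4 ∧ IsTotallyRamified K L ∧ idealVal K (discIdeal K L) = m}

variable {K Ω} [Algebra ℚ_[2] Ω] [IsScalarTower ℚ_[2] K Ω]

theorem quarticSet_congr {L L' : IntermediateField K Ω} (f : L ≃ₐ[K] L') {m : ℕ}
    (hL : L ∈ quarticSet K Ω m) : L' ∈ quarticSet K Ω m := by
  obtain ⟨h4, hT, hm⟩ := hL
  have h4' : Module.finrank K L' = 4 := by rw [← f.toLinearEquiv.finrank_eq, h4]
  have : FiniteDimensional K L := FiniteDimensional.of_finrank_pos (by omega)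
  have : FiniteDimensional K L' := FiniteDimensional.of_finrank_pos (by omega)
  have : FiniteDimensional ℚ_[2] L := FiniteDimensional.trans ℚ_[2] K L
  have : FiniteDimensional ℚ_[2] L' := FiniteDimensional.trans ℚ_[2] K L'
  exact ⟨h4', (isTotallyRamified_congr f).1 hT, by rw [← discIdeal_congr f, hm]⟩

/-- The quartic extensions above a quadratic extension `F` correspond to quadratic extensions
of `F`. -/
theorem quarticSet_above [IsAlgClosed Ω] {F : IntermediateField K Ω} {a : ℕ}
    (hF : F ∈ quadSet K Ω a) (m : ℕ) :
    {L | L ∈ quarticSet K Ω m ∧ F ≤ L}.Finite ∧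
    {L | L ∈ quarticSet K Ω m ∧ F ≤ L}.ncard = if 2 * a ≤ m then
      quadCount (2 * absRamificationIdx K) (residueCard K) (m - 2 * a) else 0 := by
  obtain ⟨h2, hFT, ha⟩ := hF
  have : FiniteDimensional K F := FiniteDimensional.of_finrank_pos (by omega)
  have : FiniteDimensional ℚ_[2] F := FiniteDimensional.trans ℚ_[2] K F
  have : IsScalarTower ℚ_[2] F Ω := IsScalarTower.of_algebraMap_eq fun _ => rfl
  obtain ⟨p, hp⟩ := exists_isUniformizer K
  obtain ⟨P, hP⟩ := (isTotallyRamified_iff hp).1 hFT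
  rw [h2] at hP
  have he : absRamificationIdx F = 2 * absRamificationIdx K :=
    absRamificationIdx_eq_of_sq_eq hp hP h2
  have hq : residueCard F = residueCard K := residueCard_eq_of_sq_eq hp hP h2
  -- By transitivity `L/F` has discriminant exponent `m - 2a`; the condition `2 * a ≤ m` guards the
  -- truncated subtraction.
  have key : {L | L ∈ quarticSet K Ω m ∧ F ≤ L} = restrictScalars K ''
      {L : IntermediateField F Ω | 2 * a ≤ m ∧ L ∈ quadSet F Ω (m - 2 * a)} := by
    have hiff : ∀ L : IntermediateField F Ω, restrictScalars K L ∈ quarticSet K Ω m ↔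
        2 * a ≤ m ∧ L ∈ quadSet F Ω (m - 2 * a) := by
      intro L
      have : IsScalarTower ℚ_[2] K L := IsScalarTower.of_algebraMap_eq fun x => Subtype.ext
        (IsScalarTower.algebraMap_apply ℚ_[2] K Ω x)
      let f : restrictScalars K L ≃ₐ[K] L := AlgEquiv.refl (A₁ := L)
      have hmul := Module.finrank_mul_finrank K F L
      rw [h2] at hmul
      by_cases hL2 : Module.finrank F L = 2
      · have : FiniteDimensional F L := FiniteDimensional.of_finrank_pos (by omega)
        have : FiniteDimensional ℚ_[2] L := FiniteDimensional.trans ℚ_[2] F L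
        have : FiniteDimensional K L := FiniteDimensional.trans K F L
        have : FiniteDimensional K (restrictScalars K L) := f.symm.toLinearEquiv.finiteDimensional
        have : FiniteDimensional ℚ_[2] (restrictScalars K L) :=
          FiniteDimensional.trans ℚ_[2] K (restrictScalars K L)
        rw [quarticSet, quadSet, Set.mem_ofPred_eq, Set.mem_ofPred_eq,
          f.toLinearEquiv.finrank_eq, isTotallyRamified_congr f, discIdeal_congr f,
          isTotallyRamified_tower_iff h2 hL2, ← hmul, hL2]
        by_cases hLT : IsTotallyRamified F L
        · obtain ⟨a', b, ha', hb, hab⟩ := idealVal_discIdeal_tower h2 hL2 hFT hLT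
          rw [ha, Nat.cast_inj] at ha'
          subst ha'
          rw [hab, hb, Nat.cast_inj, Nat.cast_inj]
          simp only [hFT, hLT, true_and]
          omega
        · simp [hLT]
      · refine iff_of_false (fun h => hL2 ?_) (fun h => hL2 h.2.1)
        have h4 := h.1
        rw [f.toLinearEquiv.finrank_eq] at h4
        omega
    ext L
    constructor
    · rintro ⟨hL, hFL⟩
      refine ⟨extendScalars hFL, ?_, extendScalars_restrictScalars hFL⟩
      exact (hiff _).1 hL
    · rintro ⟨L, hL, rfl⟩
      refine ⟨(hiff L).2 hL, fun x hx => ?_⟩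
      exact L.algebraMap_mem ⟨x, hx⟩
  rw [key]
  have hcard := quadSet_card F Ω (m - 2 * a)
  rw [he, hq] at hcard
  split_ifs with h
  · have h1 : {L : IntermediateField F Ω | 2 * a ≤ m ∧ L ∈ quadSet F Ω (m - 2 * a)} =
        quadSet F Ω (m - 2 * a) := by
      ext
      simp [h]
    rw [h1, Set.ncard_image_of_injective _ (restrictScalars_injective K)]
    exact ⟨hcard.1.image _, hcard.2⟩
  · have h1 : {L : IntermediateField F Ω | 2 * a ≤ m ∧ L ∈ quadSet F Ω (m - 2 * a)} = ∅ := by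
      ext
      simp [h]
    rw [h1, Set.image_empty, Set.ncard_empty]
    exact ⟨Set.finite_empty, rfl⟩

end QuarticSet

end

noncomputable section

open IntermediateField

/-! ### Counting towers by their quadratic subfield -/

section Towers

variable {K Ω : Type*} [Field K] [Algebra ℚ_[2] K] [FiniteDimensional ℚ_[2] K] [Field Ω]
  [Algebra K Ω] [Algebra ℚ_[2] Ω] [IsScalarTower ℚ_[2] K Ω] [IsAlgClosed Ω]

/-- A quadratic subextension of a totally ramified quartic extension is totally ramified. -/
theorem exists_mem_quadSet_of_le {F L : IntermediateField K Ω} (hFL : F ≤ L)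
    (hF : Module.finrank K F = 2) {m : ℕ} (hL : L ∈ quarticSet K Ω m) :
    ∃ a < 2 * absRamificationIdx K + 2, F ∈ quadSet K Ω a := by
  let _ : Algebra F L := (inclusion hFL).toRingHom.toAlgebra
  have : IsScalarTower K F L := IsScalarTower.of_algebraMap_eq fun _ => rfl
  have h4 := hL.1
  have hmul := Module.finrank_mul_finrank K F L
  rw [hF, h4] at hmul
  have h2 : Module.finrank F L = 2 := by omega
  have : FiniteDimensional ℚ_[2] F := finiteDimensional_padic_of_finrank Ω (by omega)
  have : FiniteDimensional ℚ_[2] L := finiteDimensional_padic_of_finrank Ω (by omega)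
  have : IsScalarTower ℚ_[2] F L := IsScalarTower.of_algebraMap_eq fun _ => rfl
  have hT := (isTotallyRamified_tower_iff hF h2).1 hL.2.1
  obtain ⟨a, b, ha, -, -⟩ := idealVal_discIdeal_tower hF h2 hT.1 hT.2
  have hFa : F ∈ quadSet K Ω a := ⟨hF, hT.1, ha⟩
  obtain ⟨p, hp⟩ := exists_isUniformizer K
  refine ⟨a, ?_, hFa⟩
  rcases quadSet_nonempty Ω hp ⟨F, hFa⟩ with h | ⟨k, hk, h⟩ <;> omega

variable (K Ω) in
/-- The pairs `F ≤ L` with `L/K` totally ramified quartic of discriminant exponent `m` and `F/K`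
quadratic. -/
def towers (m : ℕ) : Set (IntermediateField K Ω × IntermediateField K Ω) :=
  {z | Module.finrank K z.1 = 2 ∧ z.2 ∈ quarticSet K Ω m ∧ z.1 ≤ z.2}

/-- The number of towers, for absolute ramification index `e` and residue cardinality `q`. -/
def towerCount (e q m : ℕ) : ℕ := ∑ a ∈ Finset.range (2 * e + 2),
  quadCount e q a * if 2 * a ≤ m then quadCount (2 * e) q (m - 2 * a) else 0

theorem eq_of_mem_quadSet {F : IntermediateField K Ω} {a b : ℕ} (ha : F ∈ quadSet K Ω a)
    (hb : F ∈ quadSet K Ω b) : a = b := by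
  have h := ha.2.2.symm.trans hb.2.2
  exact_mod_cast h

variable (K Ω) in
theorem towers_card (m : ℕ) : (towers K Ω m).Finite ∧
    (towers K Ω m).ncard = towerCount (absRamificationIdx K) (residueCard K) m := by
  classical
  let T : ℕ → Set (IntermediateField K Ω × IntermediateField K Ω) := fun a =>
    {z | z.1 ∈ quadSet K Ω a ∧ z.2 ∈ {L | L ∈ quarticSet K Ω m ∧ z.1 ≤ L}}
  have hT : ∀ a, (T a).Finite ∧ (T a).ncard = quadCount (absRamificationIdx K) (residueCard K) a *
      if 2 * a ≤ m then
        quadCount (2 * absRamificationIdx K) (residueCard K) (m - 2 * a) else 0 := by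
    intro a
    have h := quadSet_card (K := K) Ω a
    rw [← h.2]
    exact ncard_prod_fibre h.1 (fun F hF => (quarticSet_above hF m).1)
      (fun F hF => (quarticSet_above hF m).2)
  have hU : towers K Ω m = ⋃ a ∈ Finset.range (2 * absRamificationIdx K + 2), T a := by
    ext ⟨F, L⟩
    simp only [Set.mem_iUnion, Finset.mem_range]
    constructor
    · rintro ⟨h1, h2, h3⟩
      obtain ⟨a, ha, hF⟩ := exists_mem_quadSet_of_le h3 h1 h2
      exact ⟨a, ha, hF, h2, h3⟩
    · rintro ⟨a, -, hF, h2, h3⟩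
      exact ⟨hF.1, h2, h3⟩
  choose Z hZ using fun a => (hT a).1.exists_finset_coe
  have hU' : towers K Ω m =
      ((Finset.range (2 * absRamificationIdx K + 2)).biUnion Z : Finset _) := by
    rw [hU, Finset.coe_biUnion]
    simp only [hZ]
    rfl
  rw [hU']
  refine ⟨Finset.finite_toSet _, ?_⟩
  rw [Set.ncard_coe_finset, Finset.card_biUnion]
  · refine Finset.sum_congr rfl fun a _ => ?_
    rw [← (hT a).2, ← hZ a, Set.ncard_coe_finset]
  · intro a _ b _ hab
    change Disjoint (Z a) (Z b)
    rw [Finset.disjoint_left]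
    intro z hza hzb
    rw [← Finset.mem_coe, hZ] at hza hzb
    exact hab (eq_of_mem_quadSet hza.1 hzb.1)

theorem quadCount_ne_zero {e q n : ℕ} (h : quadCount e q n ≠ 0) :
    n = 2 * e + 1 ∨ Even n ∧ 2 ≤ n ∧ n ≤ 2 * e := by
  rw [quadCount] at h
  split_ifs at h with h1 h2
  · exact Or.inl h1
  · exact Or.inr h2
  · exact absurd rfl h

/-- The possible discriminants of a tower. -/
theorem exists_of_mem_towers {m : ℕ} {z : IntermediateField K Ω × IntermediateField K Ω}
    (hz : z ∈ towers K Ω m) : ∃ a b, m = 2 * a + b ∧ z.1 ∈ quadSet K Ω a ∧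
      (a = 2 * absRamificationIdx K + 1 ∨ Even a ∧ 2 ≤ a ∧ a ≤ 2 * absRamificationIdx K) ∧
      (b = 2 * (2 * absRamificationIdx K) + 1 ∨
        Even b ∧ 2 ≤ b ∧ b ≤ 2 * (2 * absRamificationIdx K)) := by
  obtain ⟨h1, h2, h3⟩ := hz
  obtain ⟨a, -, hF⟩ := exists_mem_quadSet_of_le h3 h1 h2
  have hab := quarticSet_above hF m
  have hne : {L | L ∈ quarticSet K Ω m ∧ z.1 ≤ L}.ncard ≠ 0 :=
    Set.ncard_ne_zero_of_mem (a := z.2) ⟨h2, h3⟩ hab.1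
  rw [hab.2] at hne
  have hq := quadSet_card (K := K) Ω a
  have hne' : (quadSet K Ω a).ncard ≠ 0 := Set.ncard_ne_zero_of_mem hF hq.1
  rw [hq.2] at hne'
  split_ifs at hne with h
  · exact ⟨a, m - 2 * a, by omega, hF, quadCount_ne_zero hne', quadCount_ne_zero hne⟩
  · exact absurd rfl hne

end Towers

/-! ### Counting towers by their quartic field -/

section IsoClasses

variable (K : Type*) [Field K] [Algebra ℚ_[2] K] [FiniteDimensional ℚ_[2] K]

/-- The totally ramified quartic extensions of `K` of type `G` and discriminant exponent `m`. -/
def typeSet (G : Type) [Group G] (m : ℕ) : Set (IntermediateField K (AlgebraicClosure K)) :=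
  {L | IsQuarticOfType K L G m}

variable {K}

theorem SigmaSet_eq_image (G : Type) [Group G] (m : ℕ) :
    SigmaSet K G m = Quotient.mk (isoSetoid K) '' typeSet K G m := by
  ext c
  exact ⟨fun ⟨L, h, hL⟩ => ⟨L, hL, h⟩, fun ⟨L, hL, h⟩ => ⟨L, h, hL⟩⟩

theorem mem_typeSet_D4_iff {m : ℕ} {L : IntermediateField K (AlgebraicClosure K)} :
    L ∈ typeSet K D4 m ↔ L ∈ quarticSet K (AlgebraicClosure K) m ∧ ¬ IsGalois K L ∧
      (quadSubfields K L).Nonempty := by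
  have := charZero_of_algebra_padic K
  constructor
  · rintro ⟨h4, h1, h2, h3⟩
    exact ⟨⟨h4, h1, h2⟩, (nonempty_mulEquiv_D4_iff h4).1 h3⟩
  · rintro ⟨⟨h4, h1, h2⟩, h3⟩
    exact ⟨h4, h1, h2, (nonempty_mulEquiv_D4_iff h4).2 h3⟩

theorem mem_typeSet_iff_of_card {G : Type} [Group G] (hG : Nat.card G = 4) {m : ℕ}
    {L : IntermediateField K (AlgebraicClosure K)} :
    L ∈ typeSet K G m ↔ L ∈ quarticSet K (AlgebraicClosure K) m ∧ IsGalois K L ∧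
      Nonempty ((L ≃ₐ[K] L) ≃* G) := by
  have := charZero_of_algebra_padic K
  constructor
  · rintro ⟨h4, h1, h2, h3⟩
    exact ⟨⟨h4, h1, h2⟩, (nonempty_mulEquiv_iff_of_card_eq_four h4 hG).1 h3⟩
  · rintro ⟨⟨h4, h1, h2⟩, h3⟩
    exact ⟨h4, h1, h2, (nonempty_mulEquiv_iff_of_card_eq_four h4 hG).2 h3⟩

theorem quadSubfields_nonempty_congr {L L' : Type*} [Field L] [Algebra K L] [Field L']
    [Algebra K L'] (f : L ≃ₐ[K] L') (h : (quadSubfields K L).Nonempty) :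
    (quadSubfields K L').Nonempty := by
  obtain ⟨F, hF⟩ := h
  refine ⟨F.map f.toAlgHom, ?_⟩
  exact (intermediateFieldMap f F).toLinearEquiv.finrank_eq.symm.trans hF

theorem typeSet_D4_congr {m : ℕ} {L L' : IntermediateField K (AlgebraicClosure K)}
    (f : L ≃ₐ[K] L') (hL : L ∈ typeSet K D4 m) : L' ∈ typeSet K D4 m := by
  rw [mem_typeSet_D4_iff] at hL ⊢
  exact ⟨quarticSet_congr f hL.1, fun h => hL.2.1 (f.transfer_galois.2 h),
    quadSubfields_nonempty_congr f hL.2.2⟩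

theorem typeSet_congr_of_card {G : Type} [Group G] (hG : Nat.card G = 4) {m : ℕ}
    {L L' : IntermediateField K (AlgebraicClosure K)}
    (f : L ≃ₐ[K] L') (hL : L ∈ typeSet K G m) : L' ∈ typeSet K G m := by
  rw [mem_typeSet_iff_of_card hG] at hL ⊢
  obtain ⟨h1, h2, ⟨g⟩⟩ := hL
  exact ⟨quarticSet_congr f h1, f.transfer_galois.1 h2, ⟨f.symm.autCongr.trans g⟩⟩

/-- The members of one isomorphism class are the conjugates of `L`, of which there are `4 / |Aut
L|`. The constant `c` will be 2 for `D4` and 1 for the groups of order 4. -/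
theorem ncard_typeSet {G : Type} [Group G] {m c : ℕ} (hfin : (typeSet K G m).Finite)
    (hcongr : ∀ {L L' : IntermediateField K (AlgebraicClosure K)}, (L ≃ₐ[K] L') →
      L ∈ typeSet K G m → L' ∈ typeSet K G m)
    (hc : ∀ L ∈ typeSet K G m, c * Nat.card (L ≃ₐ[K] L) = 4) :
    (typeSet K G m).ncard = c * (SigmaSet K G m).ncard := by
  have := charZero_of_algebra_padic K
  rw [SigmaSet_eq_image]
  refine ncard_eq_mul_ncard_image hfin _ fun L hL => ?_
  have hset : {L' ∈ typeSet K G m | Quotient.mk (isoSetoid K) L' = Quotient.mk (isoSetoid K) L} =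
      {L' : IntermediateField K (AlgebraicClosure K) | Nonempty (L' ≃ₐ[K] L)} := by
    ext L'
    constructor
    · rintro ⟨-, h⟩
      exact Quotient.exact h
    · rintro ⟨f⟩
      exact ⟨hcongr f.symm hL, Quotient.sound (s := isoSetoid K) ⟨f⟩⟩
  have h4 : Module.finrank K L = 4 := hL.1
  have : FiniteDimensional K L := FiniteDimensional.of_finrank_pos (by omega)
  have h1 := ncard_conjugates_mul_card_aut L
  rw [h4, ← hc L hL] at h1
  rw [hset]
  refine Nat.eq_of_mul_eq_mul_right (Nat.pos_of_ne_zero fun h0 => ?_) h1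
  have := hc L hL
  rw [h0] at this
  omega

theorem card_C4 : Nat.card C4 = 4 := card_eq_four_iff.2 (Or.inl ⟨MulEquiv.refl _⟩)

theorem card_V4 : Nat.card V4 = 4 := card_eq_four_iff.2 (Or.inr ⟨MulEquiv.refl _⟩)

/-- The quadratic subextensions of `L` as subfields of the algebraic closure. -/
theorem quadratic_le_eq_image (L : IntermediateField K (AlgebraicClosure K)) :
    {F : IntermediateField K (AlgebraicClosure K) | Module.finrank K F = 2 ∧ F ≤ L} =
      lift '' quadSubfields K L := by
  ext F
  constructor
  · rintro ⟨h, hF⟩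
    refine ⟨restrict hF, ?_, lift_restrict hF⟩
    exact (restrictAlgEquiv hF).toLinearEquiv.finrank_eq.symm.trans h
  · rintro ⟨F, hF, rfl⟩
    exact ⟨(liftAlgEquiv F).toLinearEquiv.finrank_eq.symm.trans hF, lift_le F⟩

theorem ncard_towers_of_type {X : Set (IntermediateField K (AlgebraicClosure K))} (hX : X.Finite)
    {c : ℕ} (hc0 : c ≠ 0) (hc : ∀ L ∈ X, (quadSubfields K L).ncard = c) :
    {z : IntermediateField K (AlgebraicClosure K) × IntermediateField K (AlgebraicClosure K) |
      Module.finrank K z.1 = 2 ∧ z.2 ∈ X ∧ z.1 ≤ z.2}.ncard = X.ncard * c := by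
  have hY : ∀ L ∈ X, {F : IntermediateField K (AlgebraicClosure K) |
      Module.finrank K F = 2 ∧ F ≤ L}.ncard = c := by
    intro L hL
    rw [quadratic_le_eq_image, Set.ncard_image_of_injective _ (lift_injective L), hc L hL]
  have h := ncard_prod_fibre hX (Y := fun L => {F : IntermediateField K (AlgebraicClosure K) |
      Module.finrank K F = 2 ∧ F ≤ L})
    (fun L hL => Set.finite_of_ncard_ne_zero (by rw [hY L hL]; exact hc0)) hY
  rw [← h.2, ← Set.ncard_image_of_injective {z | z.1 ∈ X ∧ _} Prod.swap_injective]
  refine congrArg Set.ncard ?_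
  ext ⟨F, L⟩
  constructor
  · rintro ⟨h1, h2, h3⟩
    exact ⟨(L, F), ⟨h2, h1, h3⟩, rfl⟩
  · rintro ⟨⟨L', F'⟩, ⟨h2, h1, h3⟩, h⟩
    obtain ⟨rfl, rfl⟩ := Prod.mk.inj h
    exact ⟨h1, h2, h3⟩

theorem quadSubfields_nonempty_iff {L : IntermediateField K (AlgebraicClosure K)} :
    (quadSubfields K L).Nonempty ↔
      ∃ F : IntermediateField K (AlgebraicClosure K), Module.finrank K F = 2 ∧ F ≤ L := by
  rw [← Set.image_nonempty (f := lift), ← quadratic_le_eq_image]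
  rfl

theorem ncard_quadSubfields_D4 {m : ℕ} {L : IntermediateField K (AlgebraicClosure K)}
    (hL : L ∈ typeSet K D4 m) : (quadSubfields K L).ncard = 1 := by
  have := charZero_of_algebra_padic K
  rw [mem_typeSet_D4_iff] at hL
  exact ncard_quadSubfields_of_not_isGalois hL.1.1 hL.2.1 hL.2.2

theorem ncard_quadSubfields_C4 {m : ℕ} {L : IntermediateField K (AlgebraicClosure K)}
    (hL : L ∈ typeSet K C4 m) : (quadSubfields K L).ncard = 1 := by
  have := charZero_of_algebra_padic K
  rw [mem_typeSet_iff_of_card card_C4] at hL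
  obtain ⟨h1, h2, ⟨f⟩⟩ := hL
  rw [ncard_quadSubfields_of_isGalois h1.1, ncard_subgroups_card_two_C4 f]

theorem ncard_quadSubfields_V4 {m : ℕ} {L : IntermediateField K (AlgebraicClosure K)}
    (hL : L ∈ typeSet K V4 m) : (quadSubfields K L).ncard = 3 := by
  have := charZero_of_algebra_padic K
  rw [mem_typeSet_iff_of_card card_V4] at hL
  obtain ⟨h1, h2, ⟨f⟩⟩ := hL
  rw [ncard_quadSubfields_of_isGalois h1.1, ncard_subgroups_card_two_V4 f]

theorem exists_mem_towers {G : Type} [Group G] {m : ℕ}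
    {L : IntermediateField K (AlgebraicClosure K)} (hL : L ∈ typeSet K G m)
    (h : (quadSubfields K L).ncard ≠ 0) : ∃ F, (F, L) ∈ towers K (AlgebraicClosure K) m := by
  obtain ⟨F, h1, h2⟩ := quadSubfields_nonempty_iff.1 (Set.nonempty_of_ncard_ne_zero h)
  exact ⟨F, h1, ⟨hL.1, hL.2.1, hL.2.2.1⟩, h2⟩

/-- A field with a quadratic subfield is the top of a tower, and there are finitely many towers. -/
theorem finite_typeSet {G : Type} [Group G] {m : ℕ}
    (h : ∀ L ∈ typeSet K G m, (quadSubfields K L).ncard ≠ 0) : (typeSet K G m).Finite := by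
  refine ((towers_card K (AlgebraicClosure K) m).1.image Prod.snd).subset fun L hL => ?_
  obtain ⟨F, hF⟩ := exists_mem_towers hL (h L hL)
  exact ⟨_, hF, rfl⟩

theorem finite_typeSet_D4 (m : ℕ) : (typeSet K D4 m).Finite :=
  finite_typeSet fun _ hL => by rw [ncard_quadSubfields_D4 hL]; norm_num

theorem finite_typeSet_C4 (m : ℕ) : (typeSet K C4 m).Finite :=
  finite_typeSet fun _ hL => by rw [ncard_quadSubfields_C4 hL]; norm_num

theorem finite_typeSet_V4 (m : ℕ) : (typeSet K V4 m).Finite :=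
  finite_typeSet fun _ hL => by rw [ncard_quadSubfields_V4 hL]; norm_num

theorem ncard_typeSet_D4 (m : ℕ) : (typeSet K D4 m).ncard = 2 * (SigmaSet K D4 m).ncard := by
  have := charZero_of_algebra_padic K
  refine ncard_typeSet (finite_typeSet_D4 m) typeSet_D4_congr fun L hL => ?_
  rw [mem_typeSet_D4_iff] at hL
  rw [card_aut_of_not_isGalois hL.1.1 hL.2.1 hL.2.2]

theorem ncard_typeSet_of_card {G : Type} [Group G] (hG : Nat.card G = 4) {m : ℕ}
    (hfin : (typeSet K G m).Finite) : (typeSet K G m).ncard = (SigmaSet K G m).ncard := by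
  rw [ncard_typeSet (c := 1) hfin (typeSet_congr_of_card hG), one_mul]
  intro L hL
  rw [mem_typeSet_iff_of_card hG] at hL
  rw [Nat.card_congr hL.2.2.some.toEquiv, hG]

/-- The number of towers in terms of isomorphism classes of quartic extensions. -/
theorem ncard_towers_eq (m : ℕ) : (towers K (AlgebraicClosure K) m).ncard =
    2 * (SigmaSet K D4 m).ncard + (SigmaSet K C4 m).ncard + 3 * (SigmaSet K V4 m).ncard := by
  have := charZero_of_algebra_padic K
  let T : Set (IntermediateField K (AlgebraicClosure K)) →
      Set (IntermediateField K (AlgebraicClosure K) × IntermediateField K (AlgebraicClosure K)) :=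
    fun X => {z | Module.finrank K z.1 = 2 ∧ z.2 ∈ X ∧ z.1 ≤ z.2}
  have hU : towers K (AlgebraicClosure K) m =
      (T (typeSet K D4 m) ∪ T (typeSet K C4 m)) ∪ T (typeSet K V4 m) := by
    ext ⟨F, L⟩
    constructor
    · rintro ⟨h1, h2, h3⟩
      by_cases hG : IsGalois K L
      · have : FiniteDimensional K L := FiniteDimensional.of_finrank_pos (by rw [h2.1]; norm_num)
        have hcard : Nat.card (L ≃ₐ[K] L) = 4 := by rw [IsGalois.card_aut_eq_finrank, h2.1]
        rcases card_eq_four_iff.1 hcard with h | h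
        · exact Or.inl (Or.inr ⟨h1, (mem_typeSet_iff_of_card card_C4).2 ⟨h2, hG, h⟩, h3⟩)
        · exact Or.inr ⟨h1, (mem_typeSet_iff_of_card card_V4).2 ⟨h2, hG, h⟩, h3⟩
      · exact Or.inl (Or.inl ⟨h1, mem_typeSet_D4_iff.2
          ⟨h2, hG, quadSubfields_nonempty_iff.2 ⟨F, h1, h3⟩⟩, h3⟩)
    · rintro ((⟨h1, h2, h3⟩ | ⟨h1, h2, h3⟩) | ⟨h1, h2, h3⟩) <;>
        exact ⟨h1, ⟨h2.1, h2.2.1, h2.2.2.1⟩, h3⟩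
  have hfin := (towers_card K (AlgebraicClosure K) m).1
  rw [hU] at hfin ⊢
  have hfin1 := hfin.subset Set.subset_union_left
  rw [Set.ncard_union_eq _ hfin1 (hfin.subset Set.subset_union_right),
    Set.ncard_union_eq _ (hfin1.subset Set.subset_union_left)
      (hfin1.subset Set.subset_union_right),
    ncard_towers_of_type (finite_typeSet_D4 m) one_ne_zero fun L hL => ncard_quadSubfields_D4 hL,
    ncard_towers_of_type (finite_typeSet_C4 m) one_ne_zero fun L hL => ncard_quadSubfields_C4 hL,
    ncard_towers_of_type (finite_typeSet_V4 m) three_ne_zero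
      fun L hL => ncard_quadSubfields_V4 hL,
    ncard_typeSet_D4, ncard_typeSet_of_card card_C4 (finite_typeSet_C4 m),
    ncard_typeSet_of_card card_V4 (finite_typeSet_V4 m)]
  · ring
  · rw [Set.disjoint_left]
    rintro z ⟨-, h2, -⟩ ⟨-, h3, -⟩
    exact (mem_typeSet_D4_iff.1 h2).2.1 ((mem_typeSet_iff_of_card card_C4).1 h3).2.1
  · rw [Set.disjoint_left]
    rintro z (⟨-, h2, -⟩ | ⟨-, h2, -⟩) ⟨-, h3, -⟩
    · exact (mem_typeSet_D4_iff.1 h2).2.1 ((mem_typeSet_iff_of_card card_V4).1 h3).2.1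
    · obtain ⟨f⟩ := ((mem_typeSet_iff_of_card card_C4).1 h2).2.2
      obtain ⟨g⟩ := ((mem_typeSet_iff_of_card card_V4).1 h3).2.2
      exact not_nonempty_mulEquiv_C4_V4 f g

theorem finite_SigmaSet (m : ℕ) : (SigmaSet K D4 m).Finite ∧ (SigmaSet K C4 m).Finite ∧
    (SigmaSet K V4 m).Finite := by
  simp only [SigmaSet_eq_image]
  exact ⟨(finite_typeSet_D4 m).image _, (finite_typeSet_C4 m).image _,
    (finite_typeSet_V4 m).image _⟩

/-- There are no biquadratic extensions of maximal discriminant. -/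
theorem SigmaSet_V4_eq_empty : SigmaSet K V4 (8 * absRamificationIdx K + 3) = ∅ := by
  have hch := charZero_of_algebra_padic K
  obtain ⟨p, hp⟩ := exists_isUniformizer K
  rw [SigmaSet_eq_image, Set.image_eq_empty, Set.eq_empty_iff_forall_notMem]
  intro L hL
  have hquad : ∀ F : IntermediateField K (AlgebraicClosure K), Module.finrank K F = 2 → F ≤ L →
      F ∈ quadSet K (AlgebraicClosure K) (2 * absRamificationIdx K + 1) := by
    intro F h1 h2
    obtain ⟨a, b, hab, hF, ha, hb⟩ := exists_of_mem_towers
      (z := (F, L)) ⟨h1, ⟨hL.1, hL.2.1, hL.2.2.1⟩, h2⟩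
    -- The value `m = 8e + 3` is reached only when both steps have their maximal exponents `2e + 1`
    -- and `4e + 1`.
    obtain rfl : a = 2 * absRamificationIdx K + 1 := by omega
    exact hF
  have h3 : 1 < {F : IntermediateField K (AlgebraicClosure K) |
      Module.finrank K F = 2 ∧ F ≤ L}.ncard := by
    rw [quadratic_le_eq_image, Set.ncard_image_of_injective _ (lift_injective L),
      ncard_quadSubfields_V4 hL]
    norm_num
  obtain ⟨F₁, F₂, ⟨h1, h1L⟩, ⟨h2, h2L⟩, hne⟩ :=
    (Set.one_lt_ncard_iff (Set.finite_of_ncard_ne_zero (by omega))).1 h3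
  obtain ⟨a, rfl⟩ := exists_eq_sqrtField _ h1
  obtain ⟨b, rfl⟩ := exists_eq_sqrtField _ h2
  have hodd : ∀ c : Kˣ, sqrtField (AlgebraicClosure K) c ∈
      quadSet K (AlgebraicClosure K) (2 * absRamificationIdx K + 1) → c ∉ sqFiltration p 0 := by
    intro c hc hc0
    rw [quadSet_odd _ hp] at hc
    obtain ⟨d, ⟨-, hd⟩, hdc⟩ := hc
    rw [sqrtField_eq_iff] at hdc
    have hs : squares K ≤ sqFiltration p 0 := le_sup_right
    have h := div_mem hc0 (hs hdc)
    rw [div_div_cancel] at h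
    exact hd h
  have ha := hodd a (hquad _ h1 h1L)
  have hb := hodd b (hquad _ h2 h2L)
  -- The valuation of `ab` is even as a sum of two odd ones. Yet `√(ab)` generates a further
  -- quadratic subfield of `L`, whose class would also have odd valuation.
  have hab : a * b ∈ sqFiltration p 0 :=
    (Subgroup.mul_mem_iff_of_index_two (index_sqFiltration_zero hp)).2 (iff_of_false ha hb)
  have habs : a * b ∉ squares K := by
    intro h
    refine hne ((sqrtField_eq_iff _ a b).2 ?_)
    have h' : b / a = (a * b) / a ^ 2 := by
      rw [sq, mul_div_mul_left_eq_div]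
    rw [h']
    exact div_mem h ⟨a, rfl⟩
  refine hodd (a * b) (hquad _ (finrank_sqrtField _ habs) ?_) hab
  rw [sqrtField, adjoin_simple_le_iff]
  have hsq : sqrtIn (AlgebraicClosure K) (a * b) ^ 2 =
      (sqrtIn (AlgebraicClosure K) a * sqrtIn (AlgebraicClosure K) b) ^ 2 := by
    rw [mul_pow, sqrtIn_sq, sqrtIn_sq, sqrtIn_sq, Units.val_mul, map_mul]
  have hmem : sqrtIn (AlgebraicClosure K) a * sqrtIn (AlgebraicClosure K) b ∈ L :=
    mul_mem (h1L (mem_adjoin_simple_self K _)) (h2L (mem_adjoin_simple_self K _))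
  rcases sq_eq_sq_iff_eq_or_eq_neg.1 hsq with h | h
  · rw [h]
    exact hmem
  · rw [h]
    exact neg_mem hmem

end IsoClasses

end

noncomputable section

/-! ### Evaluation of the sum over towers -/

section Counting

theorem quadCount_two_mul_add_one (e q : ℕ) : quadCount e q (2 * e + 1) = 2 * q ^ e :=
  if_pos rfl

theorem quadCount_two_mul {e q k : ℕ} (h1 : 1 ≤ k) (h2 : k ≤ e) :
    quadCount e q (2 * k) = 2 * (q - 1) * q ^ (k - 1) := by
  rw [quadCount, if_neg (by omega), if_pos ⟨even_two_mul k, by omega, by omega⟩,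
    Nat.mul_div_cancel_left k two_pos]

theorem quadCount_eq_zero {e q n : ℕ} (h1 : n ≠ 2 * e + 1)
    (h2 : n % 2 = 1 ∨ n < 2 ∨ 2 * e < n) : quadCount e q n = 0 := by
  rw [quadCount, if_neg h1, if_neg]
  rintro ⟨h3, h4, h5⟩
  rw [Nat.even_iff] at h3
  omega

/-- The sum telescopes, because `(q - 1) q^(-j) = q^(1-j) - q^(-j)`. -/
theorem sum_Ico_sub_one_mul_zpow_neg {q : ℚ} (hq : q ≠ 0) {a b : ℕ} (h : a ≤ b) :
    ∑ j ∈ Finset.Ico a b, (q - 1) * q ^ (-(j : ℤ)) = q ^ (1 - (a : ℤ)) - q ^ (1 - (b : ℤ)) := by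
  induction b, h using Nat.le_induction with
  | base => simp
  | succ n hn ih =>
    rw [Finset.sum_Ico_succ_top hn, ih, sub_mul, ← zpow_one_add₀ hq, one_mul]
    push_cast
    rw [show (1 : ℤ) - (n + 1) = -n by ring, show (1 : ℤ) + -n = 1 - n by ring]
    ring

theorem towerCount_max (e q : ℕ) : towerCount e q (8 * e + 3) = 4 * q ^ (3 * e) := by
  rw [towerCount, Finset.sum_eq_single (2 * e + 1)]
  · rw [if_pos (by omega), show 8 * e + 3 - 2 * (2 * e + 1) = 2 * (2 * e) + 1 by omega,
      quadCount_two_mul_add_one, quadCount_two_mul_add_one]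
    ring
  · intro a ha hne
    rw [Finset.mem_range] at ha
    rw [if_pos (by omega), quadCount_eq_zero (n := 8 * e + 3 - 2 * a) (by omega) (by omega),
      mul_zero]
  · intro h
    exact absurd (Finset.mem_range.2 (by omega)) h

/-- An odd `m` needs an odd upper exponent, which can only be `4e + 1`; this leaves the single term
`a = 2k`. -/
theorem towerCount_odd {e q k : ℕ} (h1 : 1 ≤ k) (h2 : k ≤ e) :
    towerCount e q (4 * (e + k) + 1) = 4 * (q - 1) * q ^ (2 * e + k - 1) := by
  rw [towerCount, Finset.sum_eq_single (2 * k)]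
  · rw [if_pos (by omega), show 4 * (e + k) + 1 - 2 * (2 * k) = 2 * (2 * e) + 1 by omega,
      quadCount_two_mul_add_one, quadCount_two_mul h1 h2,
      show 2 * e + k - 1 = (k - 1) + 2 * e by omega, pow_add]
    ring
  · intro a ha hne
    rw [Finset.mem_range] at ha
    split_ifs
    · rw [quadCount_eq_zero (n := 4 * (e + k) + 1 - 2 * a) (by omega) (by omega), mul_zero]
    · rw [mul_zero]
  · intro h
    exact absurd (Finset.mem_range.2 (by omega)) h

/-- The term `a = 2e + 1` needs `b = 2k - 4e - 2 ≥ 2`, which is the indicator. The terms `a = 2j`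
need `1 ≤ j ≤ e` and `1 ≤ k - 2j ≤ 2e`, which gives the `max` and `min` as the ends of the range;
each contributes `4(q - 1)² q^(k - 2 - j)`, and their sum telescopes. -/
theorem towerCount_even {e q k : ℕ} (hq : 1 ≤ q) (h1 : 3 ≤ k) (h2 : k ≤ 4 * e + 1) :
    (towerCount e q (2 * k) : ℚ) = 4 * ((q : ℚ) - 1) * (q : ℚ) ^ ((k : ℤ) - 2) *
      ((if 2 * e + 2 ≤ k then 1 else 0) * (q : ℚ) ^ (-(e : ℤ)) +
        ((q : ℚ) ^ (1 - ((max 1 ((k + 1) / 2 - e) : ℕ) : ℤ)) -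
          (q : ℚ) ^ (-((min e ((k - 1) / 2) : ℕ) : ℤ)))) := by
  have hq0 : (q : ℚ) ≠ 0 := by exact_mod_cast (by omega : q ≠ 0)
  have hq1 : ((q - 1 : ℕ) : ℚ) = (q : ℚ) - 1 := by rw [Nat.cast_sub hq, Nat.cast_one]
  obtain ⟨A, hA⟩ : ∃ A, A = max 1 ((k + 1) / 2 - e) := ⟨_, rfl⟩
  obtain ⟨B, hB⟩ : ∃ B, B = min e ((k - 1) / 2) := ⟨_, rfl⟩
  rw [towerCount, ← hA, ← hB, Finset.sum_range_succ, Nat.cast_add, add_comm,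
    mul_add (4 * ((q : ℚ) - 1) * _)]
  congr 1
  · rw [quadCount_two_mul_add_one]
    by_cases h : 2 * e + 2 ≤ k
    · rw [if_pos (by omega), if_pos h, show 2 * k - 2 * (2 * e + 1) = 2 * (k - 2 * e - 1) by omega,
        quadCount_two_mul (by omega) (by omega)]
      push_cast
      rw [hq1, one_mul, mul_assoc _ ((q : ℚ) ^ _) ((q : ℚ) ^ _), ← zpow_add₀ hq0,
        show (k : ℤ) - 2 + -e = (e : ℤ) + (k - 2 * e - 1 - 1 : ℕ) by omega, zpow_add₀ hq0,
        zpow_natCast, zpow_natCast]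
      ring
    · rw [if_neg h, zero_mul, mul_zero]
      split_ifs
      · rw [quadCount_eq_zero (n := 2 * k - 2 * (2 * e + 1)) (by omega) (by omega), mul_zero,
          Nat.cast_zero]
      · rw [mul_zero, Nat.cast_zero]
  · have hsum := sum_Ico_sub_one_mul_zpow_neg hq0 (a := A) (b := B + 1) (by omega)
    rw [show (1 : ℤ) - (B + 1 : ℕ) = -B by push_cast; ring] at hsum
    rw [← hsum, Finset.mul_sum, Nat.cast_sum]
    symm
    refine Finset.sum_of_injOn (fun j => 2 * j)
      (fun _ _ _ _ h => Nat.eq_of_mul_eq_mul_left two_pos h) ?_ ?_ ?_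
    · intro j hj
      rw [Finset.mem_coe, Finset.mem_Ico] at hj
      refine Finset.mem_coe.2 (Finset.mem_range.2 ?_)
      change 2 * j < 2 * e + 1
      omega
    · intro a ha hne
      rw [Finset.mem_range] at ha
      have hne' : ∀ j, a = 2 * j → j < A ∨ B < j := by
        intro j hj
        by_contra hcon
        exact hne ⟨j, Finset.mem_coe.2 (Finset.mem_Ico.2 (by omega)), hj.symm⟩
      rcases Nat.even_or_odd' a with ⟨j, rfl | rfl⟩
      · have hj := hne' j rfl
        split_ifs
        · rcases Nat.eq_zero_or_pos j with rfl | hj0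
          · rw [quadCount_eq_zero (n := 2 * 0) (by omega) (by omega), zero_mul, Nat.cast_zero]
          · rw [quadCount_eq_zero (n := 2 * k - 2 * (2 * j)) (by omega) (by omega), mul_zero,
              Nat.cast_zero]
        · rw [mul_zero, Nat.cast_zero]
      · rw [quadCount_eq_zero (n := 2 * j + 1) (by omega) (by omega), zero_mul, Nat.cast_zero]
    · intro j hj
      rw [Finset.mem_Ico] at hj
      change _ = ((quadCount e q (2 * j) * if 2 * (2 * j) ≤ 2 * k then
        quadCount (2 * e) q (2 * k - 2 * (2 * j)) else 0 : ℕ) : ℚ)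
      rw [if_pos (by omega), show 2 * k - 2 * (2 * j) = 2 * (k - 2 * j) by omega,
        quadCount_two_mul (by omega) (by omega), quadCount_two_mul (by omega) (by omega)]
      push_cast
      have hpow : (q : ℚ) ^ ((k : ℤ) - 2) * (q : ℚ) ^ (-(j : ℤ)) =
          (q : ℚ) ^ (j - 1) * (q : ℚ) ^ (k - 2 * j - 1) := by
        rw [← zpow_add₀ hq0, ← zpow_natCast, ← zpow_natCast, ← zpow_add₀ hq0]
        congr 1
        omega
      rw [hq1]
      linear_combination 4 * ((q : ℚ) - 1) ^ 2 * hpow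

end Counting

end

end TwoAdic

/-! ### The main theorem -/

theorem mainTheorem2 (K : Type*) [Field K] [Algebra ℚ_[2] K] [FiniteDimensional ℚ_[2] K]
    (e q : ℕ) (he : e = TwoAdic.absRamificationIdx K) (hq : q = TwoAdic.residueCard K) (m : ℕ) :
    ((TwoAdic.SigmaSet K TwoAdic.D4 m).Finite ∧
      (TwoAdic.SigmaSet K TwoAdic.C4 m).Finite ∧
      (TwoAdic.SigmaSet K TwoAdic.V4 m).Finite) ∧
    ((TwoAdic.SigmaSet K TwoAdic.D4 m).Nonempty →
      (Even m ∧ 6 ≤ m ∧ m ≤ 8 * e + 2) ∨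
      (m ≡ 1 [MOD 4] ∧ 4 * e + 5 ≤ m ∧ m ≤ 8 * e + 1) ∨
      m = 8 * e + 3) ∧
    (Even m → 6 ≤ m → m ≤ 8 * e + 2 →
      ((TwoAdic.SigmaSet K TwoAdic.D4 m).ncard : ℚ) =
        2 * ((q : ℚ) - 1) * (q : ℚ) ^ ((m : ℤ) / 2 - 2) *
          ((if 4 * e + 4 ≤ m then 1 else 0) * (q : ℚ) ^ (-(e : ℤ)) +
            (if m ≤ 8 * e then 1 else 0) *
              ((q : ℚ) ^ (min 0 ((e : ℤ) + 1 - ⌈(m : ℚ) / 4⌉)) -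
                (q : ℚ) ^ (-(min ⌊((m : ℚ) - 2) / 4⌋ (e : ℤ)))))
        - 1 / 2 * ((TwoAdic.SigmaSet K TwoAdic.C4 m).ncard : ℚ)
        - 3 / 2 * ((TwoAdic.SigmaSet K TwoAdic.V4 m).ncard : ℚ)) ∧
    (m ≡ 1 [MOD 4] → 4 * e + 5 ≤ m → m ≤ 8 * e + 1 →
      ((TwoAdic.SigmaSet K TwoAdic.D4 m).ncard : ℚ) =
        2 * ((q : ℚ) - 1) * (q : ℚ) ^ ((e : ℤ) + ((m : ℤ) - 1) / 4 - 1)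
        - 1 / 2 * ((TwoAdic.SigmaSet K TwoAdic.C4 m).ncard : ℚ)
        - 3 / 2 * ((TwoAdic.SigmaSet K TwoAdic.V4 m).ncard : ℚ)) ∧
    (m = 8 * e + 3 →
      ((TwoAdic.SigmaSet K TwoAdic.D4 m).ncard : ℚ) =
        2 * (q : ℚ) ^ (3 * e)
        - 1 / 2 * ((TwoAdic.SigmaSet K TwoAdic.C4 m).ncard : ℚ)) := by
  subst he hq
  have hq1 : 1 ≤ TwoAdic.residueCard K := TwoAdic.residueCard_pos K
  -- The double count of towers; each formula below is this identity divided by 2.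
  have hcount := (TwoAdic.towers_card K (AlgebraicClosure K) m).2
  rw [TwoAdic.ncard_towers_eq] at hcount
  have hcount' := congrArg (Nat.cast (R := ℚ)) hcount
  push_cast at hcount'
  generalize TwoAdic.residueCard K = q at *
  refine ⟨TwoAdic.finite_SigmaSet m, ?_, ?_, ?_, ?_⟩
  · rw [TwoAdic.SigmaSet_eq_image, Set.image_nonempty]
    rintro ⟨L, hL⟩
    obtain ⟨F, hF⟩ := TwoAdic.exists_mem_towers hL
      (by rw [TwoAdic.ncard_quadSubfields_D4 hL]; exact one_ne_zero)
    obtain ⟨a, b, hm, -, ha, hb⟩ := TwoAdic.exists_of_mem_towers hF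
    -- From `m = 2a + b`: an even `b` gives an even `m`, from `2·2 + 2` up to `2(2e + 1) + 4e`. For
    -- `b = 4e + 1`, an even `a` gives the second case and `a = 2e + 1` the third.
    simp only [Nat.even_iff, Nat.ModEq] at *
    omega
  · intro hm h6 h8
    obtain ⟨k, rfl⟩ := hm.exists_two_nsmul
    rw [smul_eq_mul] at *
    rw [TwoAdic.towerCount_even hq1 (by omega) (by omega)] at hcount'
    generalize TwoAdic.absRamificationIdx K = e at *
    have hceil : ⌈((2 * k : ℕ) : ℚ) / 4⌉ = ((k + 1) / 2 : ℕ) := by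
      rw [Int.ceil_eq_iff]
      rcases Nat.even_or_odd' k with ⟨j, rfl | rfl⟩
      · rw [show (2 * j + 1) / 2 = j by omega]
        push_cast
        constructor <;> linarith
      · rw [show (2 * j + 1 + 1) / 2 = j + 1 by omega]
        push_cast
        constructor <;> linarith
    have hfloor : ⌊(((2 * k : ℕ) : ℚ) - 2) / 4⌋ = ((k - 1) / 2 : ℕ) := by
      rw [Int.floor_eq_iff]
      rcases Nat.even_or_odd' k with ⟨j, rfl | rfl⟩
      · obtain ⟨i, rfl⟩ : ∃ i, j = i + 1 := ⟨j - 1, by omega⟩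
        rw [show (2 * (i + 1) - 1) / 2 = i by omega]
        push_cast
        constructor <;> linarith
      · rw [show (2 * j + 1 - 1) / 2 = j by omega]
        push_cast
        constructor <;> linarith
    rw [hceil, hfloor, show ((2 * k : ℕ) : ℤ) / 2 - 2 = (k : ℤ) - 2 by omega,
      if_congr (show 4 * e + 4 ≤ 2 * k ↔ 2 * e + 2 ≤ k by omega) rfl rfl]
    by_cases hk : 2 * k ≤ 8 * e
    · rw [if_pos hk, one_mul,
        show min 0 ((e : ℤ) + 1 - ((k + 1) / 2 : ℕ)) =
          1 - ((max 1 ((k + 1) / 2 - e) : ℕ) : ℤ) by omega,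
        show min (((k - 1) / 2 : ℕ) : ℤ) (e : ℤ) = ((min e ((k - 1) / 2) : ℕ) : ℤ) by omega]
      linear_combination hcount' / 2
    -- Here `k = 4e + 1`, that is `m = 8e + 2`: the range of `j` is empty, so the two powers cancel,
    -- in agreement with the vanishing indicator.
    · rw [show 1 - ((max 1 ((k + 1) / 2 - e) : ℕ) : ℤ) = -e by omega,
        show min e ((k - 1) / 2) = e by omega] at hcount'
      rw [if_neg hk, zero_mul]
      linear_combination hcount' / 2
  · intro hm h1 h2
    rw [Nat.ModEq] at hm
    obtain ⟨k, rfl⟩ : ∃ k, m = 4 * (TwoAdic.absRamificationIdx K + k) + 1 :=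
      ⟨(m - 1) / 4 - TwoAdic.absRamificationIdx K, by omega⟩
    rw [TwoAdic.towerCount_odd (by omega) (by omega)] at hcount'
    push_cast [Nat.cast_sub hq1] at hcount'
    generalize TwoAdic.absRamificationIdx K = e at *
    rw [show (e : ℤ) + (((4 * (e + k) + 1 : ℕ) : ℤ) - 1) / 4 - 1 = (2 * e + k - 1 : ℕ) by omega,
      zpow_natCast]
    linear_combination hcount' / 2
  · rintro rfl
    rw [TwoAdic.towerCount_max, TwoAdic.SigmaSet_V4_eq_empty, Set.ncard_empty] at hcount'
    push_cast at hcount'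
    linear_combination hcount' / 2
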